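/- **Set-up: the classifying space.** Let $H_0=\mathbf Z^4=\bigoplus_{j=1}^4\mathbf Ze_j$ with the increasing filtration $W_{-3}=0\subset W_{-2}=\langle e_1\rangle\subset W_{-1}=\langle e_1,e_2,e_3\rangle\subset W_0=H_{0}$ (over $\mathbf R$). Let $e'_j$ be the image of $e_j$ in $\mathrm{gr}^W$, and put $\langle e'_1,e'_1\rangle=1$, $\langle e'_3,e'_2\rangle=1=-\langle e'_2,e'_3\rangle$, $\langle e'_4,e'_4\rangle=1$. Let $D$ be the classifying space of decreasing filtrations $F$ on $H_{0,\mathbf C}$ for which $(W,F)$ is a mixed Hodge structure whose graded quotients are polarized by these forms, with $h^{0,0}=h^{0,-1}=h^{-1,0}=h^{-1,-1}=1$ and all other $h^{p,q}=0$. For $\operatorname{Im}\tau>0$ and $z_1,z_2,z_3\in\mathbf C$ let $F(\tau,z_1,z_2,z_3)\in D$ be the filtration with $F^{-1}=H_{0,\mathbf C}$, $F^0=\mathbf C(z_1e_1+\tau e_2+e_3)+\mathbf C(z_2e_1+z_3e_2+e_4)$, $F^1=0$. Each $F\in D$ is uniquely $F=s(\exp(i\delta)F(\mathrm{gr}^W))$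 with $s=\mathrm{spl}_W(F)$ a real splitting of $W$ and $\delta$ an endomorphism $e'_4\mapsto d\,e'_1$, $e'_j\mapsto 0$ ($j\le3$) of $\mathrm{gr}^W$, $d\in\mathbf R$; write $\delta(F)=d\in L:=\mathbf R$, and $\bar L:=[-\infty,\infty]$. Let $G_{\mathbf Z}$ be the group of automorphisms of $(H_0,W)$ preserving the forms on $\mathrm{gr}^W$, and let $\Gamma\subset G_{\mathbf Z}$ be the subgroup of all $\gamma$ with $\gamma e_j-e_j\in\bigoplus_{k<j}\mathbf Ze_k$ for $j=1,\dots,4$. **The partial compactification.** Let $W'$ be the filtration of $\mathrm{gr}^W$ for which $e'_1,e'_2,e'_3,e'_4$ have weights $-2,-2,0,0$, and let $\Phi=\{W'\}$. Let $D^{II}_{SL(2)}(\Phi)$ be the set of classes of (rational, non-degenerate) $SL(2)$-orbits $((\rho_w,\varphi_w)_w,r)$, $r\in D$, such that every weight filtration $\ne W$ associated to the orbit induces $W'$ on $\mathrm{gr}^W$; it contains $D$ as the classes of rank $0$. For $F\in D$ let $\tau$ be the point of the upper half plane with $F^0(\mathrm{gr}^W_{-1})=\mathbf C(\tau e'_2+e'_3)$,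 put $\beta=(\operatorname{Im}\tau)^{-1/2}$ and $\alpha(t)=\mathrm{diag}(t^{-2},t^{-2},1,1)$, and let $$\nu(F)=\bigl(\beta,\ \alpha(\beta)^{-1}F(\mathrm{gr}^W),\ \mathrm{Ad}(\alpha(\beta))^{-1}\delta(F),\ \mathrm{spl}_W(F),\ \mathrm{spl}^{BS}_{W'}(F(\mathrm{gr}^W))\bigr)\in\mathbf R_{\ge0}\times D(\mathrm{gr}^W)\times\bar L\times\mathrm{spl}(W)\times\mathrm{spl}(W'),$$ where $\mathrm{spl}^{BS}$ is the Borel–Serre splitting. The map $\nu$ extends to $D^{II}_{SL(2)}(\Phi)$ by taking the limit along the torus orbit $\tau(t)r$ ($t\to0$) associated to an $SL(2)$-orbit. The topology of $D^{II}_{SL(2)}(\Phi)$ is induced by $\nu$, and its structure sheaf consists of the functions that are locally restrictions, through $\nu$, of real analytic functions; here $\bar L$ is a real analytic manifold with boundary, with coordinate $|d|^{-1/2}$ near $d=\pm\infty$. The quotient $\Gamma\backslash D^{II}_{SL(2)}(\Phi)$ has the quotient topology and the functions whose pull-backs belong to the structure sheaf. The $\bar L$-component of $\nu$ is the projection $D^{II}_{SL(2)}(\Phi)\simeq\mathrm{spl}(W)\times\bar{\mathfrak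 h}\times\bar L\to\bar L$; on $D$ it is $F\mapsto\delta(F)/\operatorname{Im}\tau$. **The family.** Let $\Delta=\{q\in\mathbf C:|q|<1\}$, $\Delta^*=\Delta\smallsetminus\{0\}$, and let $c\ge1$ be an integer. The family of elliptic curves over $\Delta^*$ with fibre $\mathbf C/(\mathbf Z\tau+\mathbf Z)$ over $e^{2\pi i\tau/c}$ has a Néron model $E_c$ over $\Delta$ with fibre $\mathbf C^\times\times\mathbf Z/c\mathbf Z$ over $0$. For $a\in\mathbf Q$ with $ca\in\mathbf Z$ and $u:\Delta\to\mathbf C^\times$ holomorphic, the section of $E_c$ given by $(a,u)$ is $e^{2\pi i\tau/c}\mapsto a\tau+(2\pi i)^{-1}\log u(e^{2\pi i\tau/c})\bmod\mathbf Z\tau+\mathbf Z$, with value $(u(0),ca\bmod c)$ at $0$. Let $m_j,n_k\in\mathbf Z$, $a_j,b_k\in\mathbf Q$ ($1\le j\le r$, $1\le k\le s$) with $\sum_jm_j=\sum_kn_k=0$ and $ca_j,cb_k\in\mathbf Z$, and let $u_j,v_k:\Delta\to\mathbf C^\times$ be holomorphic. Assume that, for all $j,k$, the section $p_j$ given by $(a_j,u_j)$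 and the section $q_k$ given by $(b_k,v_k)$ do not meet over $\Delta$. Let $\theta(\tau,z)=\prod_{n\ge0}(1-e^{2\pi in\tau}e^{2\pi iz})\prod_{n\ge1}(1-e^{2\pi in\tau}e^{-2\pi iz})$. For $q=e^{2\pi i\tau/c}\in\Delta^*$ choose lifts $z_j,w_k\in\mathbf C$ of $p_j(q),q_k(q)$ and $\lambda$ with $e^{2\pi i\lambda}=\prod_{j,k}\theta(\tau,z_j-w_k)^{m_jn_k}$. The class of $F(\tau,\sum_kn_kw_k,\lambda,\sum_jm_jz_j)$ in $\Gamma\backslash D$ is independent of the choices (of $\tau$, $z_j$, $w_k$, $\lambda$), and defines the period map $p:\Delta^*\to\Gamma\backslash D$ of the divisors $\sum_jm_j(p_j)$, $\sum_kn_k(q_k)$ of degree $0$. **The space $\Delta^{\log}$.** Let $\Delta^{\log}=[0,1)\times\mathbf S^1\supset\Delta^*$ (via $(r,u)\leftrightarrow ru$ for $r\ne0$). A function $h$ on an open subset of $\Delta^{\log}$ is $C^\infty$ if its pull-back under $\mathbf R_{\ge0}\times\mathbf R\to\Delta^{\log}$, $(t,x)\mapsto(e^{-1/t^2},e^{2\pi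 ix})$ (with $e^{-1/0^2}=0$), extends locally to $C^\infty$ functions on open subsets of $\mathbf R^2$. A map from $\Delta^{\log}$ is $C^\infty$ if it is a morphism of local ringed spaces over $\mathbf R$, i.e. is continuous and pulls sections of the structure sheaf back to $C^\infty$ functions. **Proposition.** Let $B_2(x)=x^2-x+\frac16$, and let $\{x\}\in[0,1)$ be the fractional part of $x\in\mathbf R$. (i) The map $p:\Delta^*\to\Gamma\backslash D$ extends to a $C^\infty$ map $\Delta^{\log}\to\Gamma\backslash D^{II}_{SL(2)}(\Phi)$ (compatibly with the map $\Gamma\backslash D\to\Gamma\backslash D^{II}_{SL(2)}(\Phi)$ induced by the inclusion $D\subset D^{II}_{SL(2)}(\Phi)$). (ii) The map $\delta:D\to\mathbf R$ factors through $\Gamma\backslash D$, and there is a $C^\infty$ function $h$ on $\Delta^{\log}$ such that, for all $x\in\mathbf R$ and $y>0$, $$\delta\bigl(p(e^{2\pi i(x+iy)/c})\bigr)=\tfrac12\Bigl(\sum_{j,k}m_jn_kB_2(\{a_j-b_k\})\Bigr)y+h(e^{2\pi i(x+iy)/c}).$$ (iii) The projection $D^{II}_{SL(2)}(\Phi)\to\bar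 L$ factors through $\Gamma\backslash D^{II}_{SL(2)}(\Phi)$, and its composite with the extended map of (i) sends every point of $\Delta^{\log}\smallsetminus\Delta^*$ to $$\tfrac12\sum_{j,k}m_jn_kB_2(\{a_j-b_k\})\in\mathbf R=L\subset\bar L.$$ -/

import Mathlib

open Filter Topology Matrix
open scoped ContDiff UpperHalfPlane

noncomputable section

namespace ExIV

/-! ### The lattice `ℤ⁴`, its weight filtration, and the graded quotients

Throughout, `gr^W = ⨁_w gr^W_w` is identified with `K⁴` through the basis `e'_1, …, e'_4` of images of
`e_1, …, e_4` (indices shifted to `0, …, 3`): the class modulo `W_{w-1}` of a vector of `W_w` is given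
by its coordinates of weight `w`. -/

/-- The weights of `e_1, e_2, e_3, e_4`. -/
def wt : Fin 4 → ℤ := ![-2, -1, -1, 0]

/-- The increasing filtration of `K⁴` for which the `j`-th basis vector has weight `v j`. -/
def weightSub (K : Type*) [Field K] (v : Fin 4 → ℤ) (k : ℤ) : Submodule K (Fin 4 → K) where
  carrier := {x | ∀ j, k < v j → x j = 0}
  add_mem' := fun {x y} hx hy j hj => by simp [hx j hj, hy j hj]
  zero_mem' := fun _ _ => rfl
  smul_mem' := fun a x hx j hj => by simp [hx j hj]

/-- The projection of `K⁴` to its coordinates of weight `w`. -/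
def grProj (K : Type*) [Field K] (w : ℤ) : (Fin 4 → K) →ₗ[K] (Fin 4 → K) :=
  LinearMap.pi fun j => if wt j = w then LinearMap.proj j else 0

/-- The subspace `U(gr^W_w)` of `gr^W_w` induced by a subspace `U`: the image of `U ∩ W_w`. -/
def grPiece {K : Type*} [Field K] (w : ℤ) (U : Submodule K (Fin 4 → K)) :
    Submodule K (Fin 4 → K) :=
  (U ⊓ weightSub K wt w).map (grProj K w)

/-- The subspace `⨁_w U(gr^W_w)` of `gr^W` induced by a subspace `U`. -/
def grSub {K : Type*} [Field K] (U : Submodule K (Fin 4 → K)) : Submodule K (Fin 4 → K) :=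
  ⨆ w, grPiece w U

/-- The endomorphism of `gr^W` induced by an endomorphism compatible with `W`. -/
def grMat {R : Type*} [Zero R] (g : Matrix (Fin 4) (Fin 4) R) : Matrix (Fin 4) (Fin 4) R :=
  fun i j => if wt i = wt j then g i j else 0

/-- The orthogonal sum of the bilinear forms `⟨ , ⟩_w` on `gr^W_w` (`w = -2, -1, 0`):
`⟨e'_1, e'_1⟩ = 1`, `⟨e'_3, e'_2⟩ = 1 = -⟨e'_2, e'_3⟩`, `⟨e'_4, e'_4⟩ = 1`. -/
def pairing (x y : Fin 4 → ℂ) : ℂ :=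
  x 0 * y 0 + (x 2 * y 1 - x 1 * y 2) + x 3 * y 3

/-- The Hodge numbers. -/
def hodgeNumber (p q : ℤ) : ℕ :=
  if (p = 0 ∨ p = -1) ∧ (q = 0 ∨ q = -1) then 1 else 0

/-! ### The classifying space `D` -/

/-- Families of subspaces of `ℂ⁴`, indexed by `ℤ`. -/
abbrev Fil := ℤ → Submodule ℂ (Fin 4 → ℂ)

/-- The filtration on `gr^W` induced by `F`. -/
def gr (F : Fil) : Fil := fun p => grSub (F p)

/-- The action of matrices on filtrations. -/
def act (g : Matrix (Fin 4) (Fin 4) ℂ) (F : Fil) : Fil := fun p => (F p).map g.mulVecLin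

/-- The compact dual `Ď`. -/
def checkD : Set Fil :=
  {F | Antitone F ∧
    (∀ p q : ℤ, Module.finrank ℂ (grPiece (p + q) (F p)) =
      Module.finrank ℂ (grPiece (p + q) (F (p + 1))) + hodgeNumber p q) ∧
    ∀ p q w : ℤ, w < p + q →
      ∀ x ∈ grPiece w (F p), ∀ y ∈ grPiece w (F q), pairing x y = 0}

/-- The classifying space `D` of mixed Hodge structures with polarized graded quotients. -/
def D : Set Fil :=
  {F | F ∈ checkD ∧ ∀ p q : ℤ, ∀ x : Fin 4 → ℂ, x ≠ 0 →
    x ∈ grPiece (p + q) (F p) → star x ∈ grPiece (p + q) (F q) →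
      ∃ a : ℝ, 0 < a ∧ Complex.I ^ (p - q) * pairing x (star x) = a}

/-- `Ď(gr^W) = ∏_w Ď(gr^W_w)`, a family of filtrations being regarded as their direct sum. -/
def checkDgr : Set Fil := {G | G ∈ checkD ∧ gr G = G}

/-- `D(gr^W) = ∏_w D(gr^W_w)`. -/
def Dgr : Set Fil := {G | G ∈ D ∧ gr G = G}

/-- The point `F(τ, z₁, z₂, z₃)`: `F^{-1}` is everything, `F^1 = 0`, and `F^0` is spanned by
`z₁ e_1 + τ e_2 + e_3` and `z₂ e_1 + z₃ e_2 + e_4`. -/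
def filF (τ z₁ z₂ z₃ : ℂ) : Fil := fun p =>
  if p < 0 then ⊤
  else if p = 0 then Submodule.span ℂ {![z₁, τ, 1, 0], ![z₂, z₃, 0, 1]}
  else ⊥

/-- `G_ℂ(gr^W) = ∏_w G_ℂ(gr^W_w)`. -/
def Ggr : Set (Matrix (Fin 4) (Fin 4) ℂ) :=
  {g | IsUnit g ∧ grMat g = g ∧ ∀ x y, pairing (g *ᵥ x) (g *ᵥ y) = pairing x y}

/-- The complex matrix of an integral automorphism. -/
def toC (γ : GL (Fin 4) ℤ) : Matrix (Fin 4) (Fin 4) ℂ :=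
  (γ : Matrix (Fin 4) (Fin 4) ℤ).map (fun a => (a : ℂ))

/-- `G_ℤ`: the automorphisms of `ℤ⁴` compatible with `W` and, on `gr^W`, with the forms. -/
def GZ : Set (GL (Fin 4) ℤ) :=
  {γ | (∀ i j, wt j < wt i → (γ : Matrix (Fin 4) (Fin 4) ℤ) i j = 0) ∧ grMat (toC γ) ∈ Ggr}

/-- The group `Γ` of all `γ ∈ G_ℤ` with `γ e_j - e_j ∈ ⨁_{k < j} ℤ e_k` for all `j`. -/
def Gam : Set (GL (Fin 4) ℤ) :=
  {γ | γ ∈ GZ ∧ ∀ i j, j ≤ i →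
    (γ : Matrix (Fin 4) (Fin 4) ℤ) i j = if i = j then 1 else 0}

/-- The quotient `Γ \ D`. -/
def GamD : Type := Quot fun F F' : D => ∃ γ ∈ Gam, F'.1 = act (toC γ) F.1

/-- The projection `D → Γ \ D`. -/
def GamD.mk (F : D) : GamD := Quot.mk _ F

/-! ### The canonical splitting and the `δ`-component -/

/-- `spl(W)`: the splittings `s : gr^W → H_{0,ℝ}` of `W`, as matrices. -/
def splW : Set (Matrix (Fin 4) (Fin 4) ℝ) :=
  {s | ∀ i j, wt j ≤ wt i → s i j = if i = j then 1 else 0}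

/-- The endomorphism `δ` of `gr^W` with `δ e'_4 = d e'_1`, `δ e'_j = 0` for `j ≤ 3`. These are exactly
the endomorphisms lowering weights by at least two, and they are of Hodge type `(-1, -1)`; so
`L = ℒ(F) = ℒ ≃ ℝ` for every `F ∈ D(gr^W)`. -/
def deltaMat (d : ℝ) : Matrix (Fin 4) (Fin 4) ℝ := Matrix.single 0 3 d

/-- `F = s(exp(iδ) F(gr^W))`, where `δ ↔ d`; one has `exp(iδ) = 1 + iδ` because `δ² = 0`. -/
def HasSplitting (F : Fil) (s : Matrix (Fin 4) (Fin 4) ℝ) (d : ℝ) : Prop :=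
  s ∈ splW ∧
    F = act (s.map Complex.ofReal)
      (act (1 + Complex.I • (deltaMat d).map Complex.ofReal) (gr F))

/-- The `δ`-component of `F`. -/
def delta (F : Fil) : ℝ := Classical.epsilon fun d => ∃ s, HasSplitting F s d

/-- The canonical splitting `spl_W(F)`. As `δ` is of Hodge type `(-1, -1)`, the correction `ζ(F, δ)`
vanishes and the canonical splitting is the `s` of `F = s(exp(iδ) F(gr^W))`. -/
def splOf (F : Fil) : Matrix (Fin 4) (Fin 4) ℝ :=
  Classical.epsilon fun s => ∃ d, HasSplitting F s d

/-- `D_spl`, the set of `ℝ`-split elements of `D`. -/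
def Dspl : Set Fil := {F | ∃ s ∈ splW, ∃ G ∈ Dgr, F = act (s.map Complex.ofReal) G}

/-! ### `SL(2)`-orbits -/

abbrev SL2C := Matrix.SpecialLinearGroup (Fin 2) ℂ

/-- The filtration `F_a` of `ℂ²` attached to `a ∈ ℙ¹(ℂ)`. -/
def filP1 (a : OnePoint ℂ) (k : ℤ) : Submodule ℂ (Fin 2 → ℂ) :=
  if k ≤ 0 then ⊤
  else if k = 1 then Submodule.span ℂ {a.elim (![1, 0] : Fin 2 → ℂ) (fun z => ![z, 1])}
  else ⊥

/-- The action of `SL(2, ℂ)ⁿ` on `ℙ¹(ℂ)ⁿ`. -/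
def actP1 {n : ℕ} (g : Fin n → SL2C) (z : Fin n → OnePoint ℂ) : Fin n → OnePoint ℂ :=
  fun j => (Matrix.SpecialLinearGroup.toGL (g j)) • z j

/-- `(ρ_w, φ_w)_w` is a family of `SL(2)`-orbits in `n` variables for the `gr^W_w`. The family is
regarded as one homomorphism `ρ : SL(2, ℂ)ⁿ → G_ℂ(gr^W)`, algebraic and defined over `ℝ`, and one
equivariant map `φ : ℙ¹(ℂ)ⁿ → Ď(gr^W)` (which is automatically holomorphic, since `ρ` is algebraic and
`SL(2, ℂ)ⁿ` acts transitively on `ℙ¹(ℂ)ⁿ`). -/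
structure IsPureOrbit {n : ℕ} (ρ : (Fin n → SL2C) →* Matrix (Fin 4) (Fin 4) ℂ)
    (φ : (Fin n → OnePoint ℂ) → Fil) : Prop where
  mem_Ggr : ∀ g, ρ g ∈ Ggr
  algebraic : ∀ i j, ∃ P : MvPolynomial (Fin n × Fin 2 × Fin 2) ℝ,
    ∀ g, ρ g i j = MvPolynomial.aeval (fun k => g k.1 k.2.1 k.2.2) P
  mem_checkDgr : ∀ z, φ z ∈ checkDgr
  equivariant : ∀ g z, φ (actP1 g z) = act (ρ g) (φ z)
  upper : ∀ z : Fin n → ℍ, φ (fun j => ((z j : ℂ) : OnePoint ℂ)) ∈ Dgr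
  /-- `ρ_*(fil^p_z(sl(2, ℂ)ⁿ)) ⊆ fil^p_{φ(z)}(g_ℂ)`: the element `X` of `sl(2, ℂ)ⁿ` is the velocity at
  `1` of a curve `c` in `SL(2, ℂ)ⁿ`, and `ρ_* X` is the velocity of `ρ ∘ c`. -/
  horizontal : ∀ (z : Fin n → OnePoint ℂ) (p : ℤ) (X : Fin n → Matrix (Fin 2) (Fin 2) ℂ)
    (c : ℂ → Fin n → SL2C), c 0 = 1 →
    (∀ k i j, HasDerivAt (fun t => c t k i j) (X k i j) 0) →
    (∀ k l, (filP1 (z k) l).map (X k).mulVecLin ≤ filP1 (z k) (l + p)) →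
    ∀ l, (φ z l).map
      (Matrix.of fun i j => deriv (fun t => ρ (c t) i j) 0).mulVecLin ≤ φ z (l + p)

/-- The `k`-th component of `ρ` is non-trivial (on some `gr^W_w`). -/
def NontrivialAt {n : ℕ} (ρ : (Fin n → SL2C) →* Matrix (Fin 4) (Fin 4) ℂ) (k : Fin n) : Prop :=
  ∃ g : SL2C, ρ (Pi.mulSingle k g) ≠ 1

/-- Non-degenerate `SL(2)`-orbits `((ρ_w, φ_w)_w, r)` of rank `n` in the mixed case. -/
structure Orbit (n : ℕ) where
  ρ : (Fin n → SL2C) →* Matrix (Fin 4) (Fin 4) ℂ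
  φ : (Fin n → OnePoint ℂ) → Fil
  r : Fil
  pure : IsPureOrbit ρ φ
  r_mem : r ∈ D
  gr_r : gr r = φ fun _ => (Complex.I : OnePoint ℂ)
  nontrivial : ∀ k : Fin n, (k : ℕ) ≠ 0 → NontrivialAt ρ k
  nontrivial_of_spl : r ∈ Dspl → ∀ k, NontrivialAt ρ k

/-- The diagonal matrix with entries `1/a, a`. -/
def diagSL (a : ℝˣ) : SL2C :=
  ⟨!![((a⁻¹ : ℝˣ) : ℝ), 0; 0, ((a : ℝ) : ℂ)], by
    rw [Matrix.det_fin_two_of, ← Complex.ofReal_mul]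
    simp⟩

namespace Orbit

variable {n : ℕ}

/-- The action `gr^W(τ(t))` on `gr^W` of the torus associated to an `SL(2)`-orbit:
`(∏ t_j)^w ρ_w(g_1, …, g_n)` on `gr^W_w`, where `g_j` is the diagonal matrix with entries
`1/∏_{k ≥ j} t_k` and `∏_{k ≥ j} t_k`. -/
def grTorus (o : Orbit n) (t : Fin n → ℝˣ) : Matrix (Fin 4) (Fin 4) ℂ :=
  Matrix.diagonal (fun i => ((((∏ j, t j) ^ wt i : ℝˣ) : ℝ) : ℂ)) *
    o.ρ fun j => diagSL (∏ k with j ≤ k, t k)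

/-- The associated torus action `τ(t)`, transported to `H_0` by the canonical splitting of `r`. -/
def torus (o : Orbit n) (t : Fin n → ℝˣ) : Matrix (Fin 4) (Fin 4) ℂ :=
  (splOf o.r).map Complex.ofReal * o.grTorus t * ((splOf o.r).map Complex.ofReal)⁻¹

/-- The real vectors on which the `j`-th component `τ_j` of the torus acts by `a ↦ a^l`. -/
def eigen (o : Orbit n) (j : Fin n) (l : ℤ) : Submodule ℝ (Fin 4 → ℝ) where
  carrier := {x | ∀ a : ℝˣ, o.torus (Pi.mulSingle j a) *ᵥ (fun i => (x i : ℂ)) =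
    (((a ^ l : ℝˣ) : ℝ) : ℂ) • fun i => (x i : ℂ)}
  add_mem' := fun {x y} hx hy a => by
    have h : (fun i => (((x + y) i : ℝ) : ℂ)) = (fun i => (x i : ℂ)) + fun i => (y i : ℂ) := by
      ext i; simp
    rw [h, Matrix.mulVec_add, hx a, hy a, smul_add]
  zero_mem' := fun a => by
    have h : (fun i => (((0 : Fin 4 → ℝ) i : ℝ) : ℂ)) = 0 := by ext i; simp
    rw [h, Matrix.mulVec_zero, smul_zero]
  smul_mem' := fun b x hx a => by
    have h : (fun i => (((b • x) i : ℝ) : ℂ)) = (b : ℂ) • fun i => (x i : ℂ) := by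
      ext i; simp
    rw [h, Matrix.mulVec_smul, hx a, smul_comm]

/-- The associated `j`-th weight filtration `W^{(j)}` on `H_{0,ℝ}`. -/
def weightFil (o : Orbit n) (j : Fin n) (k : ℤ) : Submodule ℝ (Fin 4 → ℝ) :=
  ⨆ l ≤ k, o.eigen j l

/-- The set of the filtrations `W'(gr^W)` for the weight filtrations `W' ≠ W` of the orbit. -/
def wBar (o : Orbit n) : Set (ℤ → Submodule ℝ (Fin 4 → ℝ)) :=
  {M | ∃ j, o.weightFil j ≠ weightSub ℝ wt ∧ M = fun k => grSub (o.weightFil j k)}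

/-- All the filtrations `W^{(j)}(gr^W_w)` are rational. -/
def IsRational (o : Orbit n) : Prop :=
  ∀ j k w, ∃ T : Set (Fin 4 → ℚ),
    grPiece w (o.weightFil j k) = Submodule.span ℝ ((fun x i => (x i : ℝ)) '' T)

/-- Equivalence of non-degenerate `SL(2)`-orbits of rank `n`. -/
def Equivalent (o o' : Orbit n) : Prop :=
  ∃ t : Fin n → ℝˣ, (∀ j, 0 < (t j : ℝ)) ∧
    (∀ g, o'.ρ g = o.grTorus t * o.ρ g * (o.grTorus t)⁻¹) ∧
    (∀ z, o'.φ z = act (o.grTorus t) (o.φ z)) ∧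
    o'.r = act (o.torus t) o.r

/-- `o' = γ o`. -/
def IsTranslate (γ : GL (Fin 4) ℤ) (o o' : Orbit n) : Prop :=
  (∀ g, o'.ρ g = grMat (toC γ) * o.ρ g * (grMat (toC γ))⁻¹) ∧
    (∀ z, o'.φ z = act (grMat (toC γ)) (o.φ z)) ∧
    o'.r = act (toC γ) o.r

end Orbit

/-! ### The space `D^{II}_{SL(2)}(Φ)` -/

/-- `Φ = {W'}`, where `W'` is the filtration of `gr^W` for which `e'_1, e'_2, e'_3, e'_4` have weights
`-2, -2, 0, 0`; on `gr^W_{-1}` it is `0 = W'_{-3} ⊂ W'_{-2} = W'_{-1} = ℝ e'_2 ⊂ W'_0 = gr^W_{-1}`. -/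
def Phi : Set (ℤ → Submodule ℝ (Fin 4 → ℝ)) := {weightSub ℝ ![-2, -2, 0, 0]}

/-- The `SL(2)`-orbits whose class belongs to `D^{II}_{SL(2)}(Φ)`. -/
def OrbitPhi : Type := {o : Σ n, Orbit n // o.2.IsRational ∧ o.2.wBar ⊆ Phi}

/-- Equivalence of `SL(2)`-orbits (of the same rank). -/
def OrbitPhi.Equivalent (o o' : OrbitPhi) : Prop :=
  ∃ (n : ℕ) (x x' : Orbit n), o.1 = ⟨n, x⟩ ∧ o'.1 = ⟨n, x'⟩ ∧ x.Equivalent x'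

/-- The set `D^{II}_{SL(2)}(Φ)` of equivalence classes. -/
def DII : Type := Quot OrbitPhi.Equivalent

/-- The class of an `SL(2)`-orbit. -/
def DII.mk (o : OrbitPhi) : DII := Quot.mk _ o

/-- The space `ℝ × ℂ × [-∞, ∞] × ℝ^{4×4} × ℝ` containing
`ℝ_{≥0} × D(gr^W) × L̄ × spl(W) × spl(W')`; here `D(gr^W)` is the upper half plane in `ℂ`, `L̄` is
`[-∞, ∞]`, a splitting of `W` is given by its matrix, and the splitting of `W'` that sends the class of
`e'_3` to `b e'_2 + e'_3` is given by `b`. -/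
abbrev B := ℝ × ℂ × EReal × (Fin 4 → Fin 4 → ℝ) × ℝ

/-- The coordinate `τ` on `D(gr^W)`: `G^0(gr^W_{-1})` is spanned by `τ e'_2 + e'_3`. -/
def tauOf (G : Fil) : ℂ := Classical.epsilon fun τ => (![0, τ, 1, 0] : Fin 4 → ℂ) ∈ G 0

/-- `C` is the Weil operator of `G ∈ D(gr^W)`: it is `i^{p-q}` on the `(p, q)`-Hodge component. -/
def IsWeil (G : Fil) (C : Matrix (Fin 4) (Fin 4) ℂ) : Prop :=
  ∀ (p q : ℤ) (x : Fin 4 → ℂ), x ∈ grPiece (p + q) (G p) → star x ∈ grPiece (p + q) (G q) →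
    C *ᵥ x = Complex.I ^ (p - q) • x

/-- The one-parameter group acting by `1` on `e'_1, e'_4`, by `a⁻¹` on `e'_2` and by `a` on
`b e'_2 + e'_3`; it lifts the weight map of `W'`. -/
def liftTorus (b : ℝ) (a : ℝˣ) : Matrix (Fin 4) (Fin 4) ℝ :=
  !![1, 0, 0, 0;
     0, (a : ℝ)⁻¹, b * ((a : ℝ) - (a : ℝ)⁻¹), 0;
     0, 0, (a : ℝ), 0;
     0, 0, 0, 1]

/-- The Borel-Serre splitting of `W'` at `G`: the lift of the weight map on which the Cartan involution
`ad(C_G)` is the inversion. -/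
def splBS (G : Fil) : ℝ :=
  Classical.epsilon fun b => ∃ C, IsWeil G C ∧ ∀ a : ℝˣ,
    C * (liftTorus b a).map Complex.ofReal * C⁻¹ = ((liftTorus b a).map Complex.ofReal)⁻¹

/-- The distance `β` to the `Φ`-boundary: `x + iy ↦ 1/√y`. -/
def beta (G : Fil) : ℝ := 1 / √(tauOf G).im

/-- The splitting `α` of `Φ`. -/
def alpha (t : ℝ) : Matrix (Fin 4) (Fin 4) ℝ := Matrix.diagonal ![t⁻¹ ^ 2, t⁻¹ ^ 2, 1, 1]

/-- The map `ν_{α,β}` on `D`. -/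
def nuD (F : Fil) : B :=
  (beta (gr F),
    tauOf (act ((alpha (beta (gr F)))⁻¹.map Complex.ofReal) (gr F)),
    ((((alpha (beta (gr F)))⁻¹ * deltaMat (delta F) * alpha (beta (gr F))) 0 3 : ℝ) : EReal),
    splOf F,
    splBS (gr F))

/-- The filter on `(ℝ^×)ⁿ` of positive `t` tending to `0`. -/
def toZero (n : ℕ) : Filter (Fin n → ℝˣ) :=
  Filter.comap (fun t j => (t j : ℝ)) (𝓝[{t | ∀ j, 0 < t j}] (0 : Fin n → ℝ))

/-- The map `ν_{α,β}` on `D^{II}_{SL(2)}(Φ)`: the limit along the associated torus orbit. -/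
def nu (p : DII) : B :=
  Classical.epsilon fun v => ∃ o : OrbitPhi, DII.mk o = p ∧
    Tendsto (fun t => nuD (act (o.1.2.torus t) o.1.2.r)) (toZero o.1.1) (𝓝 v)

instance : TopologicalSpace DII := TopologicalSpace.induced nu inferInstance

/-- The projection `D^{II}_{SL(2)}(Φ) → L̄` of the isomorphism
`D^{II}_{SL(2)}(Φ) ≃ spl(W) × 𝔥̄ × L̄`, induced by `ν_{α,β}`. -/
def lbar (p : DII) : EReal := (nu p).2.2.1

/-- A chart of the real analytic manifold with boundary `L̄ = [-∞, ∞]` around `b`. As `L` has weight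
`-2`, the points near `±∞` are `t ∘ (±1) = ± t^{-2}` with `t ≥ 0` near `0`. -/
def chartL (b : EReal) (d : EReal) : ℝ :=
  if b = ⊤ ∨ b = ⊥ then 1 / √|d.toReal| else d.toReal

/-- Coordinates on the ambient space around a point with `L̄`-component `b`. -/
def coord (b : EReal) (v : B) : ℝ × ℂ × ℝ × (Fin 4 → Fin 4 → ℝ) × ℝ :=
  (v.1, v.2.1, chartL b v.2.2.1, v.2.2.2.1, v.2.2.2.2)

/-- `f` is a real analytic function on the open set `U` of `D^{II}_{SL(2)}(Φ)`: it is locally the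
restriction of a real analytic function through `ν_{α,β}`. -/
def AnalyticOnDII (f : DII → ℝ) (U : Set DII) : Prop :=
  ∀ p ∈ U, ∃ g : ℝ × ℂ × ℝ × (Fin 4 → Fin 4 → ℝ) × ℝ → ℝ,
    AnalyticAt ℝ g (coord (lbar p) (nu p)) ∧ ∀ᶠ q in 𝓝 p, f q = g (coord (lbar p) (nu q))

/-- The quotient `Γ \ D^{II}_{SL(2)}(Φ)`. -/
def GamDII : Type :=
  Quot fun p p' : DII => ∃ γ ∈ Gam, ∃ (o o' : OrbitPhi) (n : ℕ) (x x' : Orbit n),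
    DII.mk o = p ∧ DII.mk o' = p' ∧ o.1 = ⟨n, x⟩ ∧ o'.1 = ⟨n, x'⟩ ∧ Orbit.IsTranslate γ x x'

/-- The projection `D^{II}_{SL(2)}(Φ) → Γ \ D^{II}_{SL(2)}(Φ)`. -/
def GamDII.mk (p : DII) : GamDII := Quot.mk _ p

instance : TopologicalSpace GamDII := inferInstanceAs (TopologicalSpace (Quot _))

/-- `f` is a real analytic function on the open set `U` of `Γ \ D^{II}_{SL(2)}(Φ)`. -/
def AnalyticOnGamDII (f : GamDII → ℝ) (U : Set GamDII) : Prop :=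
  AnalyticOnDII (fun p => f (GamDII.mk p)) (GamDII.mk ⁻¹' U)

/-! ### The inclusion `D ⊆ D^{II}_{SL(2)}(Φ)` -/

theorem grProj_grProj (K : Type*) [Field K] (w w' : ℤ) (x : Fin 4 → K) :
    grProj K w (grProj K w' x) = if w = w' then grProj K w x else 0 := by
  ext j
  by_cases h : w = w'
  · subst h
    by_cases hj : wt j = w <;> simp [grProj, hj]
  · by_cases hj : wt j = w
    · simp [grProj, hj, h]
    · simp [grProj, hj, h]

theorem grPiece_grSub {K : Type*} [Field K] (w : ℤ) (U : Submodule K (Fin 4 → K)) :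
    grPiece w (grSub U) = grPiece w U := by
  apply le_antisymm
  · have h1 : (grSub U).map (grProj K w) ≤ grPiece w U := by
      rw [grSub, Submodule.map_iSup]
      refine iSup_le fun w' => ?_
      rintro _ ⟨_, ⟨x, hx, rfl⟩, rfl⟩
      rw [grProj_grProj]
      split_ifs with h
      · subst h
        exact ⟨x, hx, rfl⟩
      · exact Submodule.zero_mem _
    exact (Submodule.map_mono inf_le_left).trans h1
  · rintro _ ⟨x, hx, rfl⟩
    refine ⟨grProj K w x, ⟨?_, ?_⟩, ?_⟩
    · exact (le_iSup (fun w => grPiece w U) w) ⟨x, hx, rfl⟩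
    · intro j hj
      simp [grProj, hj.ne']
    · simp [grProj_grProj]

theorem gr_mem_Dgr {F : Fil} (hF : F ∈ D) : gr F ∈ Dgr := by
  obtain ⟨⟨h1, h2, h3⟩, h4⟩ := hF
  refine ⟨⟨⟨?_, ?_, ?_⟩, ?_⟩, ?_⟩
  · intro p q hpq
    exact iSup_mono fun w => Submodule.map_mono (inf_le_inf_right _ (h1 hpq))
  · intro p q
    have h := h2 p q
    rw [← grPiece_grSub (p + q) (F p), ← grPiece_grSub (p + q) (F (p + 1))] at h
    exact h
  · intro p q w hw
    simp only [gr, grPiece_grSub]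
    exact h3 p q w hw
  · intro p q
    simp only [gr, grPiece_grSub]
    exact h4 p q
  · funext p
    simp only [gr, grSub]
    exact iSup_congr fun w => grPiece_grSub w (F p)

theorem act_one (F : Fil) : act 1 F = F := by
  funext p
  simp [act]

/-- An element of `D` as an `SL(2)`-orbit of rank `0`. -/
def orbitOfD (F : D) : Orbit 0 where
  ρ := 1
  φ := fun _ => gr F.1
  r := F.1
  pure :=
    { mem_Ggr := fun _ => ⟨isUnit_one, by
        ext i j
        by_cases h : i = j
        · simp [grMat, h]
        · simp [grMat, h], fun x y => by simp⟩
      algebraic := fun i j => ⟨MvPolynomial.C ((1 : Matrix (Fin 4) (Fin 4) ℝ) i j), fun g => by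
        rcases eq_or_ne i j with rfl | h
        · simp
        · simp [h]⟩
      mem_checkDgr := fun _ => ⟨(gr_mem_Dgr F.2).1.1, (gr_mem_Dgr F.2).2⟩
      equivariant := fun _ _ => by simp [act_one]
      upper := fun _ => gr_mem_Dgr F.2
      horizontal := fun _ p _ _ _ _ _ l => by
        have h : (Matrix.of fun i j : Fin 4 => deriv (fun _ : ℂ =>
            (1 : Matrix (Fin 4) (Fin 4) ℂ) i j) 0) = 0 := by
          ext i j
          simp
        simp only [MonoidHom.one_apply]
        rw [h]
        rintro _ ⟨x, _, rfl⟩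
        simp }
  r_mem := F.2
  gr_r := rfl
  nontrivial := fun k => k.elim0
  nontrivial_of_spl := fun _ k => k.elim0

/-- The inclusion `D → D^{II}_{SL(2)}(Φ)`. -/
def DII.ofD (F : D) : DII :=
  DII.mk ⟨⟨0, orbitOfD F⟩, fun j => j.elim0, by rintro M ⟨j, _⟩; exact j.elim0⟩

/-! ### The real blow-up `Δ^log` of the unit disc -/

/-- `Δ^log = [0, 1) × S¹`. -/
abbrev LogDisc := Set.Ico (0 : ℝ) 1 × Circle

/-- The projection `Δ^log → Δ`, `(r, u) ↦ ru`. -/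
def LogDisc.toDisc (b : LogDisc) : ℂ := ((b.1 : ℝ) : ℂ) * (b.2 : ℂ)

/-- The punctured unit disc `Δ^*`. -/
def DiscStar : Type := {q : ℂ // q ≠ 0 ∧ ‖q‖ < 1}

/-- The points of `Δ^log` over `Δ^*`. -/
def LogDisc.toStar (b : LogDisc) (hb : (b.1 : ℝ) ≠ 0) : DiscStar :=
  ⟨b.toDisc, by simp [LogDisc.toDisc, hb], by
    have h0 : (0 : ℝ) ≤ b.1 := b.1.2.1
    simpa [LogDisc.toDisc, abs_of_nonneg h0, Circle.norm_coe] using b.1.2.2⟩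

theorem glue_mem (t : ℝ) : expNegInvGlue (t ^ 2) ∈ Set.Ico (0 : ℝ) 1 := by
  refine ⟨expNegInvGlue.nonneg _, ?_⟩
  unfold expNegInvGlue
  split_ifs with h
  · exact one_pos
  · rw [Real.exp_lt_one_iff]
    have := inv_pos.2 (not_le.1 h)
    linarith

/-- The map `(t, x) ↦ (e^{-1/t²}, e^{2πix})`, with `e^{-1/0²} = 0`. -/
def logParam (t x : ℝ) : LogDisc := (⟨expNegInvGlue (t ^ 2), glue_mem t⟩, Circle.exp (2 * Real.pi * x))

/-- `h` is a `C^∞` function on the open set `U` of `Δ^log`: its pull-back to `ℝ_{≥0} × ℝ` extends,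
locally, to `C^∞` functions on open sets of `ℝ²`. -/
def SmoothOnLog (h : LogDisc → ℝ) (U : Set LogDisc) : Prop :=
  ∀ t x : ℝ, 0 ≤ t → logParam t x ∈ U →
    ∃ (V : Set (ℝ × ℝ)) (H : ℝ × ℝ → ℝ), IsOpen V ∧ (t, x) ∈ V ∧ ContDiffOn ℝ ∞ H V ∧
      ∀ t' x' : ℝ, (t', x') ∈ V → 0 ≤ t' → logParam t' x' ∈ U →
        h (logParam t' x') = H (t', x')

/-- `P` is a `C^∞` map `Δ^log → Γ \ D^{II}_{SL(2)}(Φ)`, i.e. a morphism of local ringed spaces over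
`ℝ`: it is continuous and pulls real analytic functions back to `C^∞` functions. -/
def IsSmoothMap (P : LogDisc → GamDII) : Prop :=
  Continuous P ∧ ∀ (U : Set GamDII) (f : GamDII → ℝ), IsOpen U → AnalyticOnGamDII f U →
    SmoothOnLog (f ∘ P) (P ⁻¹' U)

/-! ### Elliptic curves, sections and periods -/

/-- `e(z) = exp(2πiz)`. -/
def e (z : ℂ) : ℂ := Complex.exp (2 * Real.pi * Complex.I * z)

/-- `θ(τ, z) = ∏_{n ≥ 0} (1 - qⁿ t) ∏_{n ≥ 1} (1 - qⁿ t⁻¹)` with `q = e^{2πiτ}`, `t = e^{2πiz}`. -/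
def theta (τ z : ℂ) : ℂ :=
  (∏' n : ℕ, (1 - e τ ^ n * e z)) * ∏' n : ℕ, (1 - e τ ^ (n + 1) * (e z)⁻¹)

/-- The points of `ℂ` above the value at `τ` of the section of the Néron model `E_c` given by `(a, u)`:
the numbers `aτ + f` modulo `ℤτ + ℤ`, with `f` a value of `(2πi)⁻¹ log u(e^{2πiτ/c})`. -/
def sectionLifts (c : ℕ) (a : ℚ) (u : ℂ → ℂ) (τ : ℂ) : Set ℂ :=
  {z | ∃ (f : ℂ) (k l : ℤ), e f = u (e (τ / c)) ∧ z = a * τ + f + (k * τ + l)}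

/-- The sections of `E_c` given by `(a, u)` and `(b, v)` do not meet over `Δ`. Over `0`, the section
`(a, u)` has the value `(u(0), ca mod c) ∈ ℂ^× × ℤ/cℤ`. -/
def DoNotMeet (c : ℕ) (a : ℚ) (u : ℂ → ℂ) (b : ℚ) (v : ℂ → ℂ) : Prop :=
  (∀ τ : ℂ, 0 < τ.im → Disjoint (sectionLifts c a u τ) (sectionLifts c b v τ)) ∧
    ¬ (u 0 = v 0 ∧ ∃ k : ℤ, c * a = c * b + c * k)

/-- `F` is one of the points `F(τ, w, λ, z)` of `D` above the value at `q = e^{2πiτ/c}` of the period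
map of the divisors `∑ m_j (p_j)`, `∑ n_k (q_k)`, where `p_j, q_k` are the sections given by
`(a_j, u_j)`, `(b_k, v_k)`: with lifts `z_j`, `w_k` to `ℂ` of their values at `τ`,
`z = ∑ m_j z_j`, `w = ∑ n_k w_k` and `λ = (2πi)⁻¹ log ∏ θ(τ, z_j - w_k)^{m_j n_k}`. -/
def IsPeriod (c : ℕ) {r s : ℕ} (m : Fin r → ℤ) (n : Fin s → ℤ) (a : Fin r → ℚ) (b : Fin s → ℚ)
    (u : Fin r → ℂ → ℂ) (v : Fin s → ℂ → ℂ) (q : ℂ) (F : Fil) : Prop :=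
  ∃ (τ : ℂ) (z : Fin r → ℂ) (w : Fin s → ℂ) (lam : ℂ),
    0 < τ.im ∧ e (τ / c) = q ∧
    (∀ j, z j ∈ sectionLifts c (a j) (u j) τ) ∧
    (∀ k, w k ∈ sectionLifts c (b k) (v k) τ) ∧
    e lam = ∏ j, ∏ k, theta τ (z j - w k) ^ (m j * n k) ∧
    F = filF τ (∑ k, n k * w k) lam (∑ j, m j * z j)

/-- The second Bernoulli polynomial. -/
def B2 (x : ℝ) : ℝ := x ^ 2 - x + 1 / 6

/-- The constant `(1/2) ∑ m_j n_k B_2({a_j - b_k})`. -/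
def heightSlope {r s : ℕ} (m : Fin r → ℤ) (n : Fin s → ℤ) (a : Fin r → ℚ) (b : Fin s → ℚ) : ℝ :=
  1 / 2 * ∑ j, ∑ k, (m j : ℝ) * n k * B2 (Int.fract ((a j : ℝ) - b k))

end ExIV

end

noncomputable section

namespace ExIV

/-! ### Filtrations and graded quotients -/

/-! Everything is computed in explicit coordinates on D. The Hodge numbers and the polarization
force every point of D to be some F(τ, z₁, z₂, z₃), hence some `ptD τ s d` with Im τ > 0, s in
spl(W) and d real; solving for s and d gives δ(F) = Im z₂ - Im z₁ Im z₃ / Im τ (`filF_eq_ptD`). In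
the coordinates (τ, s, d) the map ν is (1/√Im τ, τ/Im τ, d/Im τ, s, Re τ) (`nuD_ptD`), while Γ
translates τ by an integer, changes s and fixes d (`act_toC_ptD`). Hence δ descends to Γ\D and,
after passing to limits along torus orbits, so does the L̄-component of ν.

The arithmetic input is the behaviour of θ along two sections that do not meet. Write a_j - b_k = N
+ f with N an integer and 0 ≤ f < 1. Quasi-periodicity removes Nτ at the cost of an exponential
whose exponent has an explicit coefficient of τ. What remains is a product in q = e(τ/c) without
negative powers of q; it is holomorphic on the whole disc and has no zeros, also at q = 0 because
the sections do not meet there, so it has a holomorphic logarithm (`exists_log_theta`). Thus w = Bτ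
+ ψ(q), λ = Λτ + μ(q), z = Aτ + φ(q) with ψ, μ, φ holomorphic, and δ is (Λ - AB) Im τ plus a
polynomial in 1/Im τ and the imaginary parts of φ, ψ, μ. Since -Nf - N(N-1)/2 equals B₂(f)/2 + a_j
b_k up to summands depending on only one of j, k, degree zero turns Λ - AB into the asserted slope
(`exists_periodForm`).

For the extension put |q| = exp(-1/t²). Then 1/Im τ = 2πt²/c, and all coordinates of ν along the
period map become C^∞ functions of (t, x) (`contDiff_nuCoord`), with L̄-component equal to the slope
at t = 0. The value at t = 0 is ν of an explicit SL(2)-orbit of rank one (`nu_boundaryOrbitPhi`),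
which supplies the boundary point. Topology and structure sheaf are defined through ν, so smoothness
can be read off there (`isSmoothMap_ext`). As cA, cB, cΛ are integers, x ↦ x + 1 is realized by an
element of Γ, in the interior and on the boundary alike (`mk_lift_add_int`), so the map lives on
Δ^log. -/

theorem act_mul (g h : Matrix (Fin 4) (Fin 4) ℂ) (F : Fil) : act (g * h) F = act g (act h F) := by
  funext p
  simp only [act, Matrix.mulVecLin_mul, Submodule.map_comp]

theorem mulVec_mem_weightSub {K : Type*} [Field K] {M : Matrix (Fin 4) (Fin 4) K}
    (hM : ∀ i j, wt j < wt i → M i j = 0) {w : ℤ} {x : Fin 4 → K} (hx : x ∈ weightSub K wt w) :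
    M *ᵥ x ∈ weightSub K wt w := by
  intro i hi
  simp only [Matrix.mulVec, dotProduct]
  refine Finset.sum_eq_zero fun j _ => ?_
  by_cases hj : w < wt j
  · rw [hx j hj, mul_zero]
  · rw [hM i j (by omega), zero_mul]

theorem grProj_apply {K : Type*} [Field K] (w : ℤ) (x : Fin 4 → K) (j : Fin 4) :
    grProj K w x j = if wt j = w then x j else 0 := by
  by_cases h : wt j = w <;> simp [grProj, h]

theorem grProj_mulVec {K : Type*} [Field K] {M : Matrix (Fin 4) (Fin 4) K}
    (hM : ∀ i j, wt j < wt i → M i j = 0) {w : ℤ} {x : Fin 4 → K} (hx : x ∈ weightSub K wt w) :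
    grProj K w (M *ᵥ x) = grMat M *ᵥ grProj K w x := by
  ext i
  rw [grProj_apply]
  simp only [Matrix.mulVec, dotProduct]
  split_ifs with hi
  · refine Finset.sum_congr rfl fun j _ => ?_
    rw [grProj_apply, grMat]
    rcases lt_trichotomy (wt j) w with h | h | h
    · rw [hM i j (by omega)]; simp [h.ne]
    · simp [h, hi]
    · rw [hx j h]; simp
  · symm
    refine Finset.sum_eq_zero fun j _ => ?_
    rw [grProj_apply, grMat]
    split_ifs <;> simp_all

/-- An automorphism of (V, W) acts on graded pieces through its block-diagonal part. The inverse
must preserve W too, in order to pull membership in W_w back from the image. -/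
theorem grPiece_map {K : Type*} [Field K] {M M' : Matrix (Fin 4) (Fin 4) K}
    (hM : ∀ i j, wt j < wt i → M i j = 0) (hM' : ∀ i j, wt j < wt i → M' i j = 0)
    (h : M * M' = 1) (w : ℤ) (U : Submodule K (Fin 4 → K)) :
    grPiece w (U.map M.mulVecLin) = (grPiece w U).map (grMat M).mulVecLin := by
  have h' : M' * M = 1 := mul_eq_one_comm.1 h
  ext x
  constructor
  · rintro ⟨_, ⟨⟨z, hz, rfl⟩, hw⟩, rfl⟩
    have hz' : z ∈ weightSub K wt w := by
      have := mulVec_mem_weightSub hM' hw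
      simpa [h'] using this
    exact ⟨grProj K w z, ⟨z, ⟨hz, hz'⟩, rfl⟩, (grProj_mulVec hM hz').symm⟩
  · rintro ⟨_, ⟨z, ⟨hz, hz'⟩, rfl⟩, rfl⟩
    exact ⟨M *ᵥ z, ⟨⟨z, hz, rfl⟩, mulVec_mem_weightSub hM hz'⟩, grProj_mulVec hM hz'⟩

theorem weightSub_of_lt (K : Type*) [Field K] {w : ℤ} (hw : w < -2) : weightSub K wt w = ⊥ := by
  rw [eq_bot_iff]
  intro x hx
  ext j
  exact hx j (by fin_cases j <;> simp [wt] <;> omega)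

theorem weightSub_of_nonneg (K : Type*) [Field K] {w : ℤ} (hw : 0 ≤ w) : weightSub K wt w = ⊤ := by
  rw [eq_top_iff]
  intro x _ j hj
  fin_cases j <;> simp [wt] at hj <;> omega

/-- A subspace is determined, among those containing it, by the ranks of its graded pieces. -/
theorem eq_of_le_of_finrank_grPiece {K : Type*} [Field K] {U V : Submodule K (Fin 4 → K)}
    (hUV : U ≤ V)
    (h : ∀ w, Module.finrank K (grPiece w V) ≤ Module.finrank K (grPiece w U)) : U = V := by
  have hg : ∀ w, grPiece w U = grPiece w V := fun w =>
    Submodule.eq_of_le_of_finrank_le (Submodule.map_mono (inf_le_inf_right _ hUV)) (h w)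
  -- Induction up the weight filtration, indexed so that k = 0 is W_{-3} = 0 and k = 3 is
  -- everything. At each step an element of U with the same class in the top graded piece is
  -- subtracted, which lowers the weight.
  have key : ∀ k : ℕ, ∀ x ∈ V, x ∈ weightSub K wt ((k : ℤ) - 3) → x ∈ U := by
    intro k
    induction k with
    | zero =>
      intro x _ hx
      rw [weightSub_of_lt K (by norm_num)] at hx
      rw [(Submodule.mem_bot K).1 hx]
      exact U.zero_mem
    | succ k ih =>
      intro x hxV hx
      have hx' : grProj K ((k + 1 : ℕ) - 3 : ℤ) x ∈ grPiece ((k + 1 : ℕ) - 3 : ℤ) U := by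
        rw [hg]
        exact ⟨x, ⟨hxV, hx⟩, rfl⟩
      obtain ⟨y, ⟨hyU, hy⟩, hxy⟩ := hx'
      have hd : x - y ∈ U := by
        refine ih _ (V.sub_mem hxV (hUV hyU)) fun j hj => ?_
        rcases eq_or_lt_of_le (show ((k + 1 : ℕ) - 3 : ℤ) ≤ wt j by push_cast; omega) with h | h
        · have := congrFun hxy j
          rw [grProj_apply, grProj_apply, if_pos h.symm, if_pos h.symm] at this
          simp [this]
        · simp [hx j h, hy j h]
      simpa using U.add_mem hd hyU
  refine le_antisymm hUV fun x hx => key 3 x hx ?_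
  rw [weightSub_of_nonneg K (by norm_num)]
  trivial

/-! ### Split filtrations of gr^W -/

/-- The filtration of `gr^W` of the given Hodge numbers for which the line in `gr^W_{-1}` is spanned
by `v`. -/
def gradedFil (v : Fin 2 → ℂ) : Fil := fun l =>
  { carrier := {x | (0 ≤ l → x 0 = 0) ∧ (l = 0 → x 1 * v 1 = x 2 * v 0) ∧
      (0 < l → x 1 = 0 ∧ x 2 = 0 ∧ x 3 = 0)}
    add_mem' := by
      rintro x y ⟨h1, h2, h3⟩ ⟨h1', h2', h3'⟩
      refine ⟨fun h => by simp [h1 h, h1' h], fun h => ?_, fun h => ?_⟩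
      · simp only [Pi.add_apply, add_mul, h2 h, h2' h]
      · simp [h3 h, h3' h]
    zero_mem' := by simp
    smul_mem' := by
      rintro a x ⟨h1, h2, h3⟩
      refine ⟨fun h => by simp [h1 h], fun h => ?_, fun h => by simp [h3 h]⟩
      simp only [Pi.smul_apply, smul_eq_mul, mul_assoc, h2 h] }

theorem mem_gradedFil {v : Fin 2 → ℂ} {l : ℤ} {x : Fin 4 → ℂ} :
    x ∈ gradedFil v l ↔ (0 ≤ l → x 0 = 0) ∧ (l = 0 → x 1 * v 1 = x 2 * v 0) ∧
      (0 < l → x 1 = 0 ∧ x 2 = 0 ∧ x 3 = 0) := Iff.rfl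

theorem gradedFil_of_neg (v : Fin 2 → ℂ) {l : ℤ} (hl : l < 0) : gradedFil v l = ⊤ := by
  rw [eq_top_iff]
  intro x _
  exact ⟨fun h => by omega, fun h => by omega, fun h => by omega⟩

theorem gradedFil_of_pos (v : Fin 2 → ℂ) {l : ℤ} (hl : 0 < l) : gradedFil v l = ⊥ := by
  rw [eq_bot_iff]
  rintro x ⟨h1, -, h3⟩
  obtain ⟨h4, h5, h6⟩ := h3 hl
  ext j
  fin_cases j
  exacts [h1 hl.le, h4, h5, h6]

theorem gradedFil_antitone (v : Fin 2 → ℂ) : Antitone (gradedFil v) := by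
  intro p q hpq
  rcases lt_trichotomy p 0 with h | h | h
  · rw [gradedFil_of_neg v h]; exact le_top
  · rcases eq_or_lt_of_le hpq with h' | h'
    · rw [h']
    · rw [gradedFil_of_pos v (h ▸ h')]; exact bot_le
  · rw [gradedFil_of_pos v (h.trans_le hpq)]; exact bot_le

theorem mem_grPiece_gradedFil {v : Fin 2 → ℂ} {w l : ℤ} {x : Fin 4 → ℂ} :
    x ∈ grPiece w (gradedFil v l) ↔ x ∈ gradedFil v l ∧ ∀ j, wt j ≠ w → x j = 0 := by
  constructor
  · rintro ⟨y, ⟨⟨h1, h2, h3⟩, -⟩, rfl⟩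
    refine ⟨⟨fun h => ?_, fun h => ?_, fun h => ?_⟩, fun j hj => ?_⟩
    · rw [grProj_apply, h1 h, ite_self]
    · rw [grProj_apply, grProj_apply]
      have h2 := h2 h
      by_cases hw : w = -1
      · simp [wt, hw, h2]
      · simp [wt, Ne.symm hw]
    · obtain ⟨h4, h5, h6⟩ := h3 h
      simp [grProj_apply, h4, h5, h6]
    · rw [grProj_apply, if_neg hj]
  · rintro ⟨hx, h⟩
    refine ⟨x, ⟨hx, fun j hj => h j hj.ne'⟩, ?_⟩
    ext j
    rw [grProj_apply]
    split_ifs with hj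
    · rfl
    · exact (h j hj).symm

theorem gr_gradedFil (v : Fin 2 → ℂ) : gr (gradedFil v) = gradedFil v := by
  funext p
  apply le_antisymm
  · exact iSup_le fun w x hx => (mem_grPiece_gradedFil.1 hx).1
  · intro x hx
    have hs : x = grProj ℂ (-2) x + grProj ℂ (-1) x + grProj ℂ 0 x := by
      ext j
      simp only [Pi.add_apply, grProj_apply]
      fin_cases j <;> simp [wt]
    have hm : ∀ w, grProj ℂ w x ∈ gr (gradedFil v) p := by
      intro w
      refine (le_iSup (fun w => grPiece w (gradedFil v p)) w) (mem_grPiece_gradedFil.2 ⟨?_, ?_⟩)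
      · obtain ⟨h1, h2, h3⟩ := hx
        refine ⟨fun h => by rw [grProj_apply, h1 h, ite_self], fun h => ?_, fun h => ?_⟩
        · rw [grProj_apply, grProj_apply]
          have h2 := h2 h
          by_cases hw : w = -1
          · simp [wt, hw, h2]
          · simp [wt, Ne.symm hw]
        · obtain ⟨h4, h5, h6⟩ := h3 h
          simp [grProj_apply, h4, h5, h6]
      · intro j hj
        rw [grProj_apply, if_neg hj]
    rw [hs]
    exact add_mem (add_mem (hm _) (hm _)) (hm _)

/-- The rank of `F^l gr^W_w` for `F ∈ Ď`. -/
def grRank (w l : ℤ) : ℕ :=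
  if w = -2 then (if l < 0 then 1 else 0)
  else if w = -1 then (if l < 0 then 2 else if l = 0 then 1 else 0)
  else if w = 0 then (if l ≤ 0 then 1 else 0)
  else 0

theorem finrank_eq_one_of_span {U : Submodule ℂ (Fin 4 → ℂ)} (v : Fin 4 → ℂ) (hv : v ≠ 0)
    (hU : ∀ x, x ∈ U ↔ ∃ a : ℂ, a • v = x) : Module.finrank ℂ U = 1 := by
  have : U = Submodule.span ℂ {v} := by
    ext x
    rw [hU, Submodule.mem_span_singleton]
  rw [this, finrank_span_singleton hv]

theorem finrank_grPiece_gradedFil {v : Fin 2 → ℂ} (hv : v ≠ 0) (w l : ℤ) :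
    Module.finrank ℂ (grPiece w (gradedFil v l)) = grRank w l := by
  have hbot : (∀ x ∈ grPiece w (gradedFil v l), x = 0) →
      Module.finrank ℂ (grPiece w (gradedFil v l)) = 0 := by
    intro h
    rw [(Submodule.eq_bot_iff _).2 h, finrank_bot]
  have hpos : 0 < l → Module.finrank ℂ (grPiece w (gradedFil v l)) = 0 := fun h => hbot fun x hx => by
    have := (mem_grPiece_gradedFil.1 hx).1
    rwa [gradedFil_of_pos v h] at this
  unfold grRank
  split_ifs with h1 h2 h3 h4 h5 h6 h7
  · subst h1
    refine finrank_eq_one_of_span ![1, 0, 0, 0] (fun h => by simpa using congrFun h 0) fun x => ?_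
    rw [mem_grPiece_gradedFil, gradedFil_of_neg v h2]
    constructor
    · rintro ⟨-, h⟩
      refine ⟨x 0, ?_⟩
      ext j
      fin_cases j
      · simp
      · simp [h 1 (by simp [wt])]
      · simp [h 2 (by simp [wt])]
      · simp [h 3 (by simp [wt])]
    · rintro ⟨a, rfl⟩
      refine ⟨trivial, fun j hj => ?_⟩
      fin_cases j <;> simp [wt] at hj ⊢
  · refine hbot fun x hx => ?_
    obtain ⟨⟨h3, -, -⟩, h⟩ := mem_grPiece_gradedFil.1 hx
    subst h1
    ext j
    fin_cases j
    exacts [h3 (by omega), h 1 (by simp [wt]), h 2 (by simp [wt]), h 3 (by simp [wt])]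
  · subst h3
    have : grPiece (-1) (gradedFil v l) =
        LinearMap.range (!![0, 0; 1, 0; 0, 1; 0, 0] : Matrix (Fin 4) (Fin 2) ℂ).mulVecLin := by
      ext x
      rw [mem_grPiece_gradedFil, gradedFil_of_neg v h4]
      constructor
      · rintro ⟨-, h⟩
        refine ⟨![x 1, x 2], ?_⟩
        ext j
        have h0 := h 0 (by simp [wt])
        have h3 := h 3 (by simp [wt])
        fin_cases j <;> simp [Matrix.mulVec, dotProduct, Fin.sum_univ_two, h0, h3]
      · rintro ⟨a, rfl⟩
        refine ⟨trivial, fun j hj => ?_⟩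
        fin_cases j <;> simp [wt, Matrix.mulVec, dotProduct, Fin.sum_univ_two] at hj ⊢
    rw [this, LinearMap.finrank_range_of_inj]
    · simp
    · intro x y hxy
      have e1 := congrFun hxy 1
      have e2 := congrFun hxy 2
      simp [Matrix.mulVec, dotProduct, Fin.sum_univ_two] at e1 e2
      ext j
      fin_cases j
      exacts [e1, e2]
  · subst h3 h5
    refine finrank_eq_one_of_span ![0, v 0, v 1, 0] (fun h => hv ?_) fun x => ?_
    · ext j
      fin_cases j
      exacts [congrFun h 1, congrFun h 2]
    rw [mem_grPiece_gradedFil]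
    constructor
    · rintro ⟨⟨-, h2, -⟩, h⟩
      have h0 := h 0 (by simp [wt])
      have h3 := h 3 (by simp [wt])
      have h2 := h2 rfl
      by_cases hv1 : v 1 = 0
      · have hv0 : v 0 ≠ 0 := fun hv0 => hv (by ext j; fin_cases j <;> assumption)
        refine ⟨x 1 / v 0, ?_⟩
        have hx2 : x 2 = 0 := by simpa [hv1, hv0] using h2.symm
        ext j
        fin_cases j <;> simp [h0, h3, hx2, hv1, hv0]
      · refine ⟨x 2 / v 1, ?_⟩
        ext j
        fin_cases j
        · simp [h0]
        · simp; field_simp; rw [← h2, mul_comm]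
        · simp [hv1]
        · simp [h3]
    · rintro ⟨a, rfl⟩
      refine ⟨⟨fun _ => by simp, fun _ => by simp; ring, fun h => by omega⟩, fun j hj => ?_⟩
      fin_cases j <;> simp [wt] at hj ⊢
  · exact hpos (by omega)
  · subst h6
    refine finrank_eq_one_of_span ![0, 0, 0, 1] (fun h => by simpa using congrFun h 3) fun x => ?_
    rw [mem_grPiece_gradedFil]
    constructor
    · rintro ⟨-, h⟩
      refine ⟨x 3, ?_⟩
      ext j
      fin_cases j
      · simp [h 0 (by simp [wt])]
      · simp [h 1 (by simp [wt])]
      · simp [h 2 (by simp [wt])]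
      · simp
    · rintro ⟨a, rfl⟩
      refine ⟨⟨fun _ => by simp, fun _ => by simp, fun h => by omega⟩, fun j hj => ?_⟩
      fin_cases j <;> simp [wt] at hj ⊢
  · exact hpos (by omega)
  · refine hbot fun x hx => ?_
    obtain ⟨-, h⟩ := mem_grPiece_gradedFil.1 hx
    ext j
    refine h j fun hj => ?_
    fin_cases j <;> simp [wt] at hj <;> omega

theorem grRank_eq (p q : ℤ) : grRank (p + q) p = grRank (p + q) (p + 1) + hodgeNumber p q := by
  unfold grRank hodgeNumber
  split_ifs <;> omega

theorem gradedFil_mem_checkD {v : Fin 2 → ℂ} (hv : v ≠ 0) : gradedFil v ∈ checkD := by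
  refine ⟨gradedFil_antitone v, fun p q => ?_, fun p q w hw x hx y hy => ?_⟩
  · rw [finrank_grPiece_gradedFil hv, finrank_grPiece_gradedFil hv, grRank_eq]
  · obtain ⟨⟨hx1, hx2, hx3⟩, hx⟩ := mem_grPiece_gradedFil.1 hx
    obtain ⟨⟨hy1, hy2, hy3⟩, hy⟩ := mem_grPiece_gradedFil.1 hy
    unfold pairing
    have t0 : x 0 * y 0 = 0 := by
      by_cases h : w = -2
      · rcases le_or_gt 0 p with hp | hp
        · rw [hx1 hp, zero_mul]
        · rw [hy1 (by omega), mul_zero]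
      · rw [hx 0 (by simpa [wt] using Ne.symm h), zero_mul]
    have t3 : x 3 * y 3 = 0 := by
      by_cases h : w = 0
      · rcases lt_or_ge 0 p with hp | hp
        · rw [(hx3 hp).2.2, zero_mul]
        · rw [(hy3 (by omega)).2.2, mul_zero]
      · rw [hx 3 (by simpa [wt] using Ne.symm h), zero_mul]
    have t1 : x 2 * y 1 - x 1 * y 2 = 0 := by
      by_cases h : w = -1
      · rcases lt_or_ge 0 p with hp | hp
        · rw [(hx3 hp).1, (hx3 hp).2.1]; simp
        rcases lt_or_ge 0 q with hq | hq
        · rw [(hy3 hq).1, (hy3 hq).2.1]; simp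
        have e1 := hx2 (by omega)
        have e2 := hy2 (by omega)
        by_cases hv1 : v 1 = 0
        · have hv0 : v 0 ≠ 0 := fun hv0 => hv (by ext j; fin_cases j <;> assumption)
          have hx2 : x 2 = 0 := by simpa [hv1, hv0] using e1.symm
          have hy2 : y 2 = 0 := by simpa [hv1, hv0] using e2.symm
          simp [hx2, hy2]
        · apply mul_right_cancel₀ hv1
          linear_combination x 2 * e2 - y 2 * e1
      · rw [hx 1 (by simpa [wt] using Ne.symm h), hx 2 (by simpa [wt] using Ne.symm h)]; simp
    rw [t0, t1, t3]; simp

theorem filF_graded (τ : ℂ) : filF τ 0 0 0 = gradedFil ![τ, 1] := by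
  funext p
  unfold filF
  split_ifs with h1 h2
  · rw [gradedFil_of_neg _ h1]
  · subst h2
    ext x
    rw [Submodule.mem_span_pair, mem_gradedFil]
    constructor
    · rintro ⟨a, b, rfl⟩
      simp
    · rintro ⟨h1, h2, -⟩
      refine ⟨x 2, x 3, ?_⟩
      have h1 := h1 le_rfl
      have h2 := h2 rfl
      simp at h2
      ext j
      fin_cases j <;> simp [h1, h2]
  · rw [gradedFil_of_pos _ (by omega)]

theorem gr_filF_graded (τ : ℂ) : gr (filF τ 0 0 0) = filF τ 0 0 0 := by
  rw [filF_graded, gr_gradedFil]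

theorem filF_graded_mem_D {τ : ℂ} (hτ : 0 < τ.im) : filF τ 0 0 0 ∈ D := by
  rw [filF_graded]
  refine ⟨gradedFil_mem_checkD fun h => by simpa using congrFun h 1, fun p q x hx0 hx hx' => ?_⟩
  obtain ⟨⟨hx1, hx2, hx3⟩, hx⟩ := mem_grPiece_gradedFil.1 hx
  obtain ⟨⟨hy1, hy2, hy3⟩, -⟩ := mem_grPiece_gradedFil.1 hx'
  simp only [Pi.star_apply, star_eq_zero] at hy1 hy2 hy3
  have hp : p ≤ 0 := by
    by_contra! hp
    refine hx0 ?_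
    obtain ⟨h4, h5, h6⟩ := hx3 hp
    ext j; fin_cases j
    exacts [hx1 hp.le, h4, h5, h6]
  have hq : q ≤ 0 := by
    by_contra! hp
    refine hx0 ?_
    obtain ⟨h4, h5, h6⟩ := hy3 hp
    ext j; fin_cases j
    exacts [hy1 hp.le, h4, h5, h6]
  by_cases hw2 : p + q = -2
  · rw [hw2] at hx
    have h1 := hx 1 (by simp [wt])
    have h2 := hx 2 (by simp [wt])
    have h3 := hx 3 (by simp [wt])
    have h0 : x 0 ≠ 0 := fun h0 => hx0 (by ext j; fin_cases j <;> assumption)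
    have hp' : p = -1 := by
      have := mt hx1 h0
      have := mt hy1 h0
      omega
    obtain rfl : q = -1 := by omega
    subst hp'
    refine ⟨Complex.normSq (x 0), Complex.normSq_pos.2 h0, ?_⟩
    simp [pairing, h1, h2, h3, Complex.mul_conj]
  by_cases hw1 : p + q = -1
  · rw [hw1] at hx
    have h0 := hx 0 (by simp [wt])
    have h3 := hx 3 (by simp [wt])
    rcases eq_or_lt_of_le hp with rfl | hp
    · obtain rfl : q = -1 := by omega
      have e1 := hx2 rfl
      simp at e1
      have h2 : x 2 ≠ 0 := fun h2 => hx0 (by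
        ext j; fin_cases j
        exacts [h0, by simp [e1, h2], h2, h3])
      refine ⟨2 * τ.im * Complex.normSq (x 2), by have := Complex.normSq_pos.2 h2; positivity, ?_⟩
      simp [pairing, h0, h3, e1]
      apply Complex.ext <;> simp [Complex.normSq_apply] <;> ring
    · obtain rfl : q = 0 := by omega
      obtain rfl : p = -1 := by omega
      have e1 := hy2 rfl
      simp at e1
      have e1 : x 1 = x 2 * (starRingEnd ℂ) τ := by
        have := congrArg (starRingEnd ℂ) e1
        simpa using this
      have h2 : x 2 ≠ 0 := fun h2 => hx0 (by
        ext j; fin_cases j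
        exacts [h0, by simp [e1, h2], h2, h3])
      refine ⟨2 * τ.im * Complex.normSq (x 2), by have := Complex.normSq_pos.2 h2; positivity, ?_⟩
      simp [pairing, h0, h3, e1]
      apply Complex.ext <;> simp [Complex.normSq_apply] <;> ring
  have hw0 : p + q = 0 := by
    by_contra hw0
    refine hx0 (funext fun j => hx j fun hj => ?_)
    fin_cases j <;> simp [wt] at hj <;> omega
  rw [hw0] at hx
  have h0 := hx 0 (by simp [wt])
  have h1 := hx 1 (by simp [wt])
  have h2 := hx 2 (by simp [wt])
  have h3 : x 3 ≠ 0 := fun h3 => hx0 (by ext j; fin_cases j <;> assumption)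
  obtain rfl : p = 0 := by omega
  obtain rfl : q = 0 := by omega
  refine ⟨Complex.normSq (x 3), Complex.normSq_pos.2 h3, ?_⟩
  simp [pairing, h1, h2, h0, Complex.mul_conj]

/-! ### Parametrizations of `D` -/

theorem span_pair_eq {V : Type*} [AddCommGroup V] [Module ℂ V] (x y : V) {μ ν : ℂ} (κ : ℂ)
    (hμ : μ ≠ 0) (hν : ν ≠ 0) :
    Submodule.span ℂ {μ • x, ν • (y + κ • x)} = Submodule.span ℂ {x, y} := by
  have hx : x ∈ Submodule.span ℂ {x, y} := Submodule.subset_span (by simp)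
  have hy : y ∈ Submodule.span ℂ {x, y} := Submodule.subset_span (by simp)
  apply le_antisymm
  · rw [Submodule.span_le]
    rintro _ (rfl | rfl)
    · exact Submodule.smul_mem _ _ hx
    · exact Submodule.smul_mem _ _ (add_mem hy (Submodule.smul_mem _ _ hx))
  · rw [Submodule.span_le]
    rintro _ (rfl | rfl) <;> rw [SetLike.mem_coe, Submodule.mem_span_pair]
    · exact ⟨μ⁻¹, 0, by simp [smul_smul, hμ]⟩
    · refine ⟨-(κ * μ⁻¹), ν⁻¹, ?_⟩
      rw [smul_smul, smul_smul, inv_mul_cancel₀ hν, one_smul, neg_mul, mul_assoc,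
        inv_mul_cancel₀ hμ, mul_one]
      module

/-- It suffices to follow the two generators of F^0: rescaling each of them, and adding κ times the
first to the second, leaves the span unchanged. All actions on explicit filtrations below are
evaluated in this way. -/
theorem act_filF {g : Matrix (Fin 4) (Fin 4) ℂ} (hg : IsUnit g) {τ z₁ z₂ z₃ τ' z₁' z₂' z₃' : ℂ}
    {μ ν : ℂ} (κ : ℂ) (hμ : μ ≠ 0) (hν : ν ≠ 0)
    (h1 : g *ᵥ ![z₁, τ, 1, 0] = μ • ![z₁', τ', 1, 0])
    (h2 : g *ᵥ ![z₂, z₃, 0, 1] = ν • (![z₂', z₃', 0, 1] + κ • ![z₁', τ', 1, 0])) :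
    act g (filF τ z₁ z₂ z₃) = filF τ' z₁' z₂' z₃' := by
  funext p
  unfold act filF
  split_ifs
  · rw [Submodule.map_top, LinearMap.range_eq_top]
    intro x
    exact ⟨g⁻¹ *ᵥ x, by
      simp [Matrix.mul_nonsing_inv _ ((Matrix.isUnit_iff_isUnit_det g).1 hg)]⟩
  · rw [Submodule.map_span, Set.image_pair, Matrix.mulVecLin_apply, Matrix.mulVecLin_apply, h1, h2,
      span_pair_eq _ _ _ hμ hν]
  · rw [Submodule.map_bot]

theorem filF_inj {τ z₁ z₂ z₃ τ' z₁' z₂' z₃' : ℂ} (h : filF τ z₁ z₂ z₃ = filF τ' z₁' z₂' z₃') :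
    τ = τ' ∧ z₁ = z₁' ∧ z₂ = z₂' ∧ z₃ = z₃' := by
  have h0 := congrFun h 0
  simp only [filF, lt_irrefl, if_false, if_true] at h0
  have m1 : (![z₁, τ, 1, 0] : Fin 4 → ℂ) ∈
      Submodule.span ℂ {![z₁', τ', 1, 0], ![z₂', z₃', 0, 1]} := by
    rw [← h0]; exact Submodule.subset_span (by simp)
  have m2 : (![z₂, z₃, 0, 1] : Fin 4 → ℂ) ∈
      Submodule.span ℂ {![z₁', τ', 1, 0], ![z₂', z₃', 0, 1]} := by
    rw [← h0]; exact Submodule.subset_span (by simp)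
  obtain ⟨a, b, h1⟩ := Submodule.mem_span_pair.1 m1
  obtain ⟨a', b', h2⟩ := Submodule.mem_span_pair.1 m2
  have e0 := congrFun h1 0
  have e1 := congrFun h1 1
  have e2 := congrFun h1 2
  have e3 := congrFun h1 3
  have f0 := congrFun h2 0
  have f1 := congrFun h2 1
  have e2' := congrFun h2 2
  have e3' := congrFun h2 3
  simp at e0 e1 e2 e3 f0 f1 e2' e3'
  subst e2 e3 e2' e3'
  simp at e0 e1 f0 f1
  exact ⟨e1.symm, e0.symm, f0.symm, f1.symm⟩

/-- The unipotent matrix carrying `F(τ, 0, 0, 0)` to `F(τ, z₁, z₂, z₃)`. -/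
def shearMat (z₁ z₂ z₃ : ℂ) : Matrix (Fin 4) (Fin 4) ℂ :=
  !![1, 0, z₁, z₂; 0, 1, 0, z₃; 0, 0, 1, 0; 0, 0, 0, 1]

theorem shearMat_mul (z₁ z₂ z₃ : ℂ) : shearMat z₁ z₂ z₃ * shearMat (-z₁) (-z₂) (-z₃) = 1 := by
  ext i j
  fin_cases i <;> fin_cases j <;>
    simp [shearMat, Matrix.mul_apply, Fin.sum_univ_four]

theorem shearMat_preserves (z₁ z₂ z₃ : ℂ) (i j : Fin 4) (h : wt j < wt i) :
    shearMat z₁ z₂ z₃ i j = 0 := by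
  fin_cases i <;> fin_cases j <;> simp [wt, shearMat] at h ⊢

theorem grMat_shearMat (z₁ z₂ z₃ : ℂ) : grMat (shearMat z₁ z₂ z₃) = 1 := by
  ext i j
  fin_cases i <;> fin_cases j <;> simp [grMat, wt, shearMat]

theorem act_shearMat (τ z₁ z₂ z₃ : ℂ) :
    act (shearMat z₁ z₂ z₃) (filF τ 0 0 0) = filF τ z₁ z₂ z₃ := by
  refine act_filF (IsUnit.of_mul_eq_one _ (shearMat_mul z₁ z₂ z₃)) 0 one_ne_zero one_ne_zero ?_ ?_
  all_goals
    ext i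
    fin_cases i <;> simp [shearMat, Matrix.mulVec, dotProduct, Fin.sum_univ_four]

/-- The shear carrying F(τ, 0, 0, 0) to this point induces the identity on gr^W, so only τ is seen
by the graded pieces. -/
theorem grPiece_filF (τ z₁ z₂ z₃ : ℂ) (w p : ℤ) :
    grPiece w (filF τ z₁ z₂ z₃ p) = grPiece w (gradedFil ![τ, 1] p) := by
  rw [← act_shearMat, ← filF_graded, act, grPiece_map (shearMat_preserves _ _ _)
    (shearMat_preserves _ _ _) (shearMat_mul _ _ _), grMat_shearMat, Matrix.mulVecLin_one,
    Submodule.map_id]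

theorem gr_filF (τ z₁ z₂ z₃ : ℂ) : gr (filF τ z₁ z₂ z₃) = filF τ 0 0 0 := by
  rw [← gr_filF_graded τ]
  funext p
  simp only [gr, grSub, grPiece_filF]

theorem filF_mem_D {τ : ℂ} (hτ : 0 < τ.im) (z₁ z₂ z₃ : ℂ) : filF τ z₁ z₂ z₃ ∈ D := by
  have h := filF_graded_mem_D hτ
  rw [filF_graded] at h
  obtain ⟨⟨h1, h2, h3⟩, h4⟩ := h
  refine ⟨⟨fun p q hpq => ?_, ?_, ?_⟩, ?_⟩
  · rw [← act_shearMat, filF_graded]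
    exact Submodule.map_mono (h1 hpq)
  · intro p q
    rw [grPiece_filF, grPiece_filF]
    exact h2 p q
  · simpa only [grPiece_filF] using h3
  · simpa only [grPiece_filF] using h4

theorem finrank_grPiece_le_grRank (w : ℤ) (U : Submodule ℂ (Fin 4 → ℂ)) :
    Module.finrank ℂ (grPiece w U) ≤ grRank w (-1) := by
  have hv : (![Complex.I, 1] : Fin 2 → ℂ) ≠ 0 := fun h => by simpa using congrFun h 1
  rw [← finrank_grPiece_gradedFil hv w (-1), gradedFil_of_neg _ (by norm_num)]
  exact Submodule.finrank_mono (Submodule.map_mono (inf_le_inf_right _ le_top))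

/-- The Hodge numbers only prescribe the drops in rank. But the total drop from F^{-1} to F^1 on
gr^W_w is already the full dimension of gr^W_w, so F^{-1} is everything and F^1 is zero there. -/
theorem finrank_grPiece_of_mem_checkD {F : Fil} (hF : F ∈ checkD) (w : ℤ) :
    Module.finrank ℂ (grPiece w (F (-1))) = grRank w (-1) ∧
      Module.finrank ℂ (grPiece w (F 0)) = grRank w 0 ∧
      Module.finrank ℂ (grPiece w (F 1)) = grRank w 1 := by
  have hrank' : ∀ p p' : ℤ, p' = p + 1 → Module.finrank ℂ (grPiece w (F p)) =
      Module.finrank ℂ (grPiece w (F p')) + hodgeNumber p (w - p) := fun p p' h => by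
    have := hF.2.1 p (w - p)
    rwa [add_sub_cancel, ← h] at this
  have a1 := hrank' (-1) 0 rfl
  have a2 := hrank' 0 1 rfl
  have a3 := finrank_grPiece_le_grRank w (F (-1))
  generalize Module.finrank ℂ (grPiece w (F (-1))) = x at *
  generalize Module.finrank ℂ (grPiece w (F 0)) = y at *
  generalize Module.finrank ℂ (grPiece w (F 1)) = z at *
  clear hrank'
  unfold hodgeNumber at a1 a2
  unfold grRank at a3 ⊢
  split_ifs at * <;> omega

/-- The rank count gives F^{-1} and F^1. The polarization makes the e_3-coordinate of the generator
in W_{-1} nonzero, and the rank on gr^W_0 gives a vector with nonzero e_4-coordinate; normalizing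
these two vectors yields a subspace of F^0 with the same graded ranks, hence F^0 itself. -/
theorem exists_filF_of_mem_D {F : Fil} (hF : F ∈ D) :
    ∃ τ z₁ z₂ z₃ : ℂ, 0 < τ.im ∧ F = filF τ z₁ z₂ z₃ := by
  have key := finrank_grPiece_of_mem_checkD hF.1
  obtain ⟨⟨hanti, -, -⟩, hpos⟩ := hF
  have hm1 : F (-1) = ⊤ := by
    refine eq_of_le_of_finrank_grPiece le_top fun w => ?_
    rw [(key w).1]
    exact finrank_grPiece_le_grRank w ⊤
  have h1 : F 1 = ⊥ := by
    symm
    refine eq_of_le_of_finrank_grPiece bot_le fun w => ?_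
    rw [(key w).2.2]
    have h0 : grRank w 1 = 0 := by
      unfold grRank
      split_ifs <;> omega
    rw [h0]
    exact Nat.zero_le _
  have hy : ∃ y ∈ F 0 ⊓ weightSub ℂ wt (-1), grProj ℂ (-1) y ≠ 0 := by
    by_contra! h
    have hb : grPiece (-1) (F 0) = ⊥ := by
      rw [eq_bot_iff]
      rintro _ ⟨y, hy, rfl⟩
      exact (Submodule.mem_bot ℂ).2 (h y hy)
    have := (key (-1)).2.1
    rw [hb, finrank_bot] at this
    simp [grRank] at this
  obtain ⟨y, hyF, hy0⟩ := hy
  have hy3 : y 3 = 0 := hyF.2 3 (by simp [wt])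
  -- Positivity for the type (0, -1): i⟨y, ȳ⟩ = 2 Im(y₁ȳ₂), the coordinates being numbered from 0.
  have hyim : 0 < (y 1 * (starRingEnd ℂ) (y 2)).im := by
    have hpos' := hpos 0 (-1) (grProj ℂ (-1) y) hy0
    rw [zero_add] at hpos'
    obtain ⟨a, ha, h⟩ := hpos' (Submodule.mem_map_of_mem hyF) (by
      rw [hm1]
      refine ⟨star (grProj ℂ (-1) y), ⟨trivial, fun j hj => ?_⟩, ?_⟩
      · simp [grProj_apply, hj.ne']
      · ext j
        by_cases hj : wt j = -1 <;> simp [grProj_apply, hj])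
    have h := congrArg Complex.re h
    simp [pairing, grProj_apply, wt] at h
    simp
    linarith
  have hy2 : y 2 ≠ 0 := fun h => by simp [h] at hyim
  have hx : ∃ x ∈ F 0, x 3 ≠ 0 := by
    by_contra! h
    have hb : grPiece 0 (F 0) = ⊥ := by
      rw [eq_bot_iff]
      rintro _ ⟨x, hx, rfl⟩
      rw [Submodule.mem_bot]
      ext j
      rw [grProj_apply]
      fin_cases j <;> simp [wt, h x hx.1]
    have := (key 0).2.1
    rw [hb, finrank_bot] at this
    simp [grRank] at this
  obtain ⟨x, hxF, hx3⟩ := hx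
  set y' := (y 2)⁻¹ • y with hy'
  set x' := (x 3)⁻¹ • x - ((x 3)⁻¹ * x 2) • y' with hx'
  have hy'F : y' ∈ F 0 := Submodule.smul_mem _ _ hyF.1
  have hx'F : x' ∈ F 0 := Submodule.sub_mem _ (Submodule.smul_mem _ _ hxF) (Submodule.smul_mem _ _ hy'F)
  have ey : y' = ![y' 0, y' 1, 1, 0] := by
    ext j; fin_cases j <;> simp [hy', hy3, hy2]
  have ex : x' = ![x' 0, x' 1, 0, 1] := by
    ext j; fin_cases j <;> simp [hx', hy', hy3, hy2, hx3]
  refine ⟨y' 1, y' 0, x' 0, x' 1, ?_, ?_⟩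
  · have : y' 1 = (Complex.normSq (y 2) : ℂ)⁻¹ * (y 1 * (starRingEnd ℂ) (y 2)) := by
      rw [← Complex.mul_conj]
      have : (starRingEnd ℂ) (y 2) ≠ 0 := by simpa using hy2
      simp only [hy', Pi.smul_apply, smul_eq_mul]
      field_simp
    rw [this, ← Complex.ofReal_inv, Complex.im_ofReal_mul]
    have := Complex.normSq_pos.2 hy2
    positivity
  · funext p
    unfold filF
    split_ifs with hp hp
    · rw [eq_top_iff, ← hm1]
      exact hanti (by omega)
    · subst hp
      symm
      refine eq_of_le_of_finrank_grPiece ?_ fun w => ?_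
      · rw [Submodule.span_le]
        rintro _ (h | h)
        · rw [h, ← ey]; exact hy'F
        · rw [h, ← ex]; exact hx'F
      · have := grPiece_filF (y' 1) (y' 0) (x' 0) (x' 1) w 0
        simp only [filF, lt_irrefl, if_false, if_true] at this
        rw [(key w).2.1, this, finrank_grPiece_gradedFil fun h => by simpa using congrFun h 1]
    · rw [eq_bot_iff, ← h1]
      exact hanti (by omega)

/-! ### The coordinates (τ, s, d) on D -/

/-- The point `s(exp(iδ) F(τ, 0, 0, 0))` with `δ ↔ d`. -/
def ptD (τ : ℂ) (s : Matrix (Fin 4) (Fin 4) ℝ) (d : ℝ) : Fil :=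
  act (s.map Complex.ofReal) (act (1 + Complex.I • (deltaMat d).map Complex.ofReal) (filF τ 0 0 0))

theorem eq_of_mem_splW {s : Matrix (Fin 4) (Fin 4) ℝ} (hs : s ∈ splW) :
    s = !![1, s 0 1, s 0 2, s 0 3; 0, 1, 0, s 1 3; 0, 0, 1, s 2 3; 0, 0, 0, 1] := by
  ext i j
  fin_cases i <;> fin_cases j <;> simp
  all_goals first | (rw [hs _ _ (by simp [wt])]; simp)

theorem expDelta_eq (d : ℝ) : (1 + Complex.I • (deltaMat d).map Complex.ofReal) =
    !![1, 0, 0, Complex.I * d; 0, 1, 0, 0; 0, 0, 1, 0; 0, 0, 0, 1] := by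
  ext i j
  fin_cases i <;> fin_cases j <;> simp [deltaMat, Matrix.single]

theorem splW_mul_inv {s : Matrix (Fin 4) (Fin 4) ℝ} (hs : s ∈ splW) : ∃ s' ∈ splW, s * s' = 1 := by
  refine ⟨!![1, -s 0 1, -s 0 2, -s 0 3 + s 0 1 * s 1 3 + s 0 2 * s 2 3; 0, 1, 0, -s 1 3;
    0, 0, 1, -s 2 3; 0, 0, 0, 1], ?_, ?_⟩
  · intro i j h
    fin_cases i <;> fin_cases j <;> simp [wt] at h ⊢
  · nth_rewrite 1 [eq_of_mem_splW hs]
    ext i j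
    fin_cases i <;> fin_cases j <;> simp [Matrix.mul_apply, Fin.sum_univ_four] <;> ring

theorem isUnit_map_of_mem_splW {s : Matrix (Fin 4) (Fin 4) ℝ} (hs : s ∈ splW) :
    IsUnit (s.map Complex.ofReal) := by
  obtain ⟨s', -, h⟩ := splW_mul_inv hs
  refine IsUnit.of_mul_eq_one (s'.map Complex.ofReal) ?_
  have := congrArg (fun m => Matrix.map m Complex.ofRealHom) h
  simpa only [Matrix.map_mul, Matrix.map_one _ (map_zero _) (map_one _)] using! this

theorem isUnit_expDelta (d : ℝ) :
    IsUnit (1 + Complex.I • (deltaMat d).map Complex.ofReal) := by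
  refine IsUnit.of_mul_eq_one (1 + Complex.I • (deltaMat (-d)).map Complex.ofReal) ?_
  rw [expDelta_eq, expDelta_eq]
  ext i j
  fin_cases i <;> fin_cases j <;> simp [Matrix.mul_apply, Fin.sum_univ_four]

theorem ptD_eq_filF (τ : ℂ) {s : Matrix (Fin 4) (Fin 4) ℝ} (hs : s ∈ splW) (d : ℝ) :
    ptD τ s d = filF τ (τ * s 0 1 + s 0 2)
      (s 0 3 + Complex.I * d - s 2 3 * (τ * s 0 1 + s 0 2)) (s 1 3 - s 2 3 * τ) := by
  rw [ptD, ← act_mul]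
  -- The image of the second generator has e_3-coordinate `s 2 3`; removing it costs that multiple
  -- of the first generator.
  refine act_filF ((isUnit_map_of_mem_splW hs).mul (isUnit_expDelta d)) (μ := 1) (ν := 1) (s 2 3)
    one_ne_zero one_ne_zero ?_ ?_
  all_goals
    rw [expDelta_eq, eq_of_mem_splW hs, ← Matrix.mulVec_mulVec]
    ext i
    fin_cases i <;> simp [Matrix.mulVec, dotProduct, Fin.sum_univ_four] <;> ring

theorem gr_ptD (τ : ℂ) {s : Matrix (Fin 4) (Fin 4) ℝ} (hs : s ∈ splW) (d : ℝ) :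
    gr (ptD τ s d) = filF τ 0 0 0 := by
  rw [ptD_eq_filF τ hs, gr_filF]

theorem ptD_mem_D {τ : ℂ} (hτ : 0 < τ.im) {s : Matrix (Fin 4) (Fin 4) ℝ} (hs : s ∈ splW) (d : ℝ) :
    ptD τ s d ∈ D := by
  rw [ptD_eq_filF τ hs]
  exact filF_mem_D hτ _ _ _

/-- Since Im τ > 0, real numbers x, y are determined by xτ + y. This recovers the entries of s that
enter z₁ and z₃; then the real and imaginary parts of z₂ give the last entry of s and d. -/
theorem ptD_inj {τ τ' : ℂ} (hτ : 0 < τ.im) {s s' : Matrix (Fin 4) (Fin 4) ℝ} (hs : s ∈ splW)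
    (hs' : s' ∈ splW) {d d' : ℝ} (h : ptD τ s d = ptD τ' s' d') : τ = τ' ∧ s = s' ∧ d = d' := by
  rw [ptD_eq_filF τ hs, ptD_eq_filF τ' hs'] at h
  obtain ⟨rfl, h1, h2, h3⟩ := filF_inj h
  have e1 := congrArg Complex.im h1
  have e1' := congrArg Complex.re h1
  have e3 := congrArg Complex.im h3
  have e3' := congrArg Complex.re h3
  simp at e1 e1' e3 e3'
  have a1 : s 0 1 = s' 0 1 := by
    rcases e1 with h | h
    · exact h
    · exact absurd h hτ.ne'
  have a3 : s 2 3 = s' 2 3 := by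
    rcases e3 with h | h
    · exact h
    · exact absurd h hτ.ne'
  rw [a1] at e1' h1
  rw [a3] at e3' h2
  have a2 : s 0 2 = s' 0 2 := by simpa using e1'
  have a4 : s 1 3 = s' 1 3 := by simpa using e3'
  rw [a1, a2] at h2
  have e2 := congrArg Complex.im h2
  have e2d := congrArg Complex.re h2
  simp at e2 e2d
  refine ⟨rfl, ?_, e2⟩
  rw [eq_of_mem_splW hs, eq_of_mem_splW hs', a1, a2, a3, a4, e2d]

/-- The splitting of the point `F(τ, z₁, z₂, z₃)`. -/
def splMat (τ z₁ z₂ z₃ : ℂ) : Matrix (Fin 4) (Fin 4) ℝ :=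
  !![1, z₁.im / τ.im, z₁.re - τ.re * (z₁.im / τ.im), z₂.re - z₃.im / τ.im * z₁.re;
     0, 1, 0, z₃.re - z₃.im / τ.im * τ.re;
     0, 0, 1, -(z₃.im / τ.im);
     0, 0, 0, 1]

theorem splMat_mem (τ z₁ z₂ z₃ : ℂ) : splMat τ z₁ z₂ z₃ ∈ splW := by
  intro i j h
  fin_cases i <;> fin_cases j <;> simp [wt, splMat] at h ⊢

/-- Obtained by solving `ptD_eq_filF` for s and d. The value of d is the formula for δ on which the
whole asymptotic analysis rests. -/
theorem filF_eq_ptD {τ : ℂ} (hτ : 0 < τ.im) (z₁ z₂ z₃ : ℂ) :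
    filF τ z₁ z₂ z₃ = ptD τ (splMat τ z₁ z₂ z₃) (z₂.im - z₁.im * z₃.im / τ.im) := by
  rw [ptD_eq_filF τ (splMat_mem _ _ _ _)]
  have h := hτ.ne'
  congr 1 <;> apply Complex.ext <;> simp [splMat] <;> field_simp <;> ring

theorem exists_ptD_of_mem_D {F : Fil} (hF : F ∈ D) :
    ∃ τ s d, 0 < τ.im ∧ s ∈ splW ∧ F = ptD τ s d := by
  obtain ⟨τ, z₁, z₂, z₃, hτ, rfl⟩ := exists_filF_of_mem_D hF
  exact ⟨τ, _, _, hτ, splMat_mem _ _ _ _, filF_eq_ptD hτ _ _ _⟩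

theorem exists_filF_of_mem_Dgr {G : Fil} (hG : G ∈ Dgr) : ∃ τ : ℂ, 0 < τ.im ∧ G = filF τ 0 0 0 := by
  obtain ⟨τ, z₁, z₂, z₃, hτ, rfl⟩ := exists_filF_of_mem_D hG.1
  refine ⟨τ, hτ, ?_⟩
  rw [← hG.2, gr_filF]

/-- `delta` and `splOf` are picked by `epsilon`; this uniqueness is what allows them to be
evaluated. -/
theorem hasSplitting_ptD_iff {τ : ℂ} (hτ : 0 < τ.im) {s s' : Matrix (Fin 4) (Fin 4) ℝ}
    (hs : s ∈ splW) {d d' : ℝ} : HasSplitting (ptD τ s d) s' d' ↔ s' = s ∧ d' = d := by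
  unfold HasSplitting
  rw [gr_ptD τ hs]
  constructor
  · rintro ⟨hs', h⟩
    obtain ⟨-, h1, h2⟩ := ptD_inj hτ hs hs' (d' := d') h
    exact ⟨h1.symm, h2.symm⟩
  · rintro ⟨rfl, rfl⟩
    exact ⟨hs, rfl⟩

theorem delta_ptD {τ : ℂ} (hτ : 0 < τ.im) {s : Matrix (Fin 4) (Fin 4) ℝ} (hs : s ∈ splW) (d : ℝ) :
    delta (ptD τ s d) = d := by
  have h := Classical.epsilon_spec (p := fun d' => ∃ s', HasSplitting (ptD τ s d) s' d')
    ⟨d, s, (hasSplitting_ptD_iff hτ hs).2 ⟨rfl, rfl⟩⟩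
  obtain ⟨s', h⟩ := h
  exact ((hasSplitting_ptD_iff hτ hs).1 h).2

theorem splOf_ptD {τ : ℂ} (hτ : 0 < τ.im) {s : Matrix (Fin 4) (Fin 4) ℝ} (hs : s ∈ splW) (d : ℝ) :
    splOf (ptD τ s d) = s := by
  have h := Classical.epsilon_spec (p := fun s' => ∃ d', HasSplitting (ptD τ s d) s' d')
    ⟨s, d, (hasSplitting_ptD_iff hτ hs).2 ⟨rfl, rfl⟩⟩
  obtain ⟨d', h⟩ := h
  exact ((hasSplitting_ptD_iff hτ hs).1 h).1

theorem splOf_mem {F : Fil} (hF : F ∈ D) : splOf F ∈ splW := by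
  obtain ⟨τ, s, d, hτ, hs, rfl⟩ := exists_ptD_of_mem_D hF
  rwa [splOf_ptD hτ hs]

theorem eq_ptD_of_mem_D {F : Fil} (hF : F ∈ D) {τ : ℂ} (h : gr F = filF τ 0 0 0) :
    F = ptD τ (splOf F) (delta F) := by
  obtain ⟨τ', s, d, hτ, hs, rfl⟩ := exists_ptD_of_mem_D hF
  rw [gr_ptD τ' hs] at h
  rw [splOf_ptD hτ hs, delta_ptD hτ hs, (filF_inj h).1]

/-! ### The map `ν` on `D` -/

theorem tauOf_filF (τ : ℂ) : tauOf (filF τ 0 0 0) = τ := by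
  have key : ∀ τ', (![0, τ', 1, 0] : Fin 4 → ℂ) ∈ filF τ 0 0 0 0 ↔ τ' = τ := fun τ' => by
    rw [filF_graded, mem_gradedFil]
    simp
  simp only [tauOf, key]
  exact Classical.epsilon_spec (p := fun τ' => τ' = τ) ⟨τ, rfl⟩

/-! ### The Weil operator and the Borel–Serre splitting -/

/-- The Weil operator of `F(τ, 0, 0, 0)`. -/
def weilMat (τ : ℂ) : Matrix (Fin 4) (Fin 4) ℂ :=
  !![1, 0, 0, 0;
     0, τ.re * (τ.im : ℂ)⁻¹, -(τ.re ^ 2 + τ.im ^ 2) * (τ.im : ℂ)⁻¹, 0;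
     0, (τ.im : ℂ)⁻¹, -τ.re * (τ.im : ℂ)⁻¹, 0;
     0, 0, 0, 1]

theorem weilMat_mulVec {τ : ℂ} (hτ : 0 < τ.im) :
    weilMat τ *ᵥ ![0, τ, 1, 0] = Complex.I • ![0, τ, 1, 0] ∧
    weilMat τ *ᵥ ![0, (starRingEnd ℂ) τ, 1, 0] = (-Complex.I) • ![0, (starRingEnd ℂ) τ, 1, 0] := by
  have h : (τ.im : ℂ) * (τ.im : ℂ)⁻¹ = 1 := mul_inv_cancel₀ (by exact_mod_cast hτ.ne')
  have e1 : (τ.re : ℂ) + τ.im * Complex.I = τ := Complex.re_add_im τ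
  have e2 : (τ.re : ℂ) - τ.im * Complex.I = (starRingEnd ℂ) τ := by
    apply Complex.ext <;> simp
  have hI : Complex.I ^ 2 = -1 := Complex.I_sq
  constructor
  · ext i
    fin_cases i <;> simp [weilMat, Matrix.mulVec, dotProduct, Fin.sum_univ_four]
    · linear_combination (τ.re * Complex.I - τ.im) * h - τ.im * hI -
        (τ.re * (τ.im : ℂ)⁻¹ - Complex.I) * e1
    · linear_combination Complex.I * h - (τ.im : ℂ)⁻¹ * e1
  · ext i
    fin_cases i <;> simp [weilMat, Matrix.mulVec, dotProduct, Fin.sum_univ_four]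
    · linear_combination (-τ.re * Complex.I - τ.im) * h - τ.im * hI -
        (τ.re * (τ.im : ℂ)⁻¹ + Complex.I) * e2
    · linear_combination -Complex.I * h - (τ.im : ℂ)⁻¹ * e2

theorem isWeil_weilMat {τ : ℂ} (hτ : 0 < τ.im) : IsWeil (filF τ 0 0 0) (weilMat τ) := by
  rw [filF_graded]
  intro p q x hx hx'
  obtain ⟨⟨hx1, hx2, hx3⟩, hx⟩ := mem_grPiece_gradedFil.1 hx
  obtain ⟨⟨hy1, hy2, hy3⟩, -⟩ := mem_grPiece_gradedFil.1 hx'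
  simp only [Pi.star_apply, star_eq_zero] at hy1 hy2 hy3
  by_cases hx0 : x = 0
  · simp [hx0]
  have hp : p ≤ 0 := by
    by_contra! hp
    refine hx0 ?_
    obtain ⟨h4, h5, h6⟩ := hx3 hp
    ext j; fin_cases j
    exacts [hx1 hp.le, h4, h5, h6]
  have hq : q ≤ 0 := by
    by_contra! hp
    refine hx0 ?_
    obtain ⟨h4, h5, h6⟩ := hy3 hp
    ext j; fin_cases j
    exacts [hy1 hp.le, h4, h5, h6]
  by_cases hw2 : p + q = -2
  · rw [hw2] at hx
    have h1 := hx 1 (by simp [wt])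
    have h2 := hx 2 (by simp [wt])
    have h3 := hx 3 (by simp [wt])
    have h0 : x 0 ≠ 0 := fun h0 => hx0 (by ext j; fin_cases j <;> assumption)
    have hpq : p = q := by
      have := mt hx1 h0
      have := mt hy1 h0
      omega
    rw [hpq, sub_self, zpow_zero, one_smul]
    ext i
    fin_cases i <;> simp [weilMat, Matrix.mulVec, dotProduct, Fin.sum_univ_four, h1, h2, h3]
  by_cases hw1 : p + q = -1
  · rw [hw1] at hx
    have h0 := hx 0 (by simp [wt])
    have h3 := hx 3 (by simp [wt])
    rcases eq_or_lt_of_le hp with rfl | hp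
    · obtain rfl : q = -1 := by omega
      have e1 := hx2 rfl
      simp at e1
      have ex : x = x 2 • ![0, τ, 1, 0] := by
        ext j; fin_cases j <;> simp [h0, h3, e1]
      rw [ex, Matrix.mulVec_smul, (weilMat_mulVec hτ).1, smul_comm]
      simp
    · obtain rfl : q = 0 := by omega
      obtain rfl : p = -1 := by omega
      have e1 := hy2 rfl
      simp at e1
      have e1 : x 1 = x 2 * (starRingEnd ℂ) τ := by
        have := congrArg (starRingEnd ℂ) e1
        simpa using this
      have ex : x = x 2 • ![0, (starRingEnd ℂ) τ, 1, 0] := by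
        ext j; fin_cases j <;> simp [h0, h3, e1]
      rw [ex, Matrix.mulVec_smul, (weilMat_mulVec hτ).2, smul_comm]
      simp
  have hw0 : p + q = 0 := by
    by_contra hw0
    refine hx0 (funext fun j => hx j fun hj => ?_)
    fin_cases j <;> simp [wt] at hj <;> omega
  rw [hw0] at hx
  have h0 := hx 0 (by simp [wt])
  have h1 := hx 1 (by simp [wt])
  have h2 := hx 2 (by simp [wt])
  obtain rfl : p = 0 := by omega
  obtain rfl : q = 0 := by omega
  rw [sub_self, zpow_zero, one_smul]
  ext i
  fin_cases i <;> simp [weilMat, Matrix.mulVec, dotProduct, Fin.sum_univ_four, h1, h2, h0]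

/-- The Hodge vectors e'_1, e'_4, τe'_2 + e'_3 and its conjugate form a basis, because τ is not
real. -/
theorem IsWeil.eq_weilMat {τ : ℂ} (hτ : 0 < τ.im) {C : Matrix (Fin 4) (Fin 4) ℂ}
    (hC : IsWeil (filF τ 0 0 0) C) : C = weilMat τ := by
  have hW := isWeil_weilMat hτ
  have key : ∀ (p q w : ℤ) (x : Fin 4 → ℂ), w = p + q → x ∈ gradedFil ![τ, 1] p →
      star x ∈ gradedFil ![τ, 1] q → (∀ j, wt j ≠ w → x j = 0) →
      (C - weilMat τ) *ᵥ x = 0 := by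
    rintro p q w x rfl hx hx' h
    rw [filF_graded] at hC hW
    have m1 : x ∈ grPiece (p + q) (gradedFil ![τ, 1] p) := mem_grPiece_gradedFil.2 ⟨hx, h⟩
    have m2 : star x ∈ grPiece (p + q) (gradedFil ![τ, 1] q) :=
      mem_grPiece_gradedFil.2 ⟨hx', fun j hj => by simp [h j hj]⟩
    rw [Matrix.sub_mulVec, hC p q x m1 m2, hW p q x m1 m2, sub_self]
  have k0 := key (-1) (-1) (-2) ![1, 0, 0, 0] rfl (by rw [gradedFil_of_neg _ (by norm_num)]; trivial)
    (by rw [gradedFil_of_neg _ (by norm_num)]; trivial)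
    (fun j hj => by fin_cases j <;> simp [wt] at hj ⊢)
  have k3 := key 0 0 0 ![0, 0, 0, 1] rfl (by simp [mem_gradedFil]) (by simp [mem_gradedFil])
    (fun j hj => by fin_cases j <;> simp [wt] at hj ⊢)
  have k1 := key 0 (-1) (-1) ![0, τ, 1, 0] rfl (by simp [mem_gradedFil])
    (by rw [gradedFil_of_neg _ (by norm_num)]; trivial)
    (fun j hj => by fin_cases j <;> simp [wt] at hj ⊢)
  have k2 := key (-1) 0 (-1) ![0, (starRingEnd ℂ) τ, 1, 0] rfl
    (by rw [gradedFil_of_neg _ (by norm_num)]; trivial) (by simp [mem_gradedFil])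
    (fun j hj => by fin_cases j <;> simp [wt] at hj ⊢)
  rw [← sub_eq_zero]
  generalize C - weilMat τ = N at *
  have hne : τ - (starRingEnd ℂ) τ ≠ 0 := by
    intro h
    have := congrArg Complex.im h
    simp at this
    linarith
  ext i j
  have a0 := congrFun k0 i
  have a1 := congrFun k1 i
  have a2 := congrFun k2 i
  have a3 := congrFun k3 i
  simp [Matrix.mulVec, dotProduct, Fin.sum_univ_four] at a0 a1 a2 a3
  have b1 : N i 1 = 0 := by
    apply mul_right_cancel₀ hne
    linear_combination a1 - a2
  have b2 : N i 2 = 0 := by simpa [b1] using a1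
  fin_cases j <;> simp [a0, b1, b2, a3]

theorem weilMat_mul_inv {τ : ℂ} (hτ : 0 < τ.im) : weilMat τ * (weilMat τ)⁻¹ = 1 := by
  have h : (τ.im : ℂ) * (τ.im : ℂ)⁻¹ = 1 := mul_inv_cancel₀ (by exact_mod_cast hτ.ne')
  refine Matrix.mul_nonsing_inv _ ?_
  rw [← Matrix.isUnit_iff_isUnit_det]
  -- The square of the Weil operator is -1 on gr^W_{-1} and 1 on the other two pieces.
  refine IsUnit.of_mul_eq_one (weilMat τ * Matrix.diagonal ![1, -1, -1, 1]) ?_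
  rw [← Matrix.mul_assoc]
  ext i j
  fin_cases i <;> fin_cases j <;>
    simp [weilMat, Matrix.mul_apply, Matrix.diagonal]
  · linear_combination (τ.im * (τ.im : ℂ)⁻¹ + 1) * h
  · ring
  · ring
  · linear_combination (τ.im * (τ.im : ℂ)⁻¹ + 1) * h

theorem liftTorus_map_mul (b : ℝ) (a : ℝˣ) :
    (liftTorus b a).map Complex.ofReal * (liftTorus b a⁻¹).map Complex.ofReal = 1 := by
  have h : liftTorus b a * liftTorus b a⁻¹ = 1 := by
    have ha := a.ne_zero
    ext i j
    fin_cases i <;> fin_cases j <;>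
      simp [liftTorus, Matrix.mul_apply, Fin.sum_univ_four]
    field_simp
    ring
  have := congrArg (fun m => Matrix.map m Complex.ofRealHom) h
  simpa only [Matrix.map_mul, Matrix.map_one _ (map_zero _) (map_one _)] using! this

theorem splBS_filF {τ : ℂ} (hτ : 0 < τ.im) : splBS (filF τ 0 0 0) = τ.re := by
  have hv : (τ.im : ℂ) * (τ.im : ℂ)⁻¹ = 1 := mul_inv_cancel₀ (by exact_mod_cast hτ.ne')
  have key : ∀ b : ℝ, (∃ C, IsWeil (filF τ 0 0 0) C ∧ ∀ a : ℝˣ,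
      C * (liftTorus b a).map Complex.ofReal * C⁻¹ = ((liftTorus b a).map Complex.ofReal)⁻¹) ↔
      b = τ.re := by
    intro b
    constructor
    · rintro ⟨C, hC, h⟩
      obtain rfl := hC.eq_weilMat hτ
      -- The single value a = 2 determines b: after multiplying by the Weil operator, the entry (1,
      -- 1) is linear in b with coefficient -(a - 1/a)/Im τ = -(3/2)/Im τ.
      have h2 := h (Units.mk0 2 two_ne_zero)
      rw [Matrix.inv_eq_right_inv (liftTorus_map_mul b _)] at h2
      have h3 := congrArg (fun m => (m * weilMat τ) 1 1) h2
      simp only [Matrix.mul_assoc] at h3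
      rw [mul_eq_one_comm.1 (weilMat_mul_inv hτ), Matrix.mul_one] at h3
      simp [weilMat, liftTorus, Matrix.mul_apply, Fin.sum_univ_four] at h3
      have h4 : (b : ℂ) = τ.re := by
        linear_combination (2 / 3 * τ.im) * h3 - (b - τ.re) * hv
      exact_mod_cast h4
    · rintro rfl
      refine ⟨weilMat τ, isWeil_weilMat hτ, fun a => ?_⟩
      have ha : ((a : ℝ) : ℂ) ≠ 0 := by exact_mod_cast a.ne_zero
      rw [Matrix.inv_eq_right_inv (liftTorus_map_mul _ _)]
      have h : weilMat τ * (liftTorus τ.re a).map Complex.ofReal =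
          (liftTorus τ.re a⁻¹).map Complex.ofReal * weilMat τ := by
        ext i j
        fin_cases i <;> fin_cases j <;>
          simp [weilMat, liftTorus, Matrix.mul_apply, Fin.sum_univ_four] <;> ring
      rw [h, Matrix.mul_assoc, weilMat_mul_inv hτ, Matrix.mul_one]
  simp only [splBS, key]
  exact Classical.epsilon_spec (p := fun b => b = τ.re) ⟨_, rfl⟩

theorem alpha_inv {t : ℝ} (ht : t ≠ 0) : (alpha t)⁻¹ = Matrix.diagonal ![t ^ 2, t ^ 2, 1, 1] := by
  refine Matrix.inv_eq_right_inv ?_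
  rw [alpha, Matrix.diagonal_mul_diagonal, ← Matrix.diagonal_one]
  congr 1
  ext i
  fin_cases i <;> simp [ht]

/-- As β² = 1/Im τ, the matrix α(β)⁻¹ is diag(1/Im τ, 1/Im τ, 1, 1); it divides both τ and δ by Im
τ. -/
theorem nuD_ptD {τ : ℂ} (hτ : 0 < τ.im) {s : Matrix (Fin 4) (Fin 4) ℝ} (hs : s ∈ splW) (d : ℝ) :
    nuD (ptD τ s d) =
      (1 / √τ.im, ((τ.im)⁻¹ : ℝ) * τ, ((d / τ.im : ℝ) : EReal), s, τ.re) := by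
  have hb : beta (gr (ptD τ s d)) = 1 / √τ.im := by rw [gr_ptD τ hs, beta, tauOf_filF]
  have hb0 : 1 / √τ.im ≠ 0 := by positivity
  have hb2 : (1 / √τ.im) ^ 2 = (τ.im)⁻¹ := by rw [div_pow, Real.sq_sqrt hτ.le]; simp
  unfold nuD
  rw [hb, gr_ptD τ hs, delta_ptD hτ hs, splOf_ptD hτ hs, splBS_filF hτ, alpha_inv hb0, hb2]
  have hv : (τ.im : ℂ) ≠ 0 := by exact_mod_cast hτ.ne'
  have h1 : act ((Matrix.diagonal ![(τ.im)⁻¹, (τ.im)⁻¹, 1, 1]).map Complex.ofReal) (filF τ 0 0 0) =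
      filF (((τ.im)⁻¹ : ℝ) * τ) 0 0 0 := by
    refine act_filF ?_ 0 (μ := 1) (ν := 1) one_ne_zero one_ne_zero ?_ ?_
    · refine IsUnit.of_mul_eq_one (Matrix.diagonal ![(τ.im : ℂ), τ.im, 1, 1]) ?_
      ext i j
      fin_cases i <;> fin_cases j <;> simp [Matrix.mul_apply, Matrix.diagonal, hv]
    all_goals
      ext i
      fin_cases i <;> simp [Matrix.mulVec, dotProduct, Fin.sum_univ_four, Matrix.diagonal]
  have h2 : (Matrix.diagonal ![(τ.im)⁻¹, (τ.im)⁻¹, 1, 1] * deltaMat d * alpha (1 / √τ.im)) 0 3 =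
      d / τ.im := by
    simp [alpha, deltaMat, Matrix.mul_apply, Fin.sum_univ_four, Matrix.diagonal, Matrix.single]
    ring
  rw [h1, tauOf_filF, h2]
  rfl

/-! ### The action of `Γ` -/

/-- The unipotent automorphism `e'_3 ↦ e'_3 + b e'_2` of `gr^W`. -/
def uMat (b : ℝ) : Matrix (Fin 4) (Fin 4) ℝ :=
  !![1, 0, 0, 0; 0, 1, b, 0; 0, 0, 1, 0; 0, 0, 0, 1]

theorem uMat_add (b b' : ℝ) : uMat b * uMat b' = uMat (b + b') := by
  ext i j
  fin_cases i <;> fin_cases j <;> simp [uMat, Matrix.mul_apply, Fin.sum_univ_four]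
  ring

theorem uMat_zero : uMat 0 = 1 := by
  ext i j
  fin_cases i <;> fin_cases j <;> simp [uMat]

theorem uMat_mul_neg (b : ℝ) : uMat b * uMat (-b) = 1 := by
  rw [uMat_add, add_neg_cancel, uMat_zero]

theorem uMat_neg_mul (b : ℝ) : uMat (-b) * uMat b = 1 := by
  rw [uMat_add, neg_add_cancel, uMat_zero]

theorem map_ofReal_mul (M N : Matrix (Fin 4) (Fin 4) ℝ) :
    (M * N).map Complex.ofReal = M.map Complex.ofReal * N.map Complex.ofReal :=
  Matrix.map_mul (f := Complex.ofRealHom)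

theorem map_ofReal_one : (1 : Matrix (Fin 4) (Fin 4) ℝ).map Complex.ofReal = 1 :=
  Matrix.map_one _ Complex.ofReal_zero Complex.ofReal_one

theorem isUnit_uMat (b : ℝ) : IsUnit ((uMat b).map Complex.ofReal) :=
  IsUnit.of_mul_eq_one ((uMat (-b)).map Complex.ofReal) (by
    rw [← map_ofReal_mul, uMat_mul_neg, map_ofReal_one])

theorem act_uMat_filF (τ : ℂ) (b : ℝ) :
    act ((uMat b).map Complex.ofReal) (filF τ 0 0 0) = filF (τ + b) 0 0 0 := by
  refine act_filF (isUnit_uMat b) 0 (μ := 1) (ν := 1) one_ne_zero one_ne_zero ?_ ?_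
  all_goals
    ext i
    fin_cases i <;> simp [uMat, Matrix.mulVec, dotProduct, Fin.sum_univ_four]

theorem uMat_expDelta_comm (b d : ℝ) :
    (uMat b).map Complex.ofReal * (1 + Complex.I • (deltaMat d).map Complex.ofReal) =
      (1 + Complex.I • (deltaMat d).map Complex.ofReal) * (uMat b).map Complex.ofReal := by
  rw [expDelta_eq]
  ext i j
  fin_cases i <;> fin_cases j <;> simp [uMat, Matrix.mul_apply, Fin.sum_univ_four]

/-- The real matrix of an integral automorphism. -/
def toR (γ : GL (Fin 4) ℤ) : Matrix (Fin 4) (Fin 4) ℝ :=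
  (γ : Matrix (Fin 4) (Fin 4) ℤ).map (fun a => (a : ℝ))

theorem toR_map (γ : GL (Fin 4) ℤ) : (toR γ).map Complex.ofReal = toC γ := by
  ext i j
  simp [toR, toC]

theorem toR_inv_mul (γ : GL (Fin 4) ℤ) : toR γ⁻¹ * toR γ = 1 := by
  have h : ((γ⁻¹ : GL (Fin 4) ℤ) : Matrix (Fin 4) (Fin 4) ℤ) * γ = 1 := by
    rw [← Units.val_mul, inv_mul_cancel, Units.val_one]
  have := congrArg (fun m => Matrix.map m (Int.castRingHom ℝ)) h
  simpa only [Matrix.map_mul, Matrix.map_one _ (map_zero _) (map_one _)] using! this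

theorem toR_mul_inv (γ : GL (Fin 4) ℤ) : toR γ * toR γ⁻¹ = 1 :=
  mul_eq_one_comm.1 (toR_inv_mul γ)

theorem isUnit_toC (γ : GL (Fin 4) ℤ) : IsUnit (toC γ) := by
  rw [← toR_map]
  exact IsUnit.of_mul_eq_one ((toR γ⁻¹).map Complex.ofReal) (by
    rw [← map_ofReal_mul, toR_mul_inv, map_ofReal_one])

/-- The entry `γ_{23}`, which describes the action of `γ` on `gr^W_{-1}`. -/
def shift (γ : GL (Fin 4) ℤ) : ℝ := toR γ 1 2

theorem toR_eq {γ : GL (Fin 4) ℤ} (hγ : γ ∈ Gam) :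
    toR γ = !![1, toR γ 0 1, toR γ 0 2, toR γ 0 3; 0, 1, shift γ, toR γ 1 3;
      0, 0, 1, toR γ 2 3; 0, 0, 0, 1] := by
  ext i j
  fin_cases i <;> fin_cases j <;> simp [shift]
  all_goals first | (rw [toR, Matrix.map_apply, hγ.2 _ _ (by decide)]; simp)

theorem grMat_toC {γ : GL (Fin 4) ℤ} (hγ : γ ∈ Gam) :
    grMat (toC γ) = (uMat (shift γ)).map Complex.ofReal := by
  rw [← toR_map, toR_eq hγ]
  ext i j
  fin_cases i <;> fin_cases j <;> simp [grMat, wt, uMat]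

theorem toR_mul_splW {γ : GL (Fin 4) ℤ} (hγ : γ ∈ Gam) {s : Matrix (Fin 4) (Fin 4) ℝ}
    (hs : s ∈ splW) : toR γ * s * uMat (-shift γ) ∈ splW := by
  rw [toR_eq hγ, eq_of_mem_splW hs]
  intro i j h
  fin_cases i <;> fin_cases j <;> simp [wt] at h ⊢ <;>
    simp [uMat]

/-- With u the unipotent translation by the shift of γ, write γs = (γsu⁻¹)u. Since u fixes e'_1 and
e'_4 it commutes with exp(iδ), and it translates τ; hence d does not change. -/
theorem act_toC_ptD {γ : GL (Fin 4) ℤ} (τ : ℂ)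
    (s : Matrix (Fin 4) (Fin 4) ℝ) (d : ℝ) :
    act (toC γ) (ptD τ s d) = ptD (τ + shift γ) (toR γ * s * uMat (-shift γ)) d := by
  have hu : (uMat (-shift γ)).map Complex.ofReal * (uMat (shift γ)).map Complex.ofReal = 1 := by
    rw [← map_ofReal_mul, uMat_neg_mul, map_ofReal_one]
  unfold ptD
  rw [← act_uMat_filF, ← toR_map, ← act_mul, ← act_mul, ← act_mul, ← act_mul, map_ofReal_mul,
    map_ofReal_mul]
  congr 1
  simp only [Matrix.mul_assoc]
  rw [← uMat_expDelta_comm, ← Matrix.mul_assoc ((uMat (-shift γ)).map _), hu, Matrix.one_mul]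

theorem delta_act {γ : GL (Fin 4) ℤ} (hγ : γ ∈ Gam) {F : Fil} (hF : F ∈ D) :
    delta (act (toC γ) F) = delta F := by
  obtain ⟨τ, s, d, hτ, hs, rfl⟩ := exists_ptD_of_mem_D hF
  rw [act_toC_ptD, delta_ptD hτ hs, delta_ptD (by simpa using hτ) (toR_mul_splW hγ hs)]

theorem splOf_act {γ : GL (Fin 4) ℤ} (hγ : γ ∈ Gam) {F : Fil} (hF : F ∈ D) :
    splOf (act (toC γ) F) = toR γ * splOf F * uMat (-shift γ) := by
  obtain ⟨τ, s, d, hτ, hs, rfl⟩ := exists_ptD_of_mem_D hF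
  rw [act_toC_ptD, splOf_ptD hτ hs, splOf_ptD (by simpa using hτ) (toR_mul_splW hγ hs)]

theorem gr_act_toC {γ : GL (Fin 4) ℤ} (hγ : γ ∈ Gam) {F : Fil} (hF : F ∈ D) :
    gr (act (toC γ) F) = act (grMat (toC γ)) (gr F) := by
  obtain ⟨τ, s, d, hτ, hs, rfl⟩ := exists_ptD_of_mem_D hF
  rw [act_toC_ptD, gr_ptD _ hs, gr_ptD _ (toR_mul_splW hγ hs), grMat_toC hγ, act_uMat_filF]

/-- The map of the target of `ν` describing the action of an element of `Γ`, for a pair of real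
matrices and a real number. -/
def ambientMap (M N : Matrix (Fin 4) (Fin 4) ℝ) (k : ℝ) (v : B) : B :=
  (v.1, v.2.1 + k * v.1 ^ 2, v.2.2.1, (M * Matrix.of v.2.2.2.1 * N : Matrix (Fin 4) (Fin 4) ℝ),
    v.2.2.2.2 + k)

theorem continuous_ambientMap (M N : Matrix (Fin 4) (Fin 4) ℝ) (k : ℝ) :
    Continuous (ambientMap M N k) := by
  unfold ambientMap
  refine Continuous.prodMk (by fun_prop) (Continuous.prodMk (by fun_prop)
    (Continuous.prodMk (by fun_prop) (Continuous.prodMk ?_ (by fun_prop))))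
  have h : Continuous fun v : B => Matrix.of v.2.2.2.1 := by
    exact continuous_snd.snd.snd.fst
  exact (continuous_const.matrix_mul h).matrix_mul continuous_const

theorem ambientMap_ambientMap {M N M' N' : Matrix (Fin 4) (Fin 4) ℝ} {k : ℝ} (hM : M' * M = 1)
    (hN : N * N' = 1) (v : B) : ambientMap M' N' (-k) (ambientMap M N k v) = v := by
  obtain ⟨a, b, c, s, x⟩ := v
  simp only [ambientMap]
  congr 1
  congr 1
  · push_cast; ring
  congr 1
  congr 1
  · have : M' * (M * Matrix.of s * N) * N' = Matrix.of s := by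
      rw [Matrix.mul_assoc M, ← Matrix.mul_assoc M', hM, Matrix.one_mul, Matrix.mul_assoc, hN,
        Matrix.mul_one]
    exact this
  · ring

/-- Translating τ by k changes τ/Im τ by k/Im τ = kβ². The action is thus the restriction of a map
that is continuous on the whole target of ν, including β = 0, so it carries limits to limits. -/
theorem nuD_act {γ : GL (Fin 4) ℤ} (hγ : γ ∈ Gam) {F : Fil} (hF : F ∈ D) :
    nuD (act (toC γ) F) = ambientMap (toR γ) (uMat (-shift γ)) (shift γ) (nuD F) := by
  obtain ⟨τ, s, d, hτ, hs, rfl⟩ := exists_ptD_of_mem_D hF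
  rw [act_toC_ptD, nuD_ptD hτ hs, nuD_ptD (by simpa using hτ) (toR_mul_splW hγ hs)]
  unfold ambientMap
  have h2 : ((1 / √τ.im : ℝ) : ℂ) ^ 2 = ((τ.im)⁻¹ : ℝ) := by
    rw [← Complex.ofReal_pow, div_pow, Real.sq_sqrt hτ.le]; simp
  simp only [Complex.add_im, Complex.ofReal_im, add_zero, Complex.add_re, Complex.ofReal_re, h2]
  congr 2
  ring

/-! ### The torus orbit of an `SL(2)`-orbit -/

theorem coe_diagSL (a : ℝˣ) : (diagSL a : Matrix (Fin 2) (Fin 2) ℂ) =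
    !![(((a⁻¹ : ℝˣ) : ℝ) : ℂ), 0; 0, ((a : ℝ) : ℂ)] := rfl

theorem diagSL_mul (a b : ℝˣ) : diagSL (a * b) = diagSL a * diagSL b := by
  refine Subtype.ext ?_
  rw [Matrix.SpecialLinearGroup.coe_mul, coe_diagSL, coe_diagSL, coe_diagSL]
  ext i j
  fin_cases i <;> fin_cases j <;> simp [mul_comm]

theorem diagSL_real (a : ℝˣ) (i j : Fin 2) :
    (diagSL a : Matrix (Fin 2) (Fin 2) ℂ) i j = (((diagSL a : Matrix (Fin 2) (Fin 2) ℂ) i j).re : ℂ) := by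
  rw [coe_diagSL]
  fin_cases i <;> fin_cases j <;> simp

theorem commute_diagonal_of_grMat_eq {M : Matrix (Fin 4) (Fin 4) ℂ} (hM : grMat M = M) (f : ℤ → ℂ) :
    Matrix.diagonal (fun i => f (wt i)) * M = M * Matrix.diagonal (fun i => f (wt i)) := by
  ext i j
  rw [Matrix.diagonal_mul, Matrix.mul_diagonal]
  by_cases h : wt i = wt j
  · rw [h, mul_comm]
  · have : M i j = 0 := by rw [← hM, grMat, if_neg h]
    simp [this]

theorem grMat_mul_eq {M N : Matrix (Fin 4) (Fin 4) ℂ} (hM : grMat M = M) (hN : grMat N = N) :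
    grMat (M * N) = M * N := by
  ext i j
  unfold grMat
  split_ifs with h
  · rfl
  · symm
    rw [Matrix.mul_apply]
    refine Finset.sum_eq_zero fun k _ => ?_
    rw [← hM, ← hN]
    unfold grMat
    split_ifs <;> simp_all

theorem grMat_diagonal (f : Fin 4 → ℂ) : grMat (Matrix.diagonal f) = Matrix.diagonal f := by
  ext i j
  by_cases h : i = j
  · simp [grMat, h]
  · simp [grMat, h]

namespace Orbit

variable {n : ℕ} (o : Orbit n)

/-- The element of `SL(2, ℂ)ⁿ` entering the torus action. -/
def torusArg (t : Fin n → ℝˣ) : Fin n → SL2C := fun j => diagSL (∏ k with j ≤ k, t k)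

theorem torusArg_mul (t t' : Fin n → ℝˣ) : torusArg (t * t') = torusArg t * torusArg t' := by
  funext j
  simp only [torusArg, Pi.mul_apply, Finset.prod_mul_distrib, diagSL_mul]

/-- The scalar part of the torus action. -/
def weightDiag (t : Fin n → ℝˣ) : Matrix (Fin 4) (Fin 4) ℂ :=
  Matrix.diagonal (fun i => ((((∏ j, t j) ^ wt i : ℝˣ) : ℝ) : ℂ))

theorem weightDiag_comm (t : Fin n → ℝˣ) {M : Matrix (Fin 4) (Fin 4) ℂ} (hM : grMat M = M) :
    weightDiag t * M = M * weightDiag t :=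
  commute_diagonal_of_grMat_eq hM fun w => ((((∏ j, t j) ^ w : ℝˣ) : ℝ) : ℂ)

theorem weightDiag_mul (t t' : Fin n → ℝˣ) :
    weightDiag (t * t') = weightDiag t * weightDiag t' := by
  simp only [weightDiag, Matrix.diagonal_mul_diagonal, Pi.mul_apply, Finset.prod_mul_distrib,
    mul_zpow, Units.val_mul, Complex.ofReal_mul]

theorem weightDiag_one : weightDiag (1 : Fin n → ℝˣ) = 1 := by
  simp [weightDiag]

theorem isUnit_weightDiag (t : Fin n → ℝˣ) : IsUnit (weightDiag t) :=
  IsUnit.of_mul_eq_one (weightDiag t⁻¹) (by rw [← weightDiag_mul, mul_inv_cancel, weightDiag_one])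

theorem grTorus_eq (t : Fin n → ℝˣ) : o.grTorus t = weightDiag t * o.ρ (torusArg t) := rfl

theorem grMat_ρ (g : Fin n → SL2C) : grMat (o.ρ g) = o.ρ g := (o.pure.mem_Ggr g).2.1

theorem grMat_grTorus (t : Fin n → ℝˣ) : grMat (o.grTorus t) = o.grTorus t :=
  grMat_mul_eq (grMat_diagonal _) (o.grMat_ρ _)

theorem isUnit_grTorus (t : Fin n → ℝˣ) : IsUnit (o.grTorus t) :=
  (isUnit_weightDiag t).mul (o.pure.mem_Ggr _).1

theorem grTorus_mul (t t' : Fin n → ℝˣ) : o.grTorus (t * t') = o.grTorus t * o.grTorus t' := by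
  rw [grTorus_eq, grTorus_eq, grTorus_eq, torusArg_mul, map_mul, weightDiag_mul]
  simp only [Matrix.mul_assoc]
  rw [← Matrix.mul_assoc (weightDiag t'), weightDiag_comm t' (o.grMat_ρ _)]
  simp only [Matrix.mul_assoc]

/-- ρ is given by polynomials with real coefficients, evaluated here at real diagonal matrices.
Reality is needed for the torus to carry a real δ to a real δ. -/
theorem ρ_torusArg_real (t : Fin n → ℝˣ) (i j : Fin 4) : ∃ x : ℝ, o.ρ (torusArg t) i j = x := by
  obtain ⟨P, hP⟩ := o.pure.algebraic i j
  have h : (fun k : Fin n × Fin 2 × Fin 2 => (torusArg t k.1 : Matrix _ _ ℂ) k.2.1 k.2.2) =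
      algebraMap ℝ ℂ ∘ fun k => ((torusArg t k.1 : Matrix _ _ ℂ) k.2.1 k.2.2).re := by
    funext k
    exact diagSL_real _ _ _
  refine ⟨MvPolynomial.aeval (fun k : Fin n × Fin 2 × Fin 2 =>
    ((torusArg t k.1 : Matrix _ _ ℂ) k.2.1 k.2.2).re) P, ?_⟩
  rw [hP, h, MvPolynomial.aeval_algebraMap_apply]
  rfl

theorem grTorus_real (t : Fin n → ℝˣ) (i : Fin 4) : ∃ x : ℝ, o.grTorus t i i = x := by
  obtain ⟨x, hx⟩ := o.ρ_torusArg_real t i i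
  refine ⟨(((∏ j, t j) ^ wt i : ℝˣ) : ℝ) * x, ?_⟩
  rw [grTorus_eq, weightDiag, Matrix.diagonal_mul, hx, Complex.ofReal_mul]

theorem grTorus_three_ne_zero (t : Fin n → ℝˣ) : o.grTorus t 3 3 ≠ 0 := by
  intro h0
  have hu := o.isUnit_grTorus t
  have h : o.grTorus t *ᵥ ![0, 0, 0, 1] = 0 := by
    have e : ∀ i, wt i ≠ wt 3 → o.grTorus t i 3 = 0 := fun i h => by
      rw [← o.grMat_grTorus t, grMat, if_neg h]
    have e0 := e 0 (by simp [wt])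
    have e1 := e 1 (by simp [wt])
    have e2 := e 2 (by simp [wt])
    ext i
    fin_cases i <;> simp [Matrix.mulVec, dotProduct, Fin.sum_univ_four, h0, e0, e1, e2]
  have h' := congrArg (fun x => (o.grTorus t)⁻¹ *ᵥ x) h
  simp only [Matrix.mulVec_mulVec,
    Matrix.nonsing_inv_mul _ ((Matrix.isUnit_iff_isUnit_det _).1 hu), Matrix.one_mulVec,
    Matrix.mulVec_zero] at h'
  simpa using congrFun h' 3

/-- The torus respects weights, so it preserves the lines of e'_1 and e'_4; conjugation multiplies δ
by the ratio of the two real eigenvalues. -/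
theorem grTorus_expDelta (t : Fin n → ℝˣ) (d : ℝ) : ∃ d' : ℝ,
    o.grTorus t * (1 + Complex.I • (deltaMat d).map Complex.ofReal) =
      (1 + Complex.I • (deltaMat d').map Complex.ofReal) * o.grTorus t := by
  obtain ⟨x, hx⟩ := o.grTorus_real t 0
  obtain ⟨y, hy⟩ := o.grTorus_real t 3
  have hy0 : (y : ℂ) ≠ 0 := hy ▸ o.grTorus_three_ne_zero t
  refine ⟨x * d / y, ?_⟩
  rw [expDelta_eq, expDelta_eq]
  have e : ∀ i j, wt i ≠ wt j → o.grTorus t i j = 0 := fun i j h => by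
    rw [← o.grMat_grTorus t, grMat, if_neg h]
  have e1 := e 3 0 (by simp [wt])
  have e2 := e 3 1 (by simp [wt])
  have e3 := e 3 2 (by simp [wt])
  have e4 := e 1 0 (by simp [wt])
  have e5 := e 2 0 (by simp [wt])
  ext i j
  fin_cases i <;> fin_cases j <;>
    simp [Matrix.mul_apply, Fin.sum_univ_four, hx, hy, e1, e2, e3, e4, e5]
  field_simp
  ring

theorem act_weightDiag_filF (t : Fin n → ℝˣ) (τ : ℂ) :
    act (weightDiag t) (filF τ 0 0 0) = filF τ 0 0 0 := by
  have h : ((((∏ j, t j) ^ (-1 : ℤ) : ℝˣ) : ℝ) : ℂ) ≠ 0 := by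
    exact_mod_cast ((∏ j, t j) ^ (-1 : ℤ) : ℝˣ).ne_zero
  refine act_filF (isUnit_weightDiag t) 0 h one_ne_zero ?_ ?_
  all_goals
    ext i
    rw [weightDiag, Matrix.mulVec_diagonal]
    fin_cases i <;> simp [wt]

/-- The matrix diag(1/a, a) sends i to a⁻²i, which is again in the upper half plane, so φ still
takes a value in D(gr^W); the scalar factors on the graded pieces do not move a split filtration. -/
theorem act_grTorus_gr (t : Fin n → ℝˣ) :
    ∃ τ : ℂ, 0 < τ.im ∧ act (o.grTorus t) (gr o.r) = filF τ 0 0 0 := by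
  have hz : ∀ a : ℝˣ, 0 < (((a : ℝ) ^ 2)⁻¹ * Complex.I : ℂ).im := fun a => by
    have : 0 < (a : ℝ) ^ 2 := by have := a.ne_zero; positivity
    rw [Complex.im_ofReal_mul]
    simpa using this
  have h1 : act (o.ρ (torusArg t)) (gr o.r) ∈ Dgr := by
    rw [o.gr_r, ← o.pure.equivariant]
    have : actP1 (torusArg t) (fun _ => (Complex.I : OnePoint ℂ)) =
        fun j => (((⟨_, hz (∏ k with j ≤ k, t k)⟩ : ℍ) : ℂ) : OnePoint ℂ) := by
      funext j
      have ha : (((∏ k with j ≤ k, t k : ℝˣ) : ℝ) : ℂ) ≠ 0 := by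
        exact_mod_cast (∏ k with j ≤ k, t k : ℝˣ).ne_zero
      simp only [actP1, torusArg]
      generalize (∏ k with j ≤ k, t k : ℝˣ) = a at *
      have hcoe : ∀ i j, Matrix.SpecialLinearGroup.toGL (diagSL a) i j =
        (diagSL a : Matrix (Fin 2) (Fin 2) ℂ) i j := fun _ _ => rfl
      rw [OnePoint.smul_some_eq_ite]
      simp only [hcoe, coe_diagSL]
      simp [ha]
      field_simp
    rw [this]
    exact o.pure.upper _
  obtain ⟨τ, hτ, h⟩ := exists_filF_of_mem_Dgr h1
  exact ⟨τ, hτ, by rw [grTorus_eq, act_mul, h, act_weightDiag_filF]⟩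

theorem splOf_r_inv_mul :
    ((splOf o.r).map Complex.ofReal)⁻¹ * (splOf o.r).map Complex.ofReal = 1 :=
  Matrix.nonsing_inv_mul _
    ((Matrix.isUnit_iff_isUnit_det _).1 (isUnit_map_of_mem_splW (splOf_mem o.r_mem)))

/-- The torus is transported to H_0 by the splitting of r itself, so along the torus orbit that
splitting stays constant and only τ and d vary. -/
theorem act_torus_r (t : Fin n → ℝˣ) :
    ∃ (τ : ℂ) (d : ℝ), 0 < τ.im ∧ act (o.torus t) o.r = ptD τ (splOf o.r) d := by
  obtain ⟨τ, hτ, h⟩ := o.act_grTorus_gr t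
  obtain ⟨τ₀, hτ₀, h₀⟩ := exists_filF_of_mem_Dgr (gr_mem_Dgr o.r_mem)
  obtain ⟨d', hd⟩ := o.grTorus_expDelta t (delta o.r)
  refine ⟨τ, d', hτ, ?_⟩
  have hr := eq_ptD_of_mem_D o.r_mem h₀
  rw [h₀] at h
  rw [torus]
  nth_rewrite 3 [hr]
  unfold ptD
  rw [← h, ← act_mul, ← act_mul, ← act_mul, ← act_mul]
  congr 1
  simp only [Matrix.mul_assoc]
  rw [← hd, ← Matrix.mul_assoc _⁻¹, o.splOf_r_inv_mul, Matrix.one_mul]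

theorem act_torus_mem_D (t : Fin n → ℝˣ) : act (o.torus t) o.r ∈ D := by
  obtain ⟨τ, d, hτ, h⟩ := o.act_torus_r t
  rw [h]
  exact ptD_mem_D hτ (splOf_mem o.r_mem) d

theorem torus_mul (t t' : Fin n → ℝˣ) : o.torus (t * t') = o.torus t * o.torus t' := by
  simp only [torus, grTorus_mul, Matrix.mul_assoc]
  rw [← Matrix.mul_assoc _⁻¹, o.splOf_r_inv_mul, Matrix.one_mul]

variable {o}

/-- The torus is commutative and preserves the splitting of r, so equivalent orbits have the same
torus action. Their torus orbits differ only by the reparametrization t ↦ tt₀. -/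
theorem Equivalent.exists_torus {o' : Orbit n} (h : o.Equivalent o') : ∃ t₀ : Fin n → ℝˣ,
    (∀ j, 0 < (t₀ j : ℝ)) ∧ ∀ t, act (o'.torus t) o'.r = act (o.torus (t * t₀)) o.r := by
  obtain ⟨t₀, hpos, hρ, -, hr⟩ := h
  refine ⟨t₀, hpos, fun t => ?_⟩
  have hs : splOf o'.r = splOf o.r := by
    obtain ⟨τ, d, hτ, h⟩ := o.act_torus_r t₀
    rw [hr, h, splOf_ptD hτ (splOf_mem o.r_mem)]
  have hu := (Matrix.isUnit_iff_isUnit_det _).1 (o.isUnit_grTorus t₀)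
  have hg : o'.grTorus t = o.grTorus t := by
    rw [grTorus_eq, hρ, ← Matrix.mul_assoc, ← Matrix.mul_assoc,
      weightDiag_comm t (o.grMat_grTorus t₀), Matrix.mul_assoc (o.grTorus t₀), ← grTorus_eq,
      ← grTorus_mul, mul_comm, grTorus_mul, Matrix.mul_assoc, Matrix.mul_nonsing_inv _ hu,
      Matrix.mul_one]
  have ht : o'.torus t = o.torus t := by rw [torus, torus, hs, hg]
  rw [ht, hr, ← act_mul, ← torus_mul]

theorem IsTranslate.act_torus {γ : GL (Fin 4) ℤ} (hγ : γ ∈ Gam) {o' : Orbit n}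
    (h : IsTranslate γ o o') (t : Fin n → ℝˣ) :
    act (o'.torus t) o'.r = act (toC γ) (act (o.torus t) o.r) := by
  obtain ⟨hρ, -, hr⟩ := h
  have hu := (Matrix.isUnit_iff_isUnit_det _).1 (isUnit_uMat (shift γ))
  have hU : grMat ((uMat (shift γ)).map Complex.ofReal) = (uMat (shift γ)).map Complex.ofReal := by
    ext i j
    fin_cases i <;> fin_cases j <;> simp [grMat, wt, uMat]
  have hi : ((uMat (shift γ)).map Complex.ofReal)⁻¹ = (uMat (-shift γ)).map Complex.ofReal :=
    Matrix.inv_eq_right_inv (by rw [← map_ofReal_mul, uMat_mul_neg, map_ofReal_one])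
  have hi' : ((uMat (-shift γ)).map Complex.ofReal)⁻¹ = (uMat (shift γ)).map Complex.ofReal :=
    Matrix.inv_eq_right_inv (by rw [← map_ofReal_mul, uMat_neg_mul, map_ofReal_one])
  have hnp : (uMat (-shift γ)).map Complex.ofReal * (uMat (shift γ)).map Complex.ofReal = 1 := by
    rw [← map_ofReal_mul, uMat_neg_mul, map_ofReal_one]
  have hg : o'.grTorus t = (uMat (shift γ)).map Complex.ofReal * o.grTorus t *
      (uMat (-shift γ)).map Complex.ofReal := by
    rw [grTorus_eq, hρ, grMat_toC hγ, ← Matrix.mul_assoc, ← Matrix.mul_assoc, weightDiag_comm t hU,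
      Matrix.mul_assoc ((uMat _).map _), ← grTorus_eq, hi]
  have hγu := (Matrix.isUnit_iff_isUnit_det _).1 (isUnit_toC γ)
  have ht : o'.torus t * toC γ = toC γ * o.torus t := by
    rw [torus, torus, hr, splOf_act hγ o.r_mem, hg, map_ofReal_mul, map_ofReal_mul, toR_map,
      Matrix.mul_inv_rev, Matrix.mul_inv_rev, hi']
    simp only [Matrix.mul_assoc]
    rw [Matrix.nonsing_inv_mul _ hγu, Matrix.mul_one, ← Matrix.mul_assoc _ _ (o.grTorus t * _), hnp,
      Matrix.one_mul, ← Matrix.mul_assoc ((uMat (-shift γ)).map _), hnp, Matrix.one_mul]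
  rw [hr, ← act_mul, ← act_mul, ht]

end Orbit

/-! ### The map `ν` on classes of `SL(2)`-orbits -/

/-- Uniqueness of limits along torus orbits depends on this; it says that 0 is adherent to the
positive orthant. -/
instance toZero_neBot (n : ℕ) : (toZero n).NeBot := by
  have h0 : (0 : Fin n → ℝ) ∈ closure {t : Fin n → ℝ | ∀ j, 0 < t j} := by
    have : {t : Fin n → ℝ | ∀ j, 0 < t j} = Set.pi Set.univ fun _ => Set.Ioi 0 := by
      ext t; simp
    rw [this, closure_pi_set]
    intro j _
    simp
  have : (𝓝[{t : Fin n → ℝ | ∀ j, 0 < t j}] 0).NeBot := mem_closure_iff_nhdsWithin_neBot.1 h0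
  refine NeBot.comap_of_range_mem this ?_
  filter_upwards [self_mem_nhdsWithin] with t ht
  exact ⟨fun j => Units.mk0 (t j) (ht j).ne', rfl⟩

theorem tendsto_toZero_mul {n : ℕ} {t₀ : Fin n → ℝˣ} (h : ∀ j, 0 < (t₀ j : ℝ)) :
    Tendsto (fun t => t * t₀) (toZero n) (toZero n) := by
  refine tendsto_comap_iff.2 ?_
  have h1 : Tendsto (fun (t : Fin n → ℝˣ) j => (t j : ℝ)) (toZero n)
      (𝓝[{t | ∀ j, 0 < t j}] (0 : Fin n → ℝ)) := tendsto_comap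
  rw [tendsto_nhdsWithin_iff] at h1 ⊢
  constructor
  · rw [tendsto_pi_nhds]
    intro j
    simpa using (tendsto_pi_nhds.1 h1.1 j).mul_const (t₀ j : ℝ)
  · filter_upwards [h1.2] with t ht j
    have := mul_pos (ht j) (h j)
    simpa using this

/-- `v` is the limit of `ν` along the torus orbit of `o`. -/
def IsLimit (o : OrbitPhi) (v : B) : Prop :=
  Tendsto (fun t => nuD (act (o.1.2.torus t) o.1.2.r)) (toZero o.1.1) (𝓝 v)

theorem OrbitPhi.Equivalent.isLimit_iff {o o' : OrbitPhi} (h : o.Equivalent o') (v : B) :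
    IsLimit o v ↔ IsLimit o' v := by
  obtain ⟨n, x, x', hx, hx', h⟩ := h
  unfold IsLimit
  rw [hx, hx']
  obtain ⟨t₀, hpos, h⟩ := h.exists_torus
  simp only [h]
  constructor
  · intro H
    exact H.comp (tendsto_toZero_mul hpos)
  · intro H
    have hinv : ∀ j, 0 < ((t₀⁻¹ : Fin n → ℝˣ) j : ℝ) := fun j => by
      have := hpos j
      simpa using this
    refine (H.comp (tendsto_toZero_mul hinv)).congr fun t => ?_
    simp [Function.comp]

/-- Two classes of a `Quot` agree when they are joined by a chain of relations and inverse
relations, so the invariance is propagated through the generated equivalence. -/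
theorem isLimit_iff_of_mk_eq {o o' : OrbitPhi} (h : DII.mk o = DII.mk o') (v : B) :
    IsLimit o v ↔ IsLimit o' v := by
  have h' := Quot.eqvGen_exact h
  clear h
  induction h' with
  | rel _ _ h => exact h.isLimit_iff v
  | refl => rfl
  | symm _ _ _ ih => exact ih.symm
  | trans _ _ _ _ _ ih ih' => exact ih.trans ih'

theorem nu_mk (o : OrbitPhi) : nu (DII.mk o) = Classical.epsilon (IsLimit o) := by
  unfold nu
  congr 1
  funext v
  apply propext
  constructor
  · rintro ⟨o', h, h'⟩
    exact (isLimit_iff_of_mk_eq h v).1 h'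
  · exact fun h => ⟨o, rfl, h⟩

theorem nu_mk_of_isLimit {o : OrbitPhi} {v : B} (h : IsLimit o v) : nu (DII.mk o) = v := by
  rw [nu_mk]
  exact tendsto_nhds_unique (Classical.epsilon_spec (p := IsLimit o) ⟨v, h⟩) h

/-- The map of the target of ν induced by γ is continuous, has a continuous inverse, and leaves the
L̄-component alone. Existence of the limit is not assumed for a general orbit, so its absence is a
separate case. -/
theorem lbar_eq_of_isTranslate {γ : GL (Fin 4) ℤ} (hγ : γ ∈ Gam) {o o' : OrbitPhi} {n : ℕ}
    {x x' : Orbit n} (hx : o.1 = ⟨n, x⟩) (hx' : o'.1 = ⟨n, x'⟩) (h : Orbit.IsTranslate γ x x') :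
    lbar (DII.mk o) = lbar (DII.mk o') := by
  have hnu : ∀ t, nuD (act (x'.torus t) x'.r) =
      ambientMap (toR γ) (uMat (-shift γ)) (shift γ) (nuD (act (x.torus t) x.r)) := fun t => by
    rw [h.act_torus hγ t, nuD_act hγ (x.act_torus_mem_D t)]
  have h1 : ∀ v, IsLimit o v → IsLimit o' (ambientMap (toR γ) (uMat (-shift γ)) (shift γ) v) := by
    intro v hv
    unfold IsLimit at hv ⊢
    rw [hx] at hv
    rw [hx']
    simp only [hnu]
    exact ((continuous_ambientMap _ _ _).tendsto v).comp hv
  have h2 : ∀ v, IsLimit o' v → ∃ v', IsLimit o v' := by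
    intro v hv
    unfold IsLimit at hv ⊢
    rw [hx'] at hv
    rw [hx]
    simp only [hnu] at hv
    refine ⟨_, (((continuous_ambientMap (toR γ⁻¹) (uMat (shift γ)) (-shift γ)).tendsto v).comp
      hv).congr fun t => ?_⟩
    exact ambientMap_ambientMap (toR_inv_mul γ) (uMat_neg_mul _) _
  by_cases hex : ∃ v, IsLimit o v
  · obtain ⟨v, hv⟩ := hex
    rw [lbar, lbar, nu_mk_of_isLimit hv, nu_mk_of_isLimit (h1 v hv)]
    rfl
  -- Neither orbit has a limit: both predicates are empty, hence equal, and `epsilon` returns the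
  -- same default for them.
  · have e1 : IsLimit o = IsLimit o' := by
      funext v
      apply propext
      exact ⟨fun h => absurd ⟨v, h⟩ hex, fun h => absurd (h2 v h) hex⟩
    rw [lbar, lbar, nu_mk, nu_mk, e1]

/-- The map `Γ \ D^{II}_{SL(2)}(Φ) → L̄`. -/
def lbarGam : GamDII → EReal :=
  Quot.lift lbar (by
    rintro _ _ ⟨γ, hγ, o, o', n, x, x', rfl, rfl, hx, hx', h⟩
    exact lbar_eq_of_isTranslate hγ hx hx' h)

theorem nu_ofD (F : D) : nu (DII.ofD F) = nuD F.1 := by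
  refine nu_mk_of_isLimit ?_
  unfold IsLimit
  have h : ∀ t, (orbitOfD F).torus t = 1 := by
    intro t
    have hg : (orbitOfD F).grTorus t = 1 := by
      rw [Orbit.grTorus_eq]
      have : Orbit.weightDiag t = 1 := by simp [Orbit.weightDiag]
      rw [this, one_mul]
      rfl
    rw [Orbit.torus, hg, Matrix.mul_one]
    exact mul_eq_one_comm.1 (orbitOfD F).splOf_r_inv_mul
  simp only [h, act_one]
  exact tendsto_const_nhds

theorem isTranslate_orbitOfD {γ : GL (Fin 4) ℤ} (hγ : γ ∈ Gam) {F F' : D}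
    (h : F'.1 = act (toC γ) F.1) : Orbit.IsTranslate γ (orbitOfD F) (orbitOfD F') := by
  refine ⟨fun g => ?_, fun z => ?_, h⟩
  · have hu := (Matrix.isUnit_iff_isUnit_det _).1 (isUnit_uMat (shift γ))
    change (1 : Matrix (Fin 4) (Fin 4) ℂ) = grMat (toC γ) * 1 * (grMat (toC γ))⁻¹
    rw [grMat_toC hγ, Matrix.mul_one, Matrix.mul_nonsing_inv _ hu]
  · change gr F'.1 = act (grMat (toC γ)) (gr F.1)
    rw [h, gr_act_toC hγ F.2]

/-- The map `Γ \ D → Γ \ D^{II}_{SL(2)}(Φ)`. -/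
def GamD.toGamDII : GamD → GamDII :=
  Quot.lift (fun F => GamDII.mk (DII.ofD F)) (by
    rintro F F' ⟨γ, hγ, h⟩
    exact Quot.sound ⟨γ, hγ, _, _, 0, orbitOfD F, orbitOfD F', rfl, rfl, rfl, rfl,
      isTranslate_orbitOfD hγ h⟩)

/-! ### Boundary points of `D^{II}_{SL(2)}(Φ)` -/

/-- The endomorphism of `gr^W` which is the identity on `gr^W_{-2}` and `gr^W_0`, and which on
`gr^W_{-1}` has the matrix `h` in the basis `e'_2, b e'_2 + e'_3`. -/
def midMat (b : ℂ) (h : Matrix (Fin 2) (Fin 2) ℂ) : Matrix (Fin 4) (Fin 4) ℂ :=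
  !![1, 0, 0, 0;
     0, h 0 0 + b * h 1 0, h 0 1 + b * h 1 1 - b * (h 0 0 + b * h 1 0), 0;
     0, h 1 0, h 1 1 - b * h 1 0, 0;
     0, 0, 0, 1]

theorem midMat_mul (b : ℂ) (h h' : Matrix (Fin 2) (Fin 2) ℂ) :
    midMat b (h * h') = midMat b h * midMat b h' := by
  ext i j
  fin_cases i <;> fin_cases j <;>
    simp [midMat, Matrix.mul_apply, Fin.sum_univ_four, Fin.sum_univ_two] <;> ring

theorem midMat_one (b : ℂ) : midMat b 1 = 1 := by
  ext i j
  fin_cases i <;> fin_cases j <;> simp [midMat]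

/-- The representation of `SL(2)` on `gr^W` attached to the splitting `b` of `W'`. -/
def midRep (b : ℂ) : (Fin 1 → SL2C) →* Matrix (Fin 4) (Fin 4) ℂ where
  toFun g := midMat b (g 0)
  map_one' := midMat_one b
  map_mul' g g' := midMat_mul b (g 0) (g' 0)

theorem midRep_apply (b : ℂ) (g : Fin 1 → SL2C) : midRep b g = midMat b (g 0) := rfl

/-- A vector spanning the line of `gr^W_{-1}` attached to a point of the projective line and the
splitting `b` of `W'`. -/
def lineVec (b : ℂ) (z : OnePoint ℂ) : Fin 2 → ℂ := z.elim ![1, 0] fun z => ![z + b, 1]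

theorem lineVec_infty (b : ℂ) : lineVec b OnePoint.infty = ![1, 0] := rfl

theorem lineVec_coe (b z : ℂ) : lineVec b (z : OnePoint ℂ) = ![z + b, 1] := rfl

theorem lineVec_ne_zero (b : ℂ) (z : OnePoint ℂ) : lineVec b z ≠ 0 := by
  induction z using OnePoint.rec with
  | infty => intro h; simpa [lineVec_infty] using congrFun h 0
  | coe z => intro h; simpa [lineVec_coe] using congrFun h 1

theorem det_coe_SL (g : SL2C) : (g : Matrix (Fin 2) (Fin 2) ℂ) 0 0 * g 1 1 - g 0 1 * g 1 0 = 1 := by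
  rw [← Matrix.det_fin_two, g.det_coe]

theorem midMat_mem_Ggr (b : ℂ) (g : SL2C) : midMat b g ∈ Ggr := by
  refine ⟨?_, ?_, fun x y => ?_⟩
  · refine IsUnit.of_mul_eq_one (midMat b (g⁻¹ : SL2C)) ?_
    rw [← midMat_mul, ← Matrix.SpecialLinearGroup.coe_mul, mul_inv_cancel,
      Matrix.SpecialLinearGroup.coe_one, midMat_one]
  · ext i j
    fin_cases i <;> fin_cases j <;> simp [grMat, wt, midMat]
  · have hd := det_coe_SL g
    simp [pairing, midMat, Matrix.mulVec, dotProduct, Fin.sum_univ_four]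
    linear_combination (x 2 * y 1 - x 1 * y 2) * hd

theorem mulVec_mem_gradedFil {b : ℂ} {h : Matrix (Fin 2) (Fin 2) ℂ} {v v' : Fin 2 → ℂ} {μ : ℂ}
    (hμ : μ ≠ 0)
    (h0 : (h 0 0 + b * h 1 0) * v 0 + (h 0 1 + b * h 1 1 - b * (h 0 0 + b * h 1 0)) * v 1 = μ * v' 0)
    (h1 : h 1 0 * v 0 + (h 1 1 - b * h 1 0) * v 1 = μ * v' 1) {l : ℤ} {x : Fin 4 → ℂ}
    (hx : x ∈ gradedFil v l) : midMat b h *ᵥ x ∈ gradedFil v' l := by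
  obtain ⟨x0, x1, x2⟩ := mem_gradedFil.1 hx
  rw [mem_gradedFil]
  simp only [midMat, Matrix.mulVec, dotProduct, Fin.sum_univ_four]
  simp
  refine ⟨x0, fun hl => ?_, fun hl => ?_⟩
  · have x1 := x1 hl
    apply mul_left_cancel₀ hμ
    linear_combination (-(h 0 0 + b * h 1 0) * x 1 - (h 0 1 + b * h 1 1 - b * (h 0 0 + b * h 1 0)) *
      x 2) * h1 + (h 1 0 * x 1 + (h 1 1 - b * h 1 0) * x 2) * h0 +
      (h 0 0 * h 1 1 - h 0 1 * h 1 0) * x1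
  · obtain ⟨y1, y2, y3⟩ := x2 hl
    simp [y1, y2, y3]

theorem act_midMat_gradedFil {b : ℂ} {g : SL2C} {v v' : Fin 2 → ℂ} {μ : ℂ} (hμ : μ ≠ 0)
    (h0 : (g 0 0 + b * g 1 0) * v 0 + (g 0 1 + b * g 1 1 - b * (g 0 0 + b * g 1 0)) * v 1 = μ * v' 0)
    (h1 : g 1 0 * v 0 + (g 1 1 - b * g 1 0) * v 1 = μ * v' 1) :
    act (midMat b g) (gradedFil v) = gradedFil v' := by
  have hd := det_coe_SL g
  have hinv : ((g⁻¹ : SL2C) : Matrix (Fin 2) (Fin 2) ℂ) = !![g 1 1, -g 0 1; -g 1 0, g 0 0] := by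
    rw [Matrix.SpecialLinearGroup.coe_inv, Matrix.adjugate_fin_two]
  funext l
  apply le_antisymm
  · rintro _ ⟨x, hx, rfl⟩
    exact mulVec_mem_gradedFil hμ h0 h1 hx
  · intro y hy
    refine ⟨midMat b (g⁻¹ : SL2C) *ᵥ y, ?_, ?_⟩
    · refine mulVec_mem_gradedFil (inv_ne_zero hμ) ?_ ?_ hy
      · rw [hinv]
        apply mul_left_cancel₀ hμ
        rw [mul_inv_cancel_left₀ hμ]
        simp
        linear_combination (-(g 1 1 - b * g 1 0)) * h0 - (-g 0 1 + b * g 0 0 - b * (g 1 1 - b * g 1 0)) * h1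
          + v 0 * hd
      · rw [hinv]
        apply mul_left_cancel₀ hμ
        rw [mul_inv_cancel_left₀ hμ]
        simp
        linear_combination (g 1 0) * h0 - (g 0 0 + b * g 1 0) * h1 + v 1 * hd
    · rw [Matrix.mulVecLin_apply, Matrix.mulVec_mulVec, ← midMat_mul,
        ← Matrix.SpecialLinearGroup.coe_mul, mul_inv_cancel, Matrix.SpecialLinearGroup.coe_one,
        midMat_one, Matrix.one_mulVec]

/-- In the basis e'_2, be'_2 + e'_3 this is the Möbius action on lines. The scalar needed is the
denominator of the Möbius transformation, or its numerator when the image is ∞. -/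
theorem act_midMat_lineVec (b : ℂ) (g : SL2C) (z : OnePoint ℂ) :
    act (midMat b g) (gradedFil (lineVec b z)) =
      gradedFil (lineVec b (Matrix.SpecialLinearGroup.toGL g • z)) := by
  have hd := det_coe_SL g
  have hcoe : ∀ i j, Matrix.SpecialLinearGroup.toGL g i j =
    (g : Matrix (Fin 2) (Fin 2) ℂ) i j := fun _ _ => rfl
  induction z using OnePoint.rec with
  | infty =>
    rw [OnePoint.smul_infty_eq_ite]
    simp only [hcoe]
    split_ifs with h
    · have h00 : (g : Matrix (Fin 2) (Fin 2) ℂ) 0 0 ≠ 0 := fun h' => by simp [h, h'] at hd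
      refine act_midMat_gradedFil h00 ?_ ?_ <;> simp [lineVec_infty, h]
    · refine act_midMat_gradedFil h ?_ ?_ <;> simp [lineVec_infty, lineVec_coe]
      field_simp
  | coe k =>
    rw [OnePoint.smul_some_eq_ite]
    simp only [hcoe]
    split_ifs with h
    · have h00 : (g : Matrix (Fin 2) (Fin 2) ℂ) 0 0 * k + g 0 1 ≠ 0 := fun h' => by
        have : (1 : ℂ) = 0 := by
          by_cases hg : (g : Matrix (Fin 2) (Fin 2) ℂ) 1 0 = 0
          · have h11 : (g : Matrix (Fin 2) (Fin 2) ℂ) 1 1 = 0 := by simpa [hg] using h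
            rw [← hd, hg, h11]; ring
          · apply mul_left_cancel₀ hg
            linear_combination (g 1 0) * (g 0 0) * h - (g 1 0) * (g 1 0) * h' - (g 1 0) * hd
        exact one_ne_zero this
      refine act_midMat_gradedFil h00 ?_ ?_ <;> simp only [lineVec_infty, lineVec_coe] <;> simp
      · linear_combination b * h
      · linear_combination h
    · refine act_midMat_gradedFil h ?_ ?_ <;> simp only [lineVec_coe] <;> simp
      · field_simp
        ring
      · ring

theorem mem_filP1_one_iff (b : ℂ) (z : OnePoint ℂ) (x y : ℂ) :
    ![x - b * y, y] ∈ filP1 z 1 ↔ x * lineVec b z 1 = y * lineVec b z 0 := by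
  simp only [filP1, show ¬ ((1 : ℤ) ≤ 0) by norm_num, if_false, if_true,
    Submodule.mem_span_singleton]
  induction z using OnePoint.rec with
  | infty =>
    rw [lineVec_infty]
    constructor
    · rintro ⟨a, h⟩
      have := congrFun h 1
      simp at this
      simp [← this]
    · intro h
      simp at h
      exact ⟨x - b * y, by ext i; fin_cases i <;> simp [← h]⟩
  | coe z =>
    rw [lineVec_coe]
    constructor
    · rintro ⟨a, h⟩
      have h0 := congrFun h 0
      have h1 := congrFun h 1
      simp at h0 h1
      simp
      subst h1
      linear_combination -h0
    · intro h
      simp at h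
      refine ⟨y, ?_⟩
      ext i
      fin_cases i
      · simp
        linear_combination -h
      · simp

/-- The filtration of ℂ² has its jump line in degree 1, that of gr^W_{-1} in degree 0; hence the
shift l + 1. The vector consists of the coordinates in the basis e'_2, be'_2 + e'_3. -/
theorem mem_filP1_of_mem_gradedFil {b : ℂ} {z : OnePoint ℂ} {l : ℤ} {x : Fin 4 → ℂ}
    (hx : x ∈ gradedFil (lineVec b z) l) : ![x 1 - b * x 2, x 2] ∈ filP1 z (l + 1) := by
  obtain ⟨-, h1, h2⟩ := mem_gradedFil.1 hx
  rcases lt_trichotomy l 0 with h | h | h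
  · rw [filP1, if_pos (by omega)]; trivial
  · subst h
    rw [zero_add]
    exact (mem_filP1_one_iff b z _ _).2 (h1 rfl)
  · obtain ⟨h3, h4, -⟩ := h2 h
    have : (![x 1 - b * x 2, x 2] : Fin 2 → ℂ) = 0 := by
      ext i
      fin_cases i <;> simp [h3, h4]
    rw [this]
    exact Submodule.zero_mem _

theorem mem_gradedFil_of_mem_filP1 {b : ℂ} {z : OnePoint ℂ} {l : ℤ} {x y : ℂ}
    (h : ![x - b * y, y] ∈ filP1 z (l + 1)) : ![0, x, y, 0] ∈ gradedFil (lineVec b z) l := by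
  rw [mem_gradedFil]
  refine ⟨fun _ => rfl, fun hl => ?_, fun hl => ?_⟩
  · subst hl
    rw [zero_add] at h
    exact (mem_filP1_one_iff b z x y).1 h
  · rw [filP1, if_neg (by omega), if_neg (by omega), Submodule.mem_bot] at h
    have h0 := congrFun h 0
    have h1 := congrFun h 1
    simp at h0 h1
    subst h1
    simp at h0
    simp [h0]

/-- On the upper half plane φ is z ↦ F(z + b, 0, 0, 0). For horizontality, the derivative of ρ kills
e'_1 and e'_4 and is X itself on gr^W_{-1}, so the condition reduces to the hypothesis on ℂ² shifted
by one degree. -/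
theorem isPureOrbit_midRep (b : ℝ) :
    IsPureOrbit (midRep b) fun z => gradedFil (lineVec b (z 0)) where
  mem_Ggr g := midMat_mem_Ggr b (g 0)
  algebraic i j := by
    let X : Fin 2 → Fin 2 → MvPolynomial (Fin 1 × Fin 2 × Fin 2) ℝ := fun i j =>
      MvPolynomial.X (0, i, j)
    let c : MvPolynomial (Fin 1 × Fin 2 × Fin 2) ℝ := MvPolynomial.C b
    let M : Matrix (Fin 4) (Fin 4) (MvPolynomial (Fin 1 × Fin 2 × Fin 2) ℝ) :=
      !![1, 0, 0, 0;
        0, X 0 0 + c * X 1 0, X 0 1 + c * X 1 1 - c * (X 0 0 + c * X 1 0), 0;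
        0, X 1 0, X 1 1 - c * X 1 0, 0;
        0, 0, 0, 1]
    refine ⟨M i j, fun g => ?_⟩
    rw [midRep_apply]
    fin_cases i <;> fin_cases j <;> simp [M, X, c, midMat]
  mem_checkDgr z := ⟨gradedFil_mem_checkD (lineVec_ne_zero _ _), gr_gradedFil _⟩
  equivariant g z := (act_midMat_lineVec b (g 0) (z 0)).symm
  upper z := by
    change gradedFil ![((z 0 : ℍ) : ℂ) + b, 1] ∈ Dgr
    rw [← filF_graded]
    exact ⟨filF_graded_mem_D (by simpa using (z 0).2), gr_filF_graded _⟩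
  horizontal z p X c hc hX hfil l := by
    have hN : (Matrix.of fun i j => deriv (fun t => midRep b (c t) i j) 0) =
        !![0, 0, 0, 0;
          0, X 0 0 0 + b * X 0 1 0, X 0 0 1 + b * X 0 1 1 - b * (X 0 0 0 + b * X 0 1 0), 0;
          0, X 0 1 0, X 0 1 1 - b * X 0 1 0, 0;
          0, 0, 0, 0] := by
      have h := hX 0
      ext i j
      simp only [Matrix.of_apply, midRep_apply]
      fin_cases i <;> fin_cases j <;> simp only [midMat] <;> simp
      · exact ((h 0 0).add ((h 1 0).const_mul _)).deriv
      · exact (((h 0 1).add ((h 1 1).const_mul _)).sub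
          (((h 0 0).add ((h 1 0).const_mul _)).const_mul _)).deriv
      · exact (h 1 0).deriv
      · exact ((h 1 1).sub ((h 1 0).const_mul _)).deriv
    rw [hN]
    rintro _ ⟨x, hx, rfl⟩
    have hx := mem_filP1_of_mem_gradedFil hx
    have hX := hfil 0 (l + 1) ⟨_, hx, rfl⟩
    rw [show l + 1 + p = l + p + 1 by ring] at hX
    have key : (X 0).mulVecLin ![x 1 - b * x 2, x 2] =
        ![((X 0 0 0 + b * X 0 1 0) * x 1 + (X 0 0 1 + b * X 0 1 1 - b * (X 0 0 0 + b * X 0 1 0)) * x 2)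
          - b * (X 0 1 0 * x 1 + (X 0 1 1 - b * X 0 1 0) * x 2),
          X 0 1 0 * x 1 + (X 0 1 1 - b * X 0 1 0) * x 2] := by
      ext i
      fin_cases i <;> simp [Matrix.mulVec, dotProduct, Fin.sum_univ_two] <;> ring
    rw [key] at hX
    convert mem_gradedFil_of_mem_filP1 hX using 1
    ext i
    fin_cases i <;> simp [Matrix.mulVec, dotProduct, Fin.sum_univ_four]

theorem nontrivialAt_midRep (b : ℂ) (k : Fin 1) : NontrivialAt (midRep b) k := by
  refine ⟨diagSL (Units.mk0 2 two_ne_zero), fun h => ?_⟩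
  have := congrFun (congrFun h 2) 2
  obtain rfl : k = 0 := Subsingleton.elim _ _
  rw [midRep_apply, Pi.mulSingle_eq_same, coe_diagSL] at this
  simp [midMat] at this

/-- The `SL(2)`-orbit of rank one with given `δ`, splitting of `W` and splitting of `W'`. -/
def boundaryOrbit (d : ℝ) (s : splW) (b : ℝ) : Orbit 1 where
  ρ := midRep b
  φ := fun z => gradedFil (lineVec b (z 0))
  r := ptD (Complex.I + b) s.1 d
  pure := isPureOrbit_midRep b
  r_mem := ptD_mem_D (by simp) s.2 d
  gr_r := by rw [gr_ptD _ s.2, filF_graded, lineVec_coe]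
  nontrivial := fun k _ => nontrivialAt_midRep b k
  nontrivial_of_spl := fun _ k => nontrivialAt_midRep b k

theorem splOf_boundaryOrbit (d : ℝ) (s : splW) (b : ℝ) : splOf (boundaryOrbit d s b).r = s.1 :=
  splOf_ptD (by simp) s.2 d

theorem uMat_conj_diagonal (b x : ℝ) : uMat b * Matrix.diagonal ![x, x, 1, 1] * uMat (-b) =
    !![x, 0, 0, 0; 0, x, b * (1 - x), 0; 0, 0, 1, 0; 0, 0, 0, 1] := by
  ext i j
  rw [Matrix.mul_apply]
  simp only [Matrix.mul_diagonal, Fin.sum_univ_four]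
  fin_cases i <;> fin_cases j <;> simp [uMat]
  ring

/-- On gr^W_{-1} the weight factor t⁻¹ multiplies diag(1/t, t) to diag(t⁻², 1); on gr^W_{-2} and
gr^W_0 the factors are t⁻² and 1. These are the weights of W', conjugated by its splitting b. -/
theorem grTorus_boundaryOrbit (d : ℝ) (s : splW) (b : ℝ) (t : Fin 1 → ℝˣ) :
    (boundaryOrbit d s b).grTorus t = (uMat b * Matrix.diagonal
      ![((t 0 : ℝ) ^ 2)⁻¹, ((t 0 : ℝ) ^ 2)⁻¹, 1, 1] * uMat (-b)).map Complex.ofReal := by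
  have ht : ((t 0 : ℝ) : ℂ) ≠ 0 := by exact_mod_cast (t 0).ne_zero
  have h1 : (∏ k with (0 : Fin 1) ≤ k, t k) = t 0 := by simp
  rw [Orbit.grTorus_eq]
  change Orbit.weightDiag t * midMat b (diagSL (∏ k with (0 : Fin 1) ≤ k, t k)) = _
  rw [h1, coe_diagSL, Orbit.weightDiag, uMat_conj_diagonal]
  ext i j
  rw [Matrix.diagonal_mul]
  fin_cases i <;> fin_cases j <;> simp [midMat, wt]
  · field_simp
  · field_simp

theorem act_diagonal_filF {x : ℝ} (hx : x ≠ 0) (τ : ℂ) :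
    act ((Matrix.diagonal ![x, x, 1, 1]).map Complex.ofReal) (filF τ 0 0 0) = filF (x * τ) 0 0 0 := by
  have hx' : (x : ℂ) ≠ 0 := by exact_mod_cast hx
  refine act_filF ?_ 0 (μ := 1) (ν := 1) one_ne_zero one_ne_zero ?_ ?_
  · refine IsUnit.of_mul_eq_one (Matrix.diagonal ![(x : ℂ)⁻¹, (x : ℂ)⁻¹, 1, 1]) ?_
    ext i j
    fin_cases i <;> fin_cases j <;> simp [Matrix.mul_apply, Matrix.diagonal, hx']
  all_goals
    ext i
    fin_cases i <;> simp [Matrix.mulVec, dotProduct, Fin.sum_univ_four, Matrix.diagonal]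

/-- Both Im τ and δ grow like t⁻², so the ratio δ/Im τ remains d along the orbit. -/
theorem act_torus_boundaryOrbit (d : ℝ) (s : splW) (b : ℝ) (t : Fin 1 → ℝˣ) :
    act ((boundaryOrbit d s b).torus t) (boundaryOrbit d s b).r =
      ptD ((((t 0 : ℝ) ^ 2)⁻¹ : ℝ) * Complex.I + b) s.1 (((t 0 : ℝ) ^ 2)⁻¹ * d) := by
  have hx : ((t 0 : ℝ) ^ 2)⁻¹ ≠ 0 := inv_ne_zero (pow_ne_zero _ (t 0).ne_zero)
  have hs := (boundaryOrbit d s b).splOf_r_inv_mul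
  rw [Orbit.torus, grTorus_boundaryOrbit]
  rw [splOf_boundaryOrbit] at hs ⊢
  generalize ((t 0 : ℝ) ^ 2)⁻¹ = x at *
  change act _ (ptD (Complex.I + b) s.1 d) = _
  have h1 : act ((uMat b * Matrix.diagonal ![x, x, 1, 1] * uMat (-b)).map Complex.ofReal)
      (filF (Complex.I + b) 0 0 0) = filF ((x : ℝ) * Complex.I + b) 0 0 0 := by
    rw [map_ofReal_mul, map_ofReal_mul, act_mul, act_mul, act_uMat_filF]
    rw [show Complex.I + b + ((-b : ℝ) : ℂ) = Complex.I by push_cast; ring, act_diagonal_filF hx,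
      act_uMat_filF]
  have h2 : (uMat b * Matrix.diagonal ![x, x, 1, 1] * uMat (-b)).map Complex.ofReal *
      (1 + Complex.I • (deltaMat d).map Complex.ofReal) =
      (1 + Complex.I • (deltaMat (x * d)).map Complex.ofReal) *
      (uMat b * Matrix.diagonal ![x, x, 1, 1] * uMat (-b)).map Complex.ofReal := by
    rw [expDelta_eq, expDelta_eq, uMat_conj_diagonal]
    ext i j
    fin_cases i <;> fin_cases j <;> simp [Matrix.mul_apply, Fin.sum_univ_four]
    ring
  unfold ptD
  rw [← h1, ← act_mul, ← act_mul, ← act_mul, ← act_mul]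
  congr 1
  simp only [Matrix.mul_assoc]
  rw [← Matrix.mul_assoc _⁻¹, hs, Matrix.one_mul]
  simp only [Matrix.mul_assoc] at h2
  rw [h2]

/-! ### Weight filtrations and ν of the boundary orbits -/

/-- The weights of `W'`. -/
def wt' : Fin 4 → ℤ := ![-2, -2, 0, 0]

theorem diagonal_wt' (a : ℝˣ) : Matrix.diagonal ![((a : ℝ) ^ 2)⁻¹, ((a : ℝ) ^ 2)⁻¹, 1, 1] =
    Matrix.diagonal fun i => ((a ^ wt' i : ℝˣ) : ℝ) := by
  congr 1
  ext i
  fin_cases i <;> simp [wt']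

theorem isUnit_splW_mul_uMat (s : splW) (b : ℝ) : IsUnit (s.1 * uMat b) := by
  obtain ⟨s', -, h⟩ := splW_mul_inv s.2
  exact (IsUnit.of_mul_eq_one _ h).mul (IsUnit.of_mul_eq_one _ (uMat_mul_neg b))

theorem mulVec_mem_eigen_iff (d : ℝ) (s : splW) (b : ℝ) (l : ℤ) (y : Fin 4 → ℝ) :
    (s.1 * uMat b) *ᵥ y ∈ (boundaryOrbit d s b).eigen 0 l ↔ ∀ j, wt' j ≠ l → y j = 0 := by
  have hu := (Matrix.isUnit_iff_isUnit_det _).1 (isUnit_splW_mul_uMat s b)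
  have hu' : IsUnit ((s.1 * uMat b).map Complex.ofReal) := by
    rw [map_ofReal_mul]
    exact (isUnit_map_of_mem_splW s.2).mul (isUnit_uMat b)
  have hu'' := (Matrix.isUnit_iff_isUnit_det _).1 hu'
  have hcast : ∀ (M : Matrix (Fin 4) (Fin 4) ℝ) (x : Fin 4 → ℝ),
      (fun i => (((M *ᵥ x) i : ℝ) : ℂ)) = M.map Complex.ofReal *ᵥ fun i => (x i : ℂ) := by
    intro M x
    ext i
    simp [Matrix.mulVec, dotProduct]
  have htor : ∀ a : ℝˣ, (boundaryOrbit d s b).torus (Pi.mulSingle 0 a) =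
      (s.1 * uMat b).map Complex.ofReal *
      (Matrix.diagonal fun i => ((a ^ wt' i : ℝˣ) : ℝ)).map Complex.ofReal *
      ((s.1 * uMat b).map Complex.ofReal)⁻¹ := by
    intro a
    have hi : ((uMat b).map Complex.ofReal)⁻¹ = (uMat (-b)).map Complex.ofReal :=
      Matrix.inv_eq_right_inv (by rw [← map_ofReal_mul, uMat_mul_neg, map_ofReal_one])
    rw [Orbit.torus, grTorus_boundaryOrbit, splOf_boundaryOrbit, Pi.mulSingle_eq_same, diagonal_wt',
      map_ofReal_mul, map_ofReal_mul, map_ofReal_mul, Matrix.mul_inv_rev, hi]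
    simp only [Matrix.mul_assoc]
  change (∀ a : ℝˣ, (boundaryOrbit d s b).torus (Pi.mulSingle 0 a) *ᵥ
    (fun i => ((((s.1 * uMat b) *ᵥ y) i : ℝ) : ℂ)) = _) ↔ _
  have key : ∀ a : ℝˣ, ((boundaryOrbit d s b).torus (Pi.mulSingle 0 a) *ᵥ
      (fun i => ((((s.1 * uMat b) *ᵥ y) i : ℝ) : ℂ)) = (((a ^ l : ℝˣ) : ℝ) : ℂ) •
      fun i => ((((s.1 * uMat b) *ᵥ y) i : ℝ) : ℂ)) ↔
      ∀ j, ((a ^ wt' j : ℝˣ) : ℝ) * y j = ((a ^ l : ℝˣ) : ℝ) * y j := by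
    intro a
    rw [htor, hcast, Matrix.mulVec_mulVec, Matrix.mul_assoc, Matrix.nonsing_inv_mul _ hu'',
      Matrix.mul_one, ← map_ofReal_mul, ← hcast, ← Matrix.mulVec_mulVec]
    have e1 : ((((a ^ l : ℝˣ) : ℝ) : ℂ) • (((s.1 * uMat b).map Complex.ofReal) *ᵥ
        fun i => (y i : ℂ))) =
        fun i => ((((s.1 * uMat b) *ᵥ (((a ^ l : ℝˣ) : ℝ) • y)) i : ℝ) : ℂ) := by
      rw [hcast, ← Matrix.mulVec_smul]
      congr 1
      ext i
      simp
    rw [e1]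
    constructor
    · intro h j
      have h' : (s.1 * uMat b) *ᵥ ((Matrix.diagonal fun i => ((a ^ wt' i : ℝˣ) : ℝ)) *ᵥ y) =
          (s.1 * uMat b) *ᵥ (((a ^ l : ℝˣ) : ℝ) • y) := by
        ext i
        exact_mod_cast congrFun h i
      have h'' := congrArg (fun x => (s.1 * uMat b)⁻¹ *ᵥ x) h'
      rw [Matrix.mulVec_mulVec _ (s.1 * uMat b)⁻¹ (s.1 * uMat b),
        Matrix.mulVec_mulVec _ (s.1 * uMat b)⁻¹ (s.1 * uMat b),
        Matrix.nonsing_inv_mul _ hu, Matrix.one_mulVec, Matrix.one_mulVec] at h''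
      have := congrFun h'' j
      rwa [Matrix.mulVec_diagonal] at this
    · intro h
      have : (Matrix.diagonal fun i => ((a ^ wt' i : ℝˣ) : ℝ)) *ᵥ y = ((a ^ l : ℝˣ) : ℝ) • y := by
        ext j
        rw [Matrix.mulVec_diagonal]
        exact h j
      rw [this]
  simp only [key]
  constructor
  · intro h j hj
    -- The integral powers of 2 are distinct, so a = 2 separates all the weights.
    have h2 := h (Units.mk0 2 two_ne_zero) j
    by_contra hy
    have h3 := mul_right_cancel₀ hy h2
    rw [Units.val_zpow_eq_zpow_val, Units.val_zpow_eq_zpow_val] at h3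
    exact hj (zpow_right_injective₀ (by norm_num) (by norm_num) h3)
  · intro h a j
    by_cases hj : wt' j = l
    · rw [hj]
    · rw [h j hj, mul_zero, mul_zero]

theorem splW_mul_uMat_mulVec (s : splW) (b : ℝ) (y : Fin 4 → ℝ) :
    ((s.1 * uMat b) *ᵥ y) 2 = y 2 + s.1 2 3 * y 3 ∧ ((s.1 * uMat b) *ᵥ y) 3 = y 3 := by
  rw [eq_of_mem_splW s.2]
  simp [uMat, Matrix.mulVec, dotProduct, Fin.sum_univ_four]

/-- The columns of s·u(b) diagonalize the torus, and this matrix preserves the span of e_1 and e_2.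
The weight filtration is therefore the coordinate one, whatever d, s and b are; this gives
rationality and membership in Φ. -/
theorem weightFil_boundaryOrbit (d : ℝ) (s : splW) (b : ℝ) (k : ℤ) :
    (boundaryOrbit d s b).weightFil 0 k = weightSub ℝ wt' k := by
  have hu := (Matrix.isUnit_iff_isUnit_det _).1 (isUnit_splW_mul_uMat s b)
  have hsurj : ∀ x : Fin 4 → ℝ, ∃ y, (s.1 * uMat b) *ᵥ y = x := fun x =>
    ⟨(s.1 * uMat b)⁻¹ *ᵥ x, by
      rw [Matrix.mulVec_mulVec, Matrix.mul_nonsing_inv _ hu, Matrix.one_mulVec]⟩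
  apply le_antisymm
  · refine iSup₂_le fun l hl x hx => ?_
    obtain ⟨y, rfl⟩ := hsurj x
    rw [mulVec_mem_eigen_iff] at hx
    obtain ⟨h2, h3⟩ := splW_mul_uMat_mulVec s b y
    have hy23 : k < 0 → y 2 = 0 ∧ y 3 = 0 := fun hk =>
      ⟨hx 2 (by simp [wt']; omega), hx 3 (by simp [wt']; omega)⟩
    have hy0 : k < -2 → y = 0 := fun hk => by
      ext j
      refine hx j ?_
      fin_cases j <;> simp [wt'] <;> omega
    intro j hj
    by_cases hk : k < -2
    · simp [hy0 hk]
    · fin_cases j <;> simp [wt'] at hj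
      · omega
      · omega
      · simp [h2, hy23 hj]
      · simp [h3, hy23 hj]
  · intro x hx
    obtain ⟨y, rfl⟩ := hsurj x
    obtain ⟨h2, h3⟩ := splW_mul_uMat_mulVec s b y
    by_cases hk : k < -2
    · have : (s.1 * uMat b) *ᵥ y = 0 := by
        ext j
        refine hx j ?_
        fin_cases j <;> simp [wt'] <;> omega
      rw [this]
      exact Submodule.zero_mem _
    have hm : ∀ l ≤ k, ∀ y', (∀ j, wt' j ≠ l → y' j = 0) →
        (s.1 * uMat b) *ᵥ y' ∈ (boundaryOrbit d s b).weightFil 0 k := fun l hl y' h =>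
      (le_iSup₂ (f := fun l (_ : l ≤ k) => (boundaryOrbit d s b).eigen 0 l) l hl)
        ((mulVec_mem_eigen_iff d s b l y').2 h)
    have e : y = ![y 0, y 1, 0, 0] + ![0, 0, y 2, y 3] := by
      ext j
      fin_cases j <;> simp
    rw [e, Matrix.mulVec_add]
    refine add_mem (hm (-2) (by omega) _ fun j hj => ?_) ?_
    · fin_cases j <;> simp [wt'] at hj ⊢
    · by_cases hk0 : k < 0
      · have y3 : y 3 = 0 := by rw [← h3]; exact hx 3 (by simpa [wt'] using hk0)
        have y2 : y 2 = 0 := by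
          have := hx 2 (by simpa [wt'] using hk0)
          rw [h2, y3] at this
          simpa using this
        have : (![0, 0, y 2, y 3] : Fin 4 → ℝ) = 0 := by
          ext j
          fin_cases j <;> simp [y2, y3]
        rw [this, Matrix.mulVec_zero]
        exact Submodule.zero_mem _
      · refine hm 0 (by omega) _ fun j hj => ?_
        fin_cases j <;> simp [wt'] at hj ⊢

theorem mem_grPiece_weightSub {v : Fin 4 → ℤ} {w k : ℤ} {x : Fin 4 → ℝ} :
    x ∈ grPiece w (weightSub ℝ v k) ↔ ∀ j, k < v j ∨ wt j ≠ w → x j = 0 := by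
  constructor
  · rintro ⟨y, ⟨hy, -⟩, rfl⟩ j hj
    rw [grProj_apply]
    split_ifs with h
    · exact hy j (hj.resolve_right (by simpa using h))
    · rfl
  · intro h
    refine ⟨x, ⟨fun j hj => h j (.inl hj), fun j hj => h j (.inr hj.ne')⟩, ?_⟩
    ext j
    rw [grProj_apply]
    split_ifs with hj
    · rfl
    · exact (h j (.inr hj)).symm

theorem grSub_weightSub (v : Fin 4 → ℤ) (k : ℤ) : grSub (weightSub ℝ v k) = weightSub ℝ v k := by
  apply le_antisymm
  · exact iSup_le fun w x hx j hj => mem_grPiece_weightSub.1 hx j (.inl hj)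
  · intro x hx
    have hs : x = grProj ℝ (-2) x + grProj ℝ (-1) x + grProj ℝ 0 x := by
      ext j
      simp only [Pi.add_apply, grProj_apply]
      fin_cases j <;> simp [wt]
    have hm : ∀ w, grProj ℝ w x ∈ grSub (weightSub ℝ v k) := by
      intro w
      refine (le_iSup (fun w => grPiece w (weightSub ℝ v k)) w)
        (mem_grPiece_weightSub.2 fun j hj => ?_)
      rw [grProj_apply]
      split_ifs with h
      · exact hx j (hj.resolve_right (by simpa using h))
      · rfl
    rw [hs]
    exact add_mem (add_mem (hm _) (hm _)) (hm _)

theorem grPiece_weightSub_rational (v : Fin 4 → ℤ) (w k : ℤ) : ∃ T : Set (Fin 4 → ℚ),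
    grPiece w (weightSub ℝ v k) = Submodule.span ℝ ((fun x i => (x i : ℝ)) '' T) := by
  refine ⟨{x | ∀ j, k < v j ∨ wt j ≠ w → x j = 0}, ?_⟩
  apply le_antisymm
  · intro x hx
    rw [mem_grPiece_weightSub] at hx
    have : x = ∑ j, x j • Pi.single j (1 : ℝ) := by
      ext i
      simp [Finset.sum_apply, Pi.single_apply]
    rw [this]
    refine Submodule.sum_mem _ fun j _ => ?_
    by_cases hj : k < v j ∨ wt j ≠ w
    · rw [hx j hj, zero_smul]
      exact Submodule.zero_mem _
    · refine Submodule.smul_mem _ _ (Submodule.subset_span ⟨Pi.single j 1, fun i hi => ?_, ?_⟩)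
      · have : i ≠ j := by rintro rfl; exact hj hi
        simp [this]
      · ext i
        by_cases hij : i = j
        · subst hij; simp
        · simp [hij]
  · rw [Submodule.span_le]
    rintro _ ⟨x, hx, rfl⟩
    refine mem_grPiece_weightSub.2 fun j hj => ?_
    simp [hx j hj]

/-- The boundary point of `D^{II}_{SL(2)}(Φ)` with given `L̄`-component in `ℝ`, splitting of `W` and
splitting of `W'`. -/
def boundaryOrbitPhi (d : ℝ) (s : splW) (b : ℝ) : OrbitPhi :=
  ⟨⟨1, boundaryOrbit d s b⟩, by
    intro j k w
    obtain rfl : j = 0 := Subsingleton.elim _ _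
    change ∃ T : Set (Fin 4 → ℚ), grPiece w ((boundaryOrbit d s b).weightFil 0 k) = _
    rw [weightFil_boundaryOrbit]
    exact grPiece_weightSub_rational _ _ _, by
    rintro M ⟨j, -, rfl⟩
    obtain rfl : j = 0 := Subsingleton.elim _ _
    change _ = weightSub ℝ wt'
    funext k
    change grSub ((boundaryOrbit d s b).weightFil 0 k) = _
    rw [weightFil_boundaryOrbit, grSub_weightSub]⟩

/-- For t > 0 the value of ν on the torus orbit is (t, i + t²b, d, s, b), and the limit at t = 0 is
visible. -/
theorem nu_boundaryOrbitPhi (d : ℝ) (s : splW) (b : ℝ) :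
    nu (DII.mk (boundaryOrbitPhi d s b)) = (0, Complex.I, (d : EReal), s.1, b) := by
  refine nu_mk_of_isLimit ?_
  change Tendsto (fun t => nuD (act ((boundaryOrbit d s b).torus t) (boundaryOrbit d s b).r))
    (toZero 1) (𝓝 _)
  have h1 : Tendsto (fun (t : Fin 1 → ℝˣ) j => (t j : ℝ)) (toZero 1)
      (𝓝[{t | ∀ j, 0 < t j}] (0 : Fin 1 → ℝ)) := tendsto_comap
  rw [tendsto_nhdsWithin_iff] at h1
  have h0 : Tendsto (fun t : Fin 1 → ℝˣ => (t 0 : ℝ)) (toZero 1) (𝓝 0) := tendsto_pi_nhds.1 h1.1 0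
  have hc : Continuous fun x : ℝ =>
      ((x, Complex.I + ((x ^ 2 * b : ℝ) : ℂ), ((d : ℝ) : EReal), s.1, b) : B) := by fun_prop
  have hlim := (hc.tendsto 0).comp h0
  simp only [ne_eq, OfNat.ofNat_ne_zero, not_false_eq_true, zero_pow, zero_mul, Complex.ofReal_zero,
    add_zero] at hlim
  refine hlim.congr' ?_
  filter_upwards [h1.2] with t ht
  have hpos : 0 < (t 0 : ℝ) := ht 0
  have hx : 0 < ((t 0 : ℝ) ^ 2)⁻¹ := by positivity
  have him : ((((t 0 : ℝ) ^ 2)⁻¹ : ℝ) * Complex.I + b : ℂ).im = ((t 0 : ℝ) ^ 2)⁻¹ := by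
    rw [Complex.add_im, Complex.im_ofReal_mul]; simp
  have hre : ((((t 0 : ℝ) ^ 2)⁻¹ : ℝ) * Complex.I + b : ℂ).re = b := by
    rw [Complex.add_re, Complex.re_ofReal_mul]; simp
  rw [act_torus_boundaryOrbit, nuD_ptD (by rwa [him]) s.2, him, hre]
  have hne : ((t 0 : ℝ) : ℂ) ≠ 0 := by exact_mod_cast hpos.ne'
  simp only [Function.comp]
  congr 1
  · rw [← inv_pow, Real.sqrt_sq (by positivity)]; simp
  congr 1
  · push_cast; field_simp
  congr 2
  field_simp

theorem isTranslate_boundaryOrbit {γ : GL (Fin 4) ℤ} (hγ : γ ∈ Gam) (d : ℝ) (s s' : splW) (b b' : ℝ)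
    (hs : s'.1 = toR γ * s.1 * uMat (-shift γ)) (hb : b' = b + shift γ) :
    Orbit.IsTranslate γ (boundaryOrbit d s b) (boundaryOrbit d s' b') := by
  have hi : ((uMat (shift γ)).map Complex.ofReal)⁻¹ = (uMat (-shift γ)).map Complex.ofReal :=
    Matrix.inv_eq_right_inv (by rw [← map_ofReal_mul, uMat_mul_neg, map_ofReal_one])
  subst hb
  refine ⟨fun g => ?_, fun z => ?_, ?_⟩
  · rw [grMat_toC hγ, hi]
    change midMat _ _ = _ * midMat _ _ * _
    ext i j
    fin_cases i <;> fin_cases j <;>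
      simp [midMat, uMat, Matrix.mul_apply, Fin.sum_univ_four]
    all_goals ring
  · rw [grMat_toC hγ]
    have hU : (uMat (shift γ)).map Complex.ofReal =
        midMat 0 ((⟨!![1, (shift γ : ℂ); 0, 1], by simp⟩ : SL2C) : Matrix (Fin 2) (Fin 2) ℂ) := by
      ext i j
      fin_cases i <;> fin_cases j <;> simp [midMat, uMat]
    rw [hU]
    symm
    refine act_midMat_gradedFil one_ne_zero ?_ ?_
    all_goals
      generalize z 0 = w
      induction w using OnePoint.rec <;> simp [lineVec_infty, lineVec_coe]
    ring
  · change ptD _ _ _ = act _ (ptD _ _ _)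
    rw [act_toC_ptD, hs]
    congr 1
    push_cast
    ring

/-! ### The exponential and theta functions -/

theorem e_add (z w : ℂ) : e (z + w) = e z * e w := by
  rw [e, mul_add, Complex.exp_add]; rfl

theorem e_zero : e 0 = 1 := by simp [e]

theorem e_ne_zero (z : ℂ) : e z ≠ 0 := Complex.exp_ne_zero _

theorem e_neg (z : ℂ) : e (-z) = (e z)⁻¹ := by
  rw [e, mul_neg, Complex.exp_neg]; rfl

theorem e_sub (z w : ℂ) : e (z - w) = e z / e w := by
  rw [sub_eq_add_neg, e_add, e_neg, div_eq_mul_inv]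

theorem e_int_mul (n : ℤ) (z : ℂ) : e (n * z) = e z ^ n := by
  rw [e, e, ← Complex.exp_int_mul]
  congr 1
  ring

theorem e_nat_mul (n : ℕ) (z : ℂ) : e (n * z) = e z ^ n := by
  exact_mod_cast e_int_mul n z

theorem e_eq_one_iff (z : ℂ) : e z = 1 ↔ ∃ n : ℤ, z = n := by
  have h := Complex.two_pi_I_ne_zero
  rw [e, Complex.exp_eq_one_iff]
  refine exists_congr fun n => ⟨fun hn => ?_, fun hn => by rw [hn]; ring⟩
  apply mul_left_cancel₀ h
  rw [hn]; ring

theorem e_eq_e_iff (z w : ℂ) : e z = e w ↔ ∃ n : ℤ, z = w + n := by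
  rw [← div_eq_one_iff_eq (e_ne_zero w), ← e_sub, e_eq_one_iff]
  exact exists_congr fun n => sub_eq_iff_eq_add'

theorem e_sum {ι : Type*} (s : Finset ι) (f : ι → ℂ) : e (∑ i ∈ s, f i) = ∏ i ∈ s, e (f i) := by
  classical
  induction s using Finset.induction_on with
  | empty => simp [e_zero]
  | insert i s hi ih => rw [Finset.sum_insert hi, Finset.prod_insert hi, e_add, ih]

theorem norm_e (z : ℂ) : ‖e z‖ = Real.exp (-(2 * Real.pi * z.im)) := by
  rw [e, Complex.norm_exp]
  congr 1
  simp

theorem norm_e_lt_one {τ : ℂ} (hτ : 0 < τ.im) : ‖e τ‖ < 1 := by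
  rw [norm_e, Real.exp_lt_one_iff]
  have := Real.pi_pos
  have : 0 < 2 * Real.pi * τ.im := by positivity
  linarith

theorem e_half : e (1 / 2) = -1 := by
  rw [e, ← Complex.exp_pi_mul_I]
  congr 1
  ring

theorem summable_norm_geometric {q : ℂ} (hq : ‖q‖ < 1) (w : ℂ) : Summable fun n : ℕ => ‖-(q ^ n * w)‖ := by
  simp only [norm_neg, norm_mul, norm_pow]
  exact (summable_geometric_of_lt_one (norm_nonneg _) hq).mul_right _

theorem multipliable_geometric {q : ℂ} (hq : ‖q‖ < 1) (w : ℂ) :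
    Multipliable fun n : ℕ => 1 - q ^ n * w := by
  simpa only [sub_eq_add_neg] using multipliable_one_add_of_summable (summable_norm_geometric hq w)

theorem tprod_geometric_succ {q : ℂ} (hq : ‖q‖ < 1) (w : ℂ) :
    ∏' n : ℕ, (1 - q ^ n * w) = (1 - w) * ∏' n : ℕ, (1 - q ^ n * (q * w)) := by
  have h : (fun n : ℕ => 1 - q ^ n * (q * w)) = fun n => 1 - q ^ (n + 1) * w := by
    funext n; ring
  have hm : Multipliable fun n : ℕ => 1 - q ^ (n + 1) * w := h ▸ multipliable_geometric hq (q * w)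
  rw [h, tprod_eq_zero_mul' (f := fun n : ℕ => 1 - q ^ n * w) hm, pow_zero, one_mul]

/-- The shift removes the factor 1 - e(z) from the first product and adds 1 - e(z)⁻¹ to the second;
their ratio is -e(z)⁻¹. The sign is written e(1/2), so that automorphy factors have explicit
logarithms. -/
theorem theta_add_tau {τ : ℂ} (hτ : 0 < τ.im) (z : ℂ) :
    theta τ (z + τ) = e (1 / 2 - z) * theta τ z := by
  have hq := norm_e_lt_one hτ
  have hz := e_ne_zero z
  have hτ0 := e_ne_zero τ
  have h1 := tprod_geometric_succ hq (e z)
  have h2 := tprod_geometric_succ hq (e z)⁻¹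
  have e2 : (fun n : ℕ => 1 - e τ ^ (n + 1) * (e z)⁻¹) = fun n => 1 - e τ ^ n * (e τ * (e z)⁻¹) := by
    funext n; ring
  have e3 : (fun n : ℕ => 1 - e τ ^ (n + 1) * (e (z + τ))⁻¹) = fun n => 1 - e τ ^ n * (e z)⁻¹ := by
    funext n
    rw [e_add]
    field_simp
    ring
  unfold theta
  rw [e2, e3, h1, h2, e_add, e_sub, e_half, mul_comm (e z) (e τ)]
  generalize ∏' n : ℕ, (1 - e τ ^ n * (e τ * e z)) = P
  generalize ∏' n : ℕ, (1 - e τ ^ n * (e τ * (e z)⁻¹)) = Q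
  field_simp
  ring

theorem theta_add_int_mul_tau {τ : ℂ} (hτ : 0 < τ.im) (z : ℂ) (N : ℤ) :
    theta τ (z + N * τ) = e (N / 2 - N * z - N * (N - 1) / 2 * τ) * theta τ z := by
  induction N using Int.induction_on with
  | zero => simp [e_zero]
  | succ i ih =>
    have : z + ((i + 1 : ℤ) : ℂ) * τ = z + (i : ℤ) * τ + τ := by push_cast; ring
    rw [this, theta_add_tau hτ, ih, ← mul_assoc, ← e_add]
    congr 2
    push_cast
    ring
  | pred i ih =>
    have h := theta_add_tau hτ (z + ((-i - 1 : ℤ) : ℂ) * τ)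
    have : z + ((-i - 1 : ℤ) : ℂ) * τ + τ = z + ((-i : ℤ) : ℂ) * τ := by push_cast; ring
    rw [this, ih] at h
    apply mul_left_cancel₀ (e_ne_zero (1 / 2 - (z + ((-i - 1 : ℤ) : ℂ) * τ)))
    rw [← h, ← mul_assoc, ← e_add]
    congr 2
    push_cast
    ring

theorem theta_congr {τ τ' z z' : ℂ} (hτ : e τ = e τ') (hz : e z = e z') : theta τ z = theta τ' z' := by
  unfold theta
  rw [hτ, hz]

theorem tprod_geometric_ne_zero {q : ℂ} (hq : ‖q‖ < 1) {w : ℂ} (h : ∀ n : ℕ, q ^ n * w ≠ 1) :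
    ∏' n : ℕ, (1 - q ^ n * w) ≠ 0 := by
  have := tprod_one_add_ne_zero_of_summable (f := fun n : ℕ => -(q ^ n * w))
    (fun n => by rw [← sub_eq_add_neg]; exact sub_ne_zero.2 (h n).symm) (summable_norm_geometric hq w)
  simpa only [sub_eq_add_neg] using this

theorem theta_ne_zero {τ : ℂ} (hτ : 0 < τ.im) {z : ℂ} (h : ∀ k l : ℤ, z ≠ k * τ + l) :
    theta τ z ≠ 0 := by
  have hq := norm_e_lt_one hτ
  have e2 : (fun n : ℕ => 1 - e τ ^ (n + 1) * (e z)⁻¹) = fun n => 1 - e τ ^ n * (e τ * (e z)⁻¹) := by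
    funext n; ring
  unfold theta
  rw [e2]
  refine mul_ne_zero (tprod_geometric_ne_zero hq fun n hn => ?_)
    (tprod_geometric_ne_zero hq fun n hn => ?_)
  · rw [← e_nat_mul, ← e_add, e_eq_one_iff] at hn
    obtain ⟨l, hl⟩ := hn
    refine h (-n) l ?_
    push_cast
    linear_combination hl
  · rw [← e_nat_mul, ← e_neg, ← e_add, ← e_add, e_eq_one_iff] at hn
    obtain ⟨l, hl⟩ := hn
    refine h (n + 1) (-l) ?_
    push_cast
    linear_combination -hl

/-! ### The period map -/

/-- The element of `Γ` with the given entries above the diagonal. -/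
def gamMk (p q k n b a : ℤ) : GL (Fin 4) ℤ where
  val := !![1, p, q, k; 0, 1, n, b; 0, 0, 1, a; 0, 0, 0, 1]
  inv := !![1, -p, p * n - q, -k + p * b + q * a - p * n * a; 0, 1, -n, n * a - b; 0, 0, 1, -a;
    0, 0, 0, 1]
  val_inv := by
    ext i j
    fin_cases i <;> fin_cases j <;> simp [Matrix.mul_apply, Fin.sum_univ_four] <;> ring
  inv_val := by
    ext i j
    fin_cases i <;> fin_cases j <;> simp [Matrix.mul_apply, Fin.sum_univ_four] <;> ring

theorem coe_gamMk (p q k n b a : ℤ) : (gamMk p q k n b a : Matrix (Fin 4) (Fin 4) ℤ) =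
    !![1, p, q, k; 0, 1, n, b; 0, 0, 1, a; 0, 0, 0, 1] := rfl

theorem toC_gamMk (p q k n b a : ℤ) : toC (gamMk p q k n b a) =
    !![1, (p : ℂ), q, k; 0, 1, n, b; 0, 0, 1, a; 0, 0, 0, 1] := by
  rw [toC, coe_gamMk]
  ext i j
  fin_cases i <;> fin_cases j <;> simp

theorem toR_gamMk (p q k n b a : ℤ) : toR (gamMk p q k n b a) =
    !![1, (p : ℝ), q, k; 0, 1, n, b; 0, 0, 1, a; 0, 0, 0, 1] := by
  rw [toR, coe_gamMk]
  ext i j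
  fin_cases i <;> fin_cases j <;> simp

theorem gamMk_mem (p q k n b a : ℤ) : gamMk p q k n b a ∈ Gam := by
  refine ⟨⟨fun i j h => ?_, ?_⟩, fun i j h => ?_⟩
  · rw [coe_gamMk]
    fin_cases i <;> fin_cases j <;> simp [wt] at h ⊢
  · have : grMat (toC (gamMk p q k n b a)) =
        midMat 0 ((⟨!![1, (n : ℂ); 0, 1], by simp⟩ : SL2C) : Matrix (Fin 2) (Fin 2) ℂ) := by
      rw [toC_gamMk]
      ext i j
      fin_cases i <;> fin_cases j <;> simp [midMat, grMat, wt]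
    rw [this]
    exact midMat_mem_Ggr _ _
  · rw [coe_gamMk]
    fin_cases i <;> fin_cases j <;> simp at h ⊢

theorem act_gamMk_filF (p q k n b a : ℤ) (τ z₁ z₂ z₃ : ℂ) :
    act (toC (gamMk p q k n b a)) (filF τ z₁ z₂ z₃) =
      filF (τ + n) (z₁ + p * τ + q) (z₂ + p * z₃ + k - a * (z₁ + p * τ + q))
        (z₃ + b - a * (τ + n)) := by
  refine act_filF (isUnit_toC _) (μ := 1) (ν := 1) a one_ne_zero one_ne_zero ?_ ?_
  all_goals
    rw [toC_gamMk]
    ext i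
    fin_cases i <;> simp [Matrix.mulVec, dotProduct, Fin.sum_univ_four]

/-- Summands depending on only one of the two indices cancel, as the other divisor has degree zero.
This is used for the independence of the choices and for the value of the slope. -/
theorem sum_sum_of_degree_zero {R : Type*} [CommRing R] {r s : ℕ} {m : Fin r → R} {n : Fin s → R}
    (hm : ∑ j, m j = 0) (hn : ∑ k, n k = 0) (F : Fin r → R) (G : Fin s → R)
    (H : Fin r → Fin s → R) :
    ∑ j, ∑ k, m j * n k * (F j + G k + H j k) = ∑ j, ∑ k, m j * n k * H j k := by
  have h1 : ∑ j, ∑ k, m j * n k * F j = 0 := by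
    have : ∀ j, ∑ k, m j * n k * F j = m j * F j * ∑ k, n k := fun j => by
      rw [Finset.mul_sum]; exact Finset.sum_congr rfl fun k _ => by ring
    simp [this, hn]
  have h2 : ∑ j, ∑ k, m j * n k * G k = 0 := by
    rw [Finset.sum_comm]
    have : ∀ k, ∑ j, m j * n k * G k = n k * G k * ∑ j, m j := fun k => by
      rw [Finset.mul_sum]; exact Finset.sum_congr rfl fun k _ => by ring
    simp [this, hm]
  simp only [mul_add, Finset.sum_add_distrib, h1, h2, zero_add]

theorem sum_sum_mul {R : Type*} [CommRing R] {r s : ℕ} (m : Fin r → R) (n : Fin s → R)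
    (F : Fin r → R) (G : Fin s → R) :
    ∑ j, ∑ k, m j * n k * (F j * G k) = (∑ j, m j * F j) * ∑ k, n k * G k := by
  rw [Finset.sum_mul_sum]
  exact Finset.sum_congr rfl fun j _ => Finset.sum_congr rfl fun k _ => by ring

/-- Replacing τ by τ + cK changes aτ by the integer (ca)K, leaves e(τ/c) unchanged, and two
logarithms of u differ by an integer. -/
theorem sectionLifts_shift {c : ℕ} (hc : 1 ≤ c) {a : ℚ} (ha : ∃ k : ℤ, c * a = k) {u : ℂ → ℂ}
    {τ : ℂ} {K : ℤ} {z z' : ℂ} (hz : z ∈ sectionLifts c a u τ)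
    (hz' : z' ∈ sectionLifts c a u (τ + c * K)) : ∃ A B : ℤ, z' = z + A * τ + B := by
  obtain ⟨f, k, l, hf, rfl⟩ := hz
  obtain ⟨f', k', l', hf', rfl⟩ := hz'
  obtain ⟨x, hx⟩ := ha
  have hc0 : (c : ℂ) ≠ 0 := by exact_mod_cast (by omega : c ≠ 0)
  have h1 : e ((τ + c * K) / c) = e (τ / c) := by
    rw [e_eq_e_iff]
    exact ⟨K, by field_simp⟩
  rw [h1, ← hf, e_eq_e_iff] at hf'
  obtain ⟨y, rfl⟩ := hf'
  have hx' : (c : ℂ) * a = x := by exact_mod_cast congrArg (fun t : ℚ => (t : ℂ)) hx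
  refine ⟨k' - k, x * K + y + k' * c * K + l' - l, ?_⟩
  push_cast
  linear_combination (K : ℂ) * hx'

theorem theta_sub_ne_zero {c : ℕ} {a b : ℚ} {u v : ℂ → ℂ} (h : DoNotMeet c a u b v) {τ z w : ℂ}
    (hτ : 0 < τ.im) (hz : z ∈ sectionLifts c a u τ) (hw : w ∈ sectionLifts c b v τ) :
    theta τ (z - w) ≠ 0 := by
  refine theta_ne_zero hτ fun k l hkl => ?_
  refine Set.disjoint_left.1 (h.1 τ hτ) hz ?_
  obtain ⟨f, k', l', hf, rfl⟩ := hw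
  refine ⟨f, k' + k, l' + l, hf, ?_⟩
  push_cast
  linear_combination hkl

/-- By quasi-periodicity a change of lifts alters λ by a double sum, quadratic in the lattice
shifts. Degree zero leaves only its mixed terms, and these are what an element of Γ adds to z₂. -/
theorem exists_act_of_isPeriod {c : ℕ} (hc : 1 ≤ c) {r s : ℕ}
    {m : Fin r → ℤ} {n : Fin s → ℤ} (hm : ∑ j, m j = 0) (hn : ∑ k, n k = 0)
    {a : Fin r → ℚ} {b : Fin s → ℚ}
    (ha : ∀ j, ∃ k : ℤ, c * a j = k) (hb : ∀ j, ∃ k : ℤ, c * b j = k)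
    {u : Fin r → ℂ → ℂ} {v : Fin s → ℂ → ℂ} {q : ℂ} {F F' : Fil}
    (hF : IsPeriod c m n a b u v q F) (hF' : IsPeriod c m n a b u v q F') :
    ∃ γ ∈ Gam, F' = act (toC γ) F := by
  obtain ⟨τ, z, w, lam, hτ, hq, hz, hw, hlam, rfl⟩ := hF
  obtain ⟨τ', z', w', lam', hτ', hq', hz', hw', hlam', rfl⟩ := hF'
  have hc0 : (c : ℂ) ≠ 0 := by exact_mod_cast (by omega : c ≠ 0)
  rw [← hq, e_eq_e_iff] at hq'
  obtain ⟨K, hK⟩ := hq'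
  obtain rfl : τ' = τ + c * K := by
    field_simp at hK
    linear_combination hK
  choose A B hAB using fun j => sectionLifts_shift hc (ha j) (hz j) (hz' j)
  choose C E hCE using fun k => sectionLifts_shift hc (hb k) (hw k) (hw' k)
  have hmC : ∑ j, (m j : ℂ) = 0 := by exact_mod_cast congrArg (fun t : ℤ => (t : ℂ)) hm
  have hnC : ∑ k, (n k : ℂ) = 0 := by exact_mod_cast congrArg (fun t : ℤ => (t : ℂ)) hn
  have hθ : ∀ j k, theta (τ + c * K) (z' j - w' k) =
      e (((A j - C k : ℤ) : ℂ) / 2 - (A j - C k : ℤ) * (z j - w k) -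
        (A j - C k : ℤ) * ((A j - C k : ℤ) - 1) / 2 * τ) * theta τ (z j - w k) := by
    intro j k
    rw [← theta_add_int_mul_tau hτ]
    refine theta_congr ((e_eq_e_iff _ _).2 ⟨c * K, by push_cast; ring⟩)
      ((e_eq_e_iff _ _).2 ⟨B j - E k, ?_⟩)
    rw [hAB, hCE]
    push_cast
    ring
  have hsum : ∑ j, ∑ k, (m j : ℂ) * n k * (((A j - C k : ℤ) : ℂ) / 2 -
        (A j - C k : ℤ) * (z j - w k) - (A j - C k : ℤ) * ((A j - C k : ℤ) - 1) / 2 * τ) =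
      (∑ j, m j * A j : ℂ) * (∑ k, n k * w k) + (∑ k, n k * C k : ℂ) * (∑ j, m j * z j) +
        (∑ j, m j * A j : ℂ) * (∑ k, n k * C k : ℂ) * τ := by
    have h := sum_sum_of_degree_zero hmC hnC
      (fun j => (A j : ℂ) / 2 - A j * z j - (A j * A j - A j) / 2 * τ)
      (fun k => -(C k : ℂ) / 2 - C k * w k - (C k * C k + C k) / 2 * τ)
      (fun j k => (A j : ℂ) * w k + z j * C k + A j * (C k * τ))
    have h2 : ∑ j, ∑ k, (m j : ℂ) * n k * ((A j : ℂ) * w k + z j * C k + A j * (C k * τ)) =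
        (∑ j, m j * A j : ℂ) * (∑ k, n k * w k) + (∑ k, n k * C k : ℂ) * (∑ j, m j * z j) +
        (∑ j, m j * A j : ℂ) * (∑ k, n k * C k : ℂ) * τ := by
      simp only [mul_add, Finset.sum_add_distrib]
      rw [sum_sum_mul, sum_sum_mul, sum_sum_mul]
      have : ∑ k, (n k : ℂ) * (C k * τ) = (∑ k, n k * C k : ℂ) * τ := by
        rw [Finset.sum_mul]; exact Finset.sum_congr rfl fun k _ => by ring
      rw [this]
      ring
    rw [← h2, ← h]
    refine Finset.sum_congr rfl fun j _ => Finset.sum_congr rfl fun k _ => ?_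
    push_cast
    ring
  have hlam2 : e lam' = e ((∑ j, m j * A j : ℂ) * (∑ k, n k * w k) +
      (∑ k, n k * C k : ℂ) * (∑ j, m j * z j) +
        (∑ j, m j * A j : ℂ) * (∑ k, n k * C k : ℂ) * τ + lam) := by
    rw [e_add, hlam, ← hsum, e_sum, hlam', ← Finset.prod_mul_distrib]
    refine Finset.prod_congr rfl fun j _ => ?_
    rw [e_sum, ← Finset.prod_mul_distrib]
    refine Finset.prod_congr rfl fun k _ => ?_
    rw [hθ, mul_zpow, ← e_int_mul]
    push_cast
    rfl
  rw [e_eq_e_iff] at hlam2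
  obtain ⟨L, hL⟩ := hlam2
  -- The entries are read off from `act_gamMk_filF`. With last parameter -∑ m_j A_j, that action
  -- adds (∑ m_j A_j)(∑ n_k E_k) to z₂ and (∑ m_j A_j)cK to z₃; the two subtracted products
  -- compensate for this.
  refine ⟨gamMk (∑ k, n k * C k) (∑ k, n k * E k) (L - (∑ j, m j * A j) * (∑ k, n k * E k)) (c * K)
    ((∑ j, m j * B j) - (∑ j, m j * A j) * (c * K)) (-∑ j, m j * A j), gamMk_mem _ _ _ _ _ _, ?_⟩
  have hw1 : ∑ k, (n k : ℂ) * w' k = ∑ k, (n k : ℂ) * w k + (∑ k, (n k : ℂ) * C k) * τ +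
      ∑ k, (n k : ℂ) * E k := by
    rw [Finset.sum_mul, ← Finset.sum_add_distrib, ← Finset.sum_add_distrib]
    exact Finset.sum_congr rfl fun k _ => by rw [hCE]; ring
  have hz1 : ∑ j, (m j : ℂ) * z' j = ∑ j, (m j : ℂ) * z j + (∑ j, (m j : ℂ) * A j) * τ +
      ∑ j, (m j : ℂ) * B j := by
    rw [Finset.sum_mul, ← Finset.sum_add_distrib, ← Finset.sum_add_distrib]
    exact Finset.sum_congr rfl fun k _ => by rw [hAB]; ring
  rw [act_gamMk_filF, hL, hw1, hz1]
  push_cast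
  congr 1 <;> ring

/-! ### Period maps over `Δ^log` -/

/-- The data of a period map of the form
`e(τ/c) = q ↦ F(τ, Bτ + ψ(q), Λτ + μ(q), Aτ + φ(q))`. -/
structure PeriodForm where
  c : ℕ
  hc : 1 ≤ c
  A : ℝ
  B : ℝ
  Lam : ℝ
  φ : ℂ → ℂ
  ψ : ℂ → ℂ
  μ : ℂ → ℂ
  hφ : DifferentiableOn ℂ φ (Metric.ball 0 1)
  hψ : DifferentiableOn ℂ ψ (Metric.ball 0 1)
  hμ : DifferentiableOn ℂ μ (Metric.ball 0 1)
  cA : ℤ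
  cB : ℤ
  cLam : ℤ
  hA : c * A = cA
  hB : c * B = cB
  hLam : c * Lam = cLam

namespace PeriodForm

variable (d : PeriodForm)

/-- The value at `τ` of the period map. -/
def point (τ : ℂ) : Fil :=
  filF τ (d.B * τ + d.ψ (e (τ / d.c))) (d.Lam * τ + d.μ (e (τ / d.c))) (d.A * τ + d.φ (e (τ / d.c)))

/-- The coefficient of `Im τ` in `δ`. -/
def slope : ℝ := d.Lam - d.A * d.B

/-- The remainder term of `δ`, in terms of `ι = (Im τ)⁻¹` and `q`. -/
def rest (ι : ℝ) (q : ℂ) : ℝ :=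
  (d.μ q).im - d.B * (d.φ q).im - d.A * (d.ψ q).im - (d.ψ q).im * (d.φ q).im * ι

/-- The splitting of `W`, in terms of `x = Re τ`, `ι = (Im τ)⁻¹` and `q`. -/
def spl (x ι : ℝ) (q : ℂ) : Matrix (Fin 4) (Fin 4) ℝ :=
  !![1, d.B + (d.ψ q).im * ι, (d.ψ q).re - x * ((d.ψ q).im * ι),
      d.Lam * x + (d.μ q).re - (d.A + (d.φ q).im * ι) * (d.B * x + (d.ψ q).re);
     0, 1, 0, (d.φ q).re - (d.φ q).im * ι * x;
     0, 0, 1, -(d.A + (d.φ q).im * ι);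
     0, 0, 0, 1]

theorem spl_mem (x ι : ℝ) (q : ℂ) : d.spl x ι q ∈ splW := by
  intro i j h
  fin_cases i <;> fin_cases j <;> simp [wt, spl] at h ⊢

theorem point_mem_D {τ : ℂ} (hτ : 0 < τ.im) : d.point τ ∈ D := filF_mem_D hτ _ _ _

/-- Here Im z₁/Im τ = B + ι Im ψ and Im z₃/Im τ = A + ι Im φ with ι = 1/Im τ, so no negative power
of ι enters the splitting or the remainder. Both make sense at ι = 0; only the slope multiplies Im
τ. -/
theorem point_eq_ptD {τ : ℂ} (hτ : 0 < τ.im) :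
    d.point τ = ptD τ (d.spl τ.re τ.im⁻¹ (e (τ / d.c)))
      (d.slope * τ.im + d.rest τ.im⁻¹ (e (τ / d.c))) := by
  have h := hτ.ne'
  rw [point, filF_eq_ptD hτ]
  generalize e (τ / d.c) = q
  congr 1
  · ext i j
    fin_cases i <;> fin_cases j <;> simp [splMat, spl]
    all_goals try field_simp
    all_goals first | ring1 | simp
  · simp [slope, rest]
    field_simp
    ring

/-! ### The lifted period map in the coordinates (t, x) -/

/-- The point of the upper half plane above `logParam t X`. -/
def tau (t X : ℝ) : ℂ := ⟨d.c * X, d.c / (2 * Real.pi * t ^ 2)⟩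

/-- The inverse of the imaginary part of `tau`. -/
def iota (t : ℝ) : ℝ := 2 * Real.pi * t ^ 2 / d.c

theorem c_pos : (0 : ℝ) < d.c := by exact_mod_cast d.hc

theorem tau_im_pos {t : ℝ} (ht : t ≠ 0) (X : ℝ) : 0 < (d.tau t X).im := by
  have := d.c_pos
  have := Real.pi_pos
  have : 0 < t ^ 2 := by positivity
  simp only [tau]
  positivity

theorem tau_im_inv (t X : ℝ) : (d.tau t X).im⁻¹ = d.iota t := by
  simp [tau, iota]

theorem toDisc_logParam (t X : ℝ) : (logParam t X).toDisc =
    (expNegInvGlue (t ^ 2) : ℂ) * Complex.exp ((2 * Real.pi * X : ℝ) * Complex.I) := by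
  simp [LogDisc.toDisc, logParam, Circle.coe_exp]

theorem e_tau {t : ℝ} (ht : t ≠ 0) (X : ℝ) : e (d.tau t X / d.c) = (logParam t X).toDisc := by
  have hc : (d.c : ℂ) ≠ 0 := by exact_mod_cast d.c_pos.ne'
  have hpi : (Real.pi : ℂ) ≠ 0 := by exact_mod_cast Real.pi_pos.ne'
  have ht' : (t : ℂ) ≠ 0 := by exact_mod_cast ht
  have ht2 : ¬ t ^ 2 ≤ 0 := by
    have : 0 < t ^ 2 := by positivity
    linarith
  have htau : d.tau t X = d.c * X + d.c / (2 * Real.pi * t ^ 2) * Complex.I := by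
    rw [show (d.c * X + d.c / (2 * Real.pi * t ^ 2) * Complex.I : ℂ) =
      ((d.c * X : ℝ) : ℂ) + ((d.c / (2 * Real.pi * t ^ 2) : ℝ) : ℂ) * Complex.I by push_cast; rfl,
      ← Complex.mk_eq_add_mul_I, tau]
  rw [toDisc_logParam, expNegInvGlue, if_neg ht2, Complex.ofReal_exp, ← Complex.exp_add, e, htau]
  congr 1
  push_cast
  field_simp
  linear_combination Complex.I_sq

theorem norm_toDisc_lt (β : LogDisc) : β.toDisc ∈ Metric.ball (0 : ℂ) 1 := by
  have h0 : (0 : ℝ) ≤ β.1 := β.1.2.1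
  simpa [LogDisc.toDisc, abs_of_nonneg h0, Circle.norm_coe] using β.1.2.2

theorem logParam_zero (X : ℝ) : (logParam 0 X).toDisc = 0 := by
  rw [toDisc_logParam]
  simp

/-- The lift to `D^{II}_{SL(2)}(Φ)` of the extended period map. -/
def lift (t X : ℝ) : DII :=
  if ht : t = 0 then
    DII.mk (boundaryOrbitPhi d.slope ⟨d.spl (d.c * X) 0 0, d.spl_mem _ _ _⟩ (d.c * X))
  else DII.ofD ⟨d.point (d.tau t X), d.point_mem_D (d.tau_im_pos ht X)⟩

/-- The coordinates of `ν` on the lift, as functions on `ℝ²`. -/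
def nuCoord (p : ℝ × ℝ) : ℝ × ℂ × ℝ × (Fin 4 → Fin 4 → ℝ) × ℝ :=
  (p.1 * √(2 * Real.pi / d.c), (d.c * p.2 * d.iota p.1 : ℝ) + Complex.I,
    d.slope + d.iota p.1 * d.rest (d.iota p.1) (logParam p.1 p.2).toDisc,
    d.spl (d.c * p.2) (d.iota p.1) (logParam p.1 p.2).toDisc, d.c * p.2)

/-- One formula covers the interior and the boundary, which is the reason for the choice of boundary
orbit. The sign of t matters for β only, through √(t²) = t. -/
theorem nu_lift {t : ℝ} (ht : 0 ≤ t) (X : ℝ) :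
    nu (d.lift t X) = ((d.nuCoord (t, X)).1, (d.nuCoord (t, X)).2.1,
      (((d.nuCoord (t, X)).2.2.1 : ℝ) : EReal), (d.nuCoord (t, X)).2.2.2.1,
      (d.nuCoord (t, X)).2.2.2.2) := by
  rcases eq_or_lt_of_le ht with h | h
  · subst h
    have h0 : d.iota 0 = 0 := by simp [iota]
    simp only [lift, dif_pos, nu_boundaryOrbitPhi, nuCoord, h0, logParam_zero]
    simp
    rfl
  · have ht0 := h.ne'
    have hτ := d.tau_im_pos ht0 X
    simp only [lift, dif_neg ht0, nu_ofD]
    rw [d.point_eq_ptD hτ, nuD_ptD hτ (d.spl_mem _ _ _), d.tau_im_inv, d.e_tau ht0]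
    have him := d.tau_im_inv t X
    have hi : d.iota t * (d.tau t X).im = 1 := by rw [← him, inv_mul_cancel₀ hτ.ne']
    simp only [nuCoord]
    congr 1
    · rw [one_div, ← Real.sqrt_inv, him, iota, show 2 * Real.pi * t ^ 2 / d.c =
        t ^ 2 * (2 * Real.pi / d.c) by ring, Real.sqrt_mul (by positivity), Real.sqrt_sq ht]
    congr 1
    · apply Complex.ext
      · simp [tau]; ring
      · simpa using hi
    congr 1
    · rw [div_eq_mul_inv, him]
      congr 1
      linear_combination d.slope * hi

/-! ### Smoothness and periodicity of the lift -/

theorem contDiff_toDisc : ContDiff ℝ ∞ fun p : ℝ × ℝ => (logParam p.1 p.2).toDisc := by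
  simp only [toDisc_logParam]
  refine ContDiff.mul ?_ ?_
  · exact Complex.ofRealCLM.contDiff.comp (expNegInvGlue.contDiff.comp (contDiff_fst.pow 2))
  · refine Complex.contDiff_exp.comp (ContDiff.mul ?_ contDiff_const)
    exact Complex.ofRealCLM.contDiff.comp (contDiff_const.mul contDiff_snd)

theorem contDiff_comp_toDisc {f : ℂ → ℂ} (hf : DifferentiableOn ℂ f (Metric.ball 0 1)) :
    ContDiff ℝ ∞ fun p : ℝ × ℝ => f (logParam p.1 p.2).toDisc := by
  have h : ContDiffOn ℝ ∞ f (Metric.ball 0 1) :=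
    (hf.contDiffOn Metric.isOpen_ball).restrict_scalars ℝ
  rw [← contDiffOn_univ]
  exact h.comp contDiff_toDisc.contDiffOn fun p _ => norm_toDisc_lt _

theorem contDiff_iota : ContDiff ℝ ∞ fun p : ℝ × ℝ => d.iota p.1 := by
  unfold iota
  fun_prop

theorem contDiff_re {f : ℂ → ℂ} (hf : DifferentiableOn ℂ f (Metric.ball 0 1)) :
    ContDiff ℝ ∞ fun p : ℝ × ℝ => (f (logParam p.1 p.2).toDisc).re :=
  Complex.reCLM.contDiff.comp (contDiff_comp_toDisc hf)

theorem contDiff_im {f : ℂ → ℂ} (hf : DifferentiableOn ℂ f (Metric.ball 0 1)) :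
    ContDiff ℝ ∞ fun p : ℝ × ℝ => (f (logParam p.1 p.2).toDisc).im :=
  Complex.imCLM.contDiff.comp (contDiff_comp_toDisc hf)

theorem contDiff_rest :
    ContDiff ℝ ∞ fun p : ℝ × ℝ => d.rest (d.iota p.1) (logParam p.1 p.2).toDisc := by
  have h1 := contDiff_im d.hφ
  have h2 := contDiff_im d.hψ
  have h3 := contDiff_im d.hμ
  have h4 := d.contDiff_iota
  unfold rest
  fun_prop

theorem contDiff_nuCoord : ContDiff ℝ ∞ d.nuCoord := by
  have h1 := contDiff_im d.hφ
  have h2 := contDiff_im d.hψ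
  have h1' := contDiff_re d.hφ
  have h2' := contDiff_re d.hψ
  have h3' := contDiff_re d.hμ
  have h4 := d.contDiff_iota
  have h5 := d.contDiff_rest
  unfold nuCoord
  refine ContDiff.prodMk (by fun_prop) (ContDiff.prodMk ?_ (ContDiff.prodMk (by fun_prop)
    (ContDiff.prodMk ?_ (by fun_prop))))
  · refine ContDiff.add ?_ contDiff_const
    refine Complex.ofRealCLM.contDiff.comp (f := fun p : ℝ × ℝ => d.c * p.2 * d.iota p.1) ?_
    fun_prop
  · refine contDiff_pi.2 fun i => contDiff_pi.2 fun j => ?_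
    fin_cases i <;> fin_cases j <;> simp [spl] <;> fun_prop

/-- The topology is induced by ν, and on t ≥ 0 the composite of ν with the lift is the restriction
of a continuous map on ℝ². -/
theorem tendsto_lift {X : Type*} {l : Filter X} {f : X → ℝ × ℝ} {p : ℝ × ℝ} (hp : 0 ≤ p.1)
    (hf : Tendsto f l (𝓝 p)) (hpos : ∀ᶠ x in l, 0 ≤ (f x).1) :
    Tendsto (fun x => d.lift (f x).1 (f x).2) l (𝓝 (d.lift p.1 p.2)) := by
  rw [nhds_induced, tendsto_comap_iff, d.nu_lift hp]
  have hc := d.contDiff_nuCoord.continuous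
  have hV : Continuous fun p : ℝ × ℝ => (((d.nuCoord p).1, (d.nuCoord p).2.1,
      (((d.nuCoord p).2.2.1 : ℝ) : EReal), (d.nuCoord p).2.2.2.1, (d.nuCoord p).2.2.2.2) : ExIV.B) := by
    refine Continuous.prodMk hc.fst (Continuous.prodMk hc.snd.fst (Continuous.prodMk ?_
      (Continuous.prodMk hc.snd.snd.snd.fst hc.snd.snd.snd.snd)))
    exact continuous_coe_real_ereal.comp hc.snd.snd.fst
  refine ((hV.tendsto p).comp hf).congr' ?_
  filter_upwards [hpos] with x hx
  simp only [Function.comp]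
  rw [d.nu_lift hx]

/-- This is the monodromy: τ ↦ τ + ck leaves q fixed and adds k times the integers cB, cΛ, cA to z₁,
z₂, z₃. The same γ translates the boundary orbits. -/
theorem mk_lift_add_int (t X : ℝ) (k : ℤ) :
    GamDII.mk (d.lift t (X + k)) = GamDII.mk (d.lift t X) := by
  symm
  set γ := gamMk 0 (k * d.cB) (k * d.cLam) (d.c * k) (k * d.cA) 0 with hγ
  have hγm : γ ∈ Gam := gamMk_mem _ _ _ _ _ _
  have hshift : shift γ = d.c * k := by
    rw [shift, hγ, toR_gamMk]
    simp
  by_cases ht : t = 0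
  · subst ht
    simp only [lift, dif_pos]
    refine Quot.sound ⟨γ, hγm, _, _, 1, _, _, rfl, rfl, rfl, rfl,
      isTranslate_boundaryOrbit hγm _ _ _ _ _ ?_ ?_⟩
    · simp only [hshift]
      rw [hγ, toR_gamMk]
      push_cast
      rw [← d.hA, ← d.hB, ← d.hLam]
      ext i j
      fin_cases i <;> fin_cases j <;> simp [spl, uMat, Matrix.mul_apply, Fin.sum_univ_four]
      all_goals ring
    · rw [hshift]; ring
  · simp only [lift, dif_neg ht]
    refine Quot.sound ⟨γ, hγm, _, _, 0, _, _, rfl, rfl, rfl, rfl,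
      isTranslate_orbitOfD hγm ?_⟩
    have hA : (d.c : ℂ) * d.A = d.cA := by exact_mod_cast congrArg (fun x : ℝ => (x : ℂ)) d.hA
    have hB : (d.c : ℂ) * d.B = d.cB := by exact_mod_cast congrArg (fun x : ℝ => (x : ℂ)) d.hB
    have hL : (d.c : ℂ) * d.Lam = d.cLam := by exact_mod_cast congrArg (fun x : ℝ => (x : ℂ)) d.hLam
    have hτ : d.tau t (X + k) = d.tau t X + d.c * k := by
      apply Complex.ext <;> simp [tau]
      ring
    have hq : e (d.tau t (X + k) / d.c) = e (d.tau t X / d.c) := by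
      have hc : (d.c : ℂ) ≠ 0 := by exact_mod_cast d.c_pos.ne'
      rw [e_eq_e_iff]
      exact ⟨k, by rw [hτ]; field_simp⟩
    change d.point _ = act _ (d.point _)
    rw [point, point, hq, hγ, act_gamMk_filF, hτ]
    push_cast
    rw [← hA, ← hB, ← hL]
    congr 1 <;> ring

/-! ### Descent to Δ^log and smoothness -/

/-- The coordinate `t` on `Δ^log`. -/
def tOf (r : ℝ) : ℝ := (√(-Real.log r))⁻¹

theorem tOf_nonneg (r : ℝ) : 0 ≤ tOf r := by unfold tOf; positivity

theorem tOf_pos {r : ℝ} (h0 : 0 < r) (h1 : r < 1) : 0 < tOf r := by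
  have := Real.log_neg h0 h1
  have : 0 < -Real.log r := by linarith
  unfold tOf
  positivity

/-- The conventions log 0 = 0 and 0⁻¹ = 0 produce the correct boundary value, the limit of 1/√(-log
r) as r → 0. -/
theorem tOf_zero : tOf 0 = 0 := by simp [tOf]

theorem expNegInvGlue_tOf {r : ℝ} (h0 : 0 ≤ r) (h1 : r < 1) : expNegInvGlue (tOf r ^ 2) = r := by
  rcases eq_or_lt_of_le h0 with rfl | h
  · simp [tOf_zero]
  · have hp := tOf_pos h h1
    have hl := Real.log_neg h h1
    have : ¬ tOf r ^ 2 ≤ 0 := by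
      have : 0 < tOf r ^ 2 := by positivity
      linarith
    rw [expNegInvGlue, if_neg this, tOf, inv_pow, Real.sq_sqrt (by linarith), inv_inv, neg_neg,
      Real.exp_log h]

theorem tOf_expNegInvGlue {t : ℝ} (ht : 0 ≤ t) : tOf (expNegInvGlue (t ^ 2)) = t := by
  rcases eq_or_lt_of_le ht with rfl | h
  · simp [tOf_zero]
  · have : ¬ t ^ 2 ≤ 0 := by
      have : 0 < t ^ 2 := by positivity
      linarith
    rw [expNegInvGlue, if_neg this, tOf, Real.log_exp, neg_neg, Real.sqrt_inv, Real.sqrt_sq ht,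
      inv_inv]

theorem continuousAt_tOf {r : ℝ} (h0 : 0 ≤ r) (h1 : r < 1) : ContinuousAt tOf r := by
  rcases eq_or_lt_of_le h0 with rfl | h
  · rw [continuousAt_iff_punctured_nhds, tOf_zero]
    exact (Real.tendsto_sqrt_atTop.comp
      (tendsto_neg_atBot_atTop.comp Real.tendsto_log_nhdsNE_zero)).inv_tendsto_atTop
  · have hl := Real.log_neg h h1
    have : √(-Real.log r) ≠ 0 := (Real.sqrt_pos.2 (by linarith)).ne'
    exact (Real.continuous_sqrt.continuousAt.comp (Real.continuousAt_log h.ne').neg).inv₀ this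

theorem logParam_tOf (β : LogDisc) {X : ℝ} (hX : Circle.exp (2 * Real.pi * X) = β.2) :
    logParam (tOf β.1) X = β := by
  refine Prod.ext (Subtype.ext ?_) hX
  exact expNegInvGlue_tOf β.1.2.1 β.1.2.2

/-- An argument of a point of the circle, divided by `2π`. -/
def argOf (u : Circle) : ℝ := (u : ℂ).arg / (2 * Real.pi)

theorem exp_argOf (u : Circle) : Circle.exp (2 * Real.pi * argOf u) = u := by
  have := Real.pi_pos
  rw [argOf, mul_div_cancel₀ _ (by positivity), Circle.exp_arg]

/-- The extended period map. -/
def ext (β : LogDisc) : GamDII := GamDII.mk (d.lift (tOf β.1) (argOf β.2))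

theorem ext_logParam {t : ℝ} (ht : 0 ≤ t) (X : ℝ) :
    d.ext (logParam t X) = GamDII.mk (d.lift t X) := by
  have h1 : tOf (logParam t X).1 = t := tOf_expNegInvGlue ht
  have h2 := exp_argOf (logParam t X).2
  change _ = Circle.exp (2 * Real.pi * X) at h2
  rw [Circle.exp_eq_exp] at h2
  obtain ⟨k, hk⟩ := h2
  have : argOf (logParam t X).2 = X + k := by
    have := Real.pi_pos
    apply mul_left_cancel₀ (show 2 * Real.pi ≠ 0 by positivity)
    rw [hk]; ring
  rw [ext, h1, this, mk_lift_add_int]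

theorem ext_eq (β : LogDisc) {X : ℝ} (hX : Circle.exp (2 * Real.pi * X) = β.2) :
    d.ext β = GamDII.mk (d.lift (tOf β.1) X) := by
  rw [← d.ext_logParam (tOf_nonneg _), logParam_tOf β hX]

theorem continuous_ext : Continuous d.ext := by
  rw [continuous_iff_continuousAt]
  intro β₀
  -- The principal argument is discontinuous at -1; dividing by the angle of β₀ first moves the base
  -- point to 1, where it is continuous.
  let X : LogDisc → ℝ := fun β => argOf β₀.2 + argOf (β.2 / β₀.2)
  have hX : ∀ β : LogDisc, Circle.exp (2 * Real.pi * X β) = β.2 := fun β => by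
    simp only [X, mul_add, Circle.exp_add, exp_argOf, mul_div_cancel]
  have hXc : ContinuousAt X β₀ := by
    refine continuousAt_const.add ?_
    have h0 : Continuous fun β : LogDisc => (β.2 / β₀.2 : Circle) := continuous_snd.div_const _
    have h1 : ContinuousAt (fun β : LogDisc => ((β.2 / β₀.2 : Circle) : ℂ)) β₀ :=
      (continuous_induced_dom.comp h0).continuousAt
    refine ContinuousAt.div_const ?_ _
    refine ContinuousAt.comp (f := fun β : LogDisc => ((β.2 / β₀.2 : Circle) : ℂ)) (g := Complex.arg) ?_ h1
    exact Complex.continuousAt_arg (by simp)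
  have hT : ContinuousAt (fun β : LogDisc => tOf β.1) β₀ :=
    ContinuousAt.comp (f := fun β : LogDisc => (β.1 : ℝ)) (continuousAt_tOf β₀.1.2.1 β₀.1.2.2)
      (continuous_subtype_val.comp continuous_fst).continuousAt
  have h := d.tendsto_lift (p := (tOf β₀.1, X β₀)) (tOf_nonneg _) (hT.prodMk_nhds hXc)
    (Eventually.of_forall fun β => tOf_nonneg _)
  have hmk : Continuous GamDII.mk := continuous_quot_mk
  have h' := (hmk.tendsto _).comp h
  rw [← d.ext_eq β₀ (hX β₀)] at h'
  refine h'.congr fun β => ?_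
  exact (d.ext_eq β (hX β)).symm

theorem coord_nu_lift (x : ℝ) {t : ℝ} (ht : 0 ≤ t) (X : ℝ) :
    coord (x : EReal) (nu (d.lift t X)) = d.nuCoord (t, X) := by
  rw [d.nu_lift ht, coord, chartL, if_neg (by simp)]
  simp

theorem isSmoothMap_ext : IsSmoothMap d.ext := by
  refine ⟨d.continuous_ext, fun U f hU hf t X ht hm => ?_⟩
  rw [Set.mem_preimage, d.ext_logParam ht] at hm
  obtain ⟨g, hg, hfg⟩ := hf (d.lift t X) hm
  have hl : lbar (d.lift t X) = (((d.nuCoord (t, X)).2.2.1 : ℝ) : EReal) := by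
    rw [lbar, d.nu_lift ht]
  rw [hl] at hg hfg
  rw [d.coord_nu_lift _ ht] at hg
  have h1 : ∀ᶠ p in 𝓝 (t, X), AnalyticAt ℝ g (d.nuCoord p) :=
    d.contDiff_nuCoord.continuous.continuousAt.eventually hg.eventually_analyticAt
  -- The identity holds only where t ≥ 0. The right-hand side is smooth on a full neighbourhood, and
  -- so is the required extension across t = 0.
  have h2 : ∀ᶠ p in 𝓝 (t, X), 0 ≤ p.1 → f (d.ext (logParam p.1 p.2)) = g (d.nuCoord p) := by
    have hT : Tendsto (fun p : ℝ × ℝ => d.lift p.1 p.2) (𝓝[{p | 0 ≤ p.1}] (t, X))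
        (𝓝 (d.lift t X)) :=
      d.tendsto_lift (p := (t, X)) ht (tendsto_nhdsWithin_of_tendsto_nhds tendsto_id)
        self_mem_nhdsWithin
    have := hT.eventually hfg
    rw [eventually_nhdsWithin_iff] at this
    filter_upwards [this] with p hp hp0
    rw [d.ext_logParam hp0, hp hp0, d.coord_nu_lift _ hp0]
  obtain ⟨V, hV, hVo, hVm⟩ := eventually_nhds_iff.1 (h1.and h2)
  refine ⟨V, g ∘ d.nuCoord, hVo, hVm, fun p hp => ?_, fun t' x' hp ht' _ => ?_⟩
  · exact ((hV p hp).1.contDiffAt.comp p d.contDiff_nuCoord.contDiffAt).contDiffWithinAt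
  · exact (hV _ hp).2 ht'

theorem lbarGam_ext_of_eq_zero {β : LogDisc} (hβ : (β.1 : ℝ) = 0) :
    lbarGam (d.ext β) = ((d.slope : ℝ) : EReal) := by
  change lbar (d.lift (tOf β.1) (argOf β.2)) = _
  rw [hβ, tOf_zero, lbar, d.nu_lift le_rfl]
  simp [nuCoord, iota]

theorem ext_of_ne_zero {β : LogDisc} (hβ : (β.1 : ℝ) ≠ 0) : ∃ (τ : ℂ) (hτ : 0 < τ.im),
    e (τ / d.c) = β.toDisc ∧ d.ext β = (GamD.mk ⟨d.point τ, d.point_mem_D hτ⟩).toGamDII := by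
  have hp := tOf_pos (lt_of_le_of_ne β.1.2.1 (Ne.symm hβ)) β.1.2.2
  refine ⟨d.tau (tOf β.1) (argOf β.2), d.tau_im_pos hp.ne' _, ?_, ?_⟩
  · rw [d.e_tau hp.ne', logParam_tOf β (exp_argOf _)]
  · rw [ext]
    simp only [lift, dif_neg hp.ne']
    rfl

/-- The remainder term of `δ` as a function on `Δ^log`. -/
def restLog (β : LogDisc) : ℝ := d.rest (-(2 * Real.pi) / (d.c * Real.log β.1)) β.toDisc

theorem smoothOnLog_restLog : SmoothOnLog d.restLog Set.univ := by
  intro t x ht _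
  refine ⟨Set.univ, fun p => d.rest (d.iota p.1) (logParam p.1 p.2).toDisc, isOpen_univ, trivial,
    d.contDiff_rest.contDiffOn, fun t' x' _ ht' _ => ?_⟩
  simp only [restLog]
  congr 1
  change -(2 * Real.pi) / (d.c * Real.log (expNegInvGlue (t' ^ 2))) = _
  -- At t' = 0 division by log 0 = 0 gives 0, which agrees with `iota`.
  rcases eq_or_lt_of_le ht' with rfl | h
  · simp [iota]
  · have : ¬ t' ^ 2 ≤ 0 := by
      have : 0 < t' ^ 2 := by positivity
      linarith
    have hc := d.c_pos.ne'
    rw [expNegInvGlue, if_neg this, Real.log_exp, iota]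
    field_simp

theorem delta_point {τ : ℂ} (hτ : 0 < τ.im) {β : LogDisc} (hβ : β.toDisc = e (τ / d.c)) :
    delta (d.point τ) = d.slope * τ.im + d.restLog β := by
  have hc := d.c_pos
  have hpi := Real.pi_pos
  rw [d.point_eq_ptD hτ, delta_ptD hτ (d.spl_mem _ _ _), restLog, hβ]
  -- The radius |q| = exp(-2π Im τ/c) recovers Im τ, so the remainder is a function on Δ^log.
  have hn : (β.1 : ℝ) = Real.exp (-(2 * Real.pi * (τ.im / d.c))) := by
    have h := congrArg norm hβ
    have h0 : (0 : ℝ) ≤ β.1 := β.1.2.1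
    have him : (τ / d.c).im = τ.im / d.c := by
      rw [← Complex.ofReal_natCast, Complex.div_ofReal_im]
    rw [norm_e, him] at h
    simpa [LogDisc.toDisc, abs_of_nonneg h0, Circle.norm_coe] using h
  congr 2
  rw [hn, Real.log_exp]
  field_simp

end PeriodForm

/-! ### Theta functions along sections -/

/-- A zero-free holomorphic function on the unit disc has a holomorphic logarithm. -/
theorem exists_e_eq {u : ℂ → ℂ} (hu : DifferentiableOn ℂ u (Metric.ball 0 1))
    (h0 : ∀ q ∈ Metric.ball (0 : ℂ) 1, u q ≠ 0) :
    ∃ f : ℂ → ℂ, DifferentiableOn ℂ f (Metric.ball 0 1) ∧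
      ∀ q ∈ Metric.ball (0 : ℂ) 1, e (f q) = u q := by
  have hpi := Complex.two_pi_I_ne_zero
  have hmem : (0 : ℂ) ∈ Metric.ball (0 : ℂ) 1 := by simp
  -- With g a primitive of u'/u on the disc, u·exp(-g) has zero derivative, so it is constant.
  obtain ⟨g, hg⟩ := ((hu.deriv Metric.isOpen_ball).div hu h0).isExactOn_ball
  have hu' : ∀ z ∈ Metric.ball (0 : ℂ) 1, HasDerivAt u (deriv u z) z := fun z hz =>
    (hu.differentiableAt (Metric.isOpen_ball.mem_nhds hz)).hasDerivAt
  have hd : ∀ z ∈ Metric.ball (0 : ℂ) 1,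
      HasDerivAt (fun z => u z * Complex.exp (-g z)) 0 z := fun z hz => by
    refine ((hu' z hz).mul (hg z hz).neg.cexp).congr_deriv ?_
    have := h0 z hz
    simp only [Pi.div_apply, Pi.neg_apply]
    field_simp
    ring
  obtain ⟨k, hk⟩ : ∃ k, Complex.exp k = u 0 := ⟨_, Complex.exp_log (h0 0 hmem)⟩
  have hconst : ∀ z ∈ Metric.ball (0 : ℂ) 1, u z * Complex.exp (-g z) = u 0 * Complex.exp (-g 0) :=
    fun z hz => Metric.isOpen_ball.is_const_of_deriv_eq_zero
      (convex_ball (0 : ℂ) 1).isPreconnected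
      (fun z hz => (hd z hz).differentiableAt.differentiableWithinAt) (fun z hz => (hd z hz).deriv)
      hz hmem
  refine ⟨fun z => (g z - g 0 + k) / (2 * Real.pi * Complex.I), ?_, fun z hz => ?_⟩
  · have hgd : DifferentiableOn ℂ g (Metric.ball 0 1) := fun z hz =>
      (hg z hz).differentiableAt.differentiableWithinAt
    fun_prop
  · have := hconst z hz
    rw [e, mul_div_cancel₀ _ hpi, Complex.exp_add, Complex.exp_sub, hk]
    rw [Complex.exp_neg, Complex.exp_neg] at this
    have h1 := Complex.exp_ne_zero (g z)
    have h2 := Complex.exp_ne_zero (g 0)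
    field_simp at this ⊢
    linear_combination -this

/-- On a compact subset |q| attains a maximum below 1 and w is bounded, so a geometric series
dominates and the product converges locally uniformly. -/
theorem differentiableOn_tprod {c : ℕ} (hc : 1 ≤ c) {w : ℂ → ℂ}
    (hw : DifferentiableOn ℂ w (Metric.ball 0 1)) :
    DifferentiableOn ℂ (fun q => ∏' n : ℕ, (1 - (q ^ c) ^ n * w q)) (Metric.ball 0 1) := by
  have key : HasProdLocallyUniformlyOn (fun (n : ℕ) q => 1 - (q ^ c) ^ n * w q)
      (fun q => ∏' n : ℕ, (1 - (q ^ c) ^ n * w q)) (Metric.ball (0 : ℂ) 1) := by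
    simp_rw [sub_eq_add_neg]
    apply hasProdLocallyUniformlyOn_of_forall_compact Metric.isOpen_ball
    intro K hK hcK
    rcases K.eq_empty_or_nonempty with hN | hN
    · simpa [hasProdUniformlyOn_iff_tendstoUniformlyOn, hN] using tendstoUniformlyOn_empty
    · obtain ⟨q₀, hq₀, _, HB⟩ := hcK.exists_sSup_image_eq_and_ge hN
        (show ContinuousOn (fun q : ℂ ↦ ‖q‖) K by fun_prop)
      obtain ⟨M, hM⟩ := hcK.exists_bound_of_continuousOn (hw.continuousOn.mono hK)
      have hq1 : ‖q₀‖ < 1 := by simpa using hK hq₀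
      have hs : Summable fun n : ℕ => (‖q₀‖ ^ c) ^ n * M :=
        (summable_geometric_of_lt_one (by positivity)
          (pow_lt_one₀ (norm_nonneg _) hq1 (by omega))).mul_right _
      refine hs.hasProdUniformlyOn_nat_one_add hcK (.of_forall fun n x hx ↦ ?_) (fun n ↦ ?_)
      · rw [norm_neg, norm_mul, norm_pow, norm_pow]
        have := HB x hx
        have := hM x hx
        gcongr
      · have := hw.continuousOn.mono hK
        fun_prop
  refine key.differentiableOn (.of_forall fun s => ?_) Metric.isOpen_ball
  simpa [Finset.prod_fn] using DifferentiableOn.finsetProd (fun _ _ ↦ by fun_prop)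

/-- `θ(τ, ζ)` in terms of `q = e(τ/c)`, where `e(ζ) = q^κ w`. -/
def thetaFun (c κ : ℕ) (q w : ℂ) : ℂ :=
  (∏' n : ℕ, (1 - (q ^ c) ^ n * (q ^ κ * w))) * ∏' n : ℕ, (1 - (q ^ c) ^ n * (q ^ (c - κ) * w⁻¹))

theorem differentiableOn_thetaFun {c : ℕ} (hc : 1 ≤ c) (κ : ℕ) {w : ℂ → ℂ}
    (hw : DifferentiableOn ℂ w (Metric.ball 0 1)) (h0 : ∀ q ∈ Metric.ball (0 : ℂ) 1, w q ≠ 0) :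
    DifferentiableOn ℂ (fun q => thetaFun c κ q (w q)) (Metric.ball 0 1) := by
  have hw' := hw.inv h0
  exact (differentiableOn_tprod hc (w := fun q => q ^ κ * w q) (by fun_prop)).mul
    (differentiableOn_tprod hc (w := fun q => q ^ (c - κ) * (w q)⁻¹)
      (DifferentiableOn.mul (by fun_prop) hw'))

/-- The second product of θ starts at n = 1, and its extra factor q^c absorbs q^{-κ}. For κ ≤ c no
negative power of q remains, so `thetaFun` makes sense at q = 0. -/
theorem theta_eq_thetaFun {c κ : ℕ} (hc : 1 ≤ c) (hκ : κ ≤ c) {τ ζ w : ℂ}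
    (hζ : e ζ = e (τ / c) ^ κ * w) : theta τ ζ = thetaFun c κ (e (τ / c)) w := by
  have hc0 : (c : ℂ) ≠ 0 := by exact_mod_cast (by omega : c ≠ 0)
  have hτ : e τ = e (τ / c) ^ c := by rw [← e_nat_mul, mul_div_cancel₀ _ hc0]
  have hq := e_ne_zero (τ / c)
  rw [theta, thetaFun, hζ, hτ]
  congr 1
  refine tprod_congr fun n => ?_
  rw [pow_succ, mul_assoc, mul_inv, ← mul_assoc (e (τ / c) ^ c), ← pow_sub₀ _ hq hκ]

/-- At q = 0 all factors are 1, except that for κ = 0 the first factor of the first product is 1 -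
w. -/
theorem thetaFun_zero_ne_zero {c κ : ℕ} (hκ : κ < c) {w : ℂ} (h : κ = 0 → w ≠ 1) :
    thetaFun c κ 0 w ≠ 0 := by
  have hc : c ≠ 0 := by omega
  have hck : c - κ ≠ 0 := by omega
  refine mul_ne_zero (tprod_geometric_ne_zero (by simp [hc]) fun n => ?_)
    (tprod_geometric_ne_zero (by simp [hc]) fun n => ?_)
  · rcases eq_or_ne κ 0 with rfl | hk
    · rcases eq_or_ne n 0 with rfl | hn
      · simpa using h rfl
      · simp [hc, hn]
    · simp [hk]
  · simp [hck]

/-- Every point of the punctured disc is of the form `e(τ/c)`. -/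
theorem exists_e_div_eq {c : ℕ} (hc : 1 ≤ c) {q : ℂ} (h0 : q ≠ 0) (h1 : ‖q‖ < 1) :
    ∃ τ : ℂ, 0 < τ.im ∧ e (τ / c) = q := by
  have hc0 : (c : ℂ) ≠ 0 := by exact_mod_cast (by omega : c ≠ 0)
  have hpi := Complex.two_pi_I_ne_zero
  have he : e (Complex.log q / (2 * Real.pi * Complex.I)) = q := by
    rw [e, mul_div_cancel₀ _ hpi, Complex.exp_log h0]
  set z := Complex.log q / (2 * Real.pi * Complex.I) with hz
  refine ⟨c * z, ?_, by rw [mul_div_cancel_left₀ _ hc0, he]⟩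
  have hn : Real.exp (-(2 * Real.pi * z.im)) < 1 := by rw [← norm_e, he]; exact h1
  rw [Real.exp_lt_one_iff] at hn
  have hzp : 0 < z.im := by
    have := Real.pi_pos
    by_contra h
    have : 2 * Real.pi * z.im ≤ 0 := mul_nonpos_of_nonneg_of_nonpos (by positivity) (not_lt.1 h)
    linarith
  have hcp : (0 : ℝ) < c := by exact_mod_cast hc
  simpa using mul_pos hcp hzp

theorem exists_nat_eq_mul_fract {c : ℕ} (hc : 1 ≤ c) {α : ℚ} (h : ∃ k : ℤ, c * α = k) :
    ∃ κ : ℕ, κ < c ∧ (κ : ℚ) = c * Int.fract α := by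
  obtain ⟨k, hk⟩ := h
  have hcp : (0 : ℚ) < c := by exact_mod_cast hc
  have h1 : ((k - c * ⌊α⌋ : ℤ) : ℚ) = c * Int.fract α := by
    push_cast
    rw [← hk, Int.fract]; ring
  have h2 : 0 ≤ k - c * ⌊α⌋ := by
    have : (0 : ℚ) ≤ ((k - c * ⌊α⌋ : ℤ) : ℚ) := by
      rw [h1]; exact mul_nonneg hcp.le (Int.fract_nonneg _)
    exact_mod_cast this
  obtain ⟨κ, hκ⟩ := Int.eq_ofNat_of_zero_le h2
  rw [hκ] at h1
  refine ⟨κ, ?_, by exact_mod_cast h1⟩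
  have : ((κ : ℤ) : ℚ) < c := by
    rw [h1]
    exact mul_lt_of_lt_one_right hcp (Int.fract_lt_one _)
  exact_mod_cast this

/-- The logarithm of `θ` along the difference of two sections that do not meet. -/
theorem exists_log_theta {c : ℕ} (hc : 1 ≤ c) {a b : ℚ} (ha : ∃ k : ℤ, c * a = k)
    (hb : ∃ k : ℤ, c * b = k) {u v f g : ℂ → ℂ}
    (hf : DifferentiableOn ℂ f (Metric.ball 0 1)) (hg : DifferentiableOn ℂ g (Metric.ball 0 1))
    (hfu : ∀ q ∈ Metric.ball (0 : ℂ) 1, e (f q) = u q)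
    (hgv : ∀ q ∈ Metric.ball (0 : ℂ) 1, e (g q) = v q) (h : DoNotMeet c a u b v) :
    ∃ (κ : ℕ) (l : ℂ → ℂ), (κ : ℚ) = c * Int.fract (a - b) ∧
      DifferentiableOn ℂ l (Metric.ball 0 1) ∧ ∀ τ : ℂ, 0 < τ.im →
        theta τ ((a * τ + f (e (τ / c))) - (b * τ + g (e (τ / c)))) =
          e (((-(⌊a - b⌋ * Int.fract (a - b)) - ⌊a - b⌋ * (⌊a - b⌋ - 1) / 2 : ℚ) : ℂ) * τ +
            (l (e (τ / c)) + ⌊a - b⌋ / 2 - ⌊a - b⌋ * (f (e (τ / c)) - g (e (τ / c))))) := by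
  have hc0 : (c : ℂ) ≠ 0 := by exact_mod_cast (by omega : c ≠ 0)
  have hcq : (c : ℚ) ≠ 0 := by exact_mod_cast (by omega : c ≠ 0)
  have hball : ∀ {τ : ℂ}, 0 < τ.im → e (τ / c) ∈ Metric.ball (0 : ℂ) 1 := fun {τ} hτ => by
    rw [mem_ball_zero_iff]
    apply norm_e_lt_one
    rw [← Complex.ofReal_natCast, Complex.div_ofReal_im]
    have : (0 : ℝ) < c := by exact_mod_cast hc
    positivity
  obtain ⟨κ, hκc, hκ⟩ := exists_nat_eq_mul_fract hc (α := a - b) (by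
    obtain ⟨k, hk⟩ := ha
    obtain ⟨k', hk'⟩ := hb
    exact ⟨k - k', by push_cast; rw [mul_sub, hk, hk']⟩)
  have hab : ((a : ℂ) - b) = ((Int.fract (a - b) : ℚ) : ℂ) + ⌊a - b⌋ := by
    have := Int.fract_add_floor (a - b)
    exact_mod_cast (congrArg (fun x : ℚ => (x : ℂ)) this).symm
  have hκ' : (κ : ℂ) = c * ((Int.fract (a - b) : ℚ) : ℂ) := by
    exact_mod_cast congrArg (fun x : ℚ => (x : ℂ)) hκ
  have hζ : ∀ τ : ℂ, e (((Int.fract (a - b) : ℚ) : ℂ) * τ + (f (e (τ / c)) - g (e (τ / c)))) =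
      e (τ / c) ^ κ * e (f (e (τ / c)) - g (e (τ / c))) := fun τ => by
    rw [e_add, ← e_nat_mul, hκ']
    congr 2
    field_simp
  -- Split a - b into floor and fractional part: quasi-periodicity removes the floor, and the
  -- fractional part gives exponent κ with 0 ≤ κ < c.
  have hth : ∀ {τ : ℂ}, 0 < τ.im →
      theta τ ((a * τ + f (e (τ / c))) - (b * τ + g (e (τ / c)))) =
        e (⌊a - b⌋ / 2 - ⌊a - b⌋ * (((Int.fract (a - b) : ℚ) : ℂ) * τ +
          (f (e (τ / c)) - g (e (τ / c)))) - ⌊a - b⌋ * (⌊a - b⌋ - 1) / 2 * τ) *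
        thetaFun c κ (e (τ / c)) (e (f (e (τ / c)) - g (e (τ / c)))) := fun {τ} hτ => by
    rw [← theta_eq_thetaFun hc hκc.le (hζ τ), ← theta_add_int_mul_tau hτ]
    congr 1
    linear_combination τ * hab
  have hw : DifferentiableOn ℂ (fun q => e (f q - g q)) (Metric.ball 0 1) := by
    unfold e
    fun_prop
  -- A zero at q = 0 would force κ = 0 and u(0) = v(0), i.e. the sections would meet over 0. At q ≠
  -- 0 a zero of θ is a lattice point, i.e. a meeting over Δ^*.
  have hne : ∀ q ∈ Metric.ball (0 : ℂ) 1, thetaFun c κ q (e (f q - g q)) ≠ 0 := by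
    intro q hq
    rcases eq_or_ne q 0 with rfl | hq0
    · refine thetaFun_zero_ne_zero hκc fun hk hw1 => h.2 ⟨?_, ⌊a - b⌋, ?_⟩
      · rw [e_sub, hfu 0 hq, hgv 0 hq] at hw1
        refine (div_eq_one_iff_eq ?_).1 hw1
        rw [← hgv 0 hq]
        exact e_ne_zero _
      · have h0 : Int.fract (a - b) = 0 := by
          rw [hk] at hκ
          simpa [hcq] using hκ.symm
        have := Int.fract_add_floor (a - b)
        rw [h0] at this
        linear_combination -c * this
    · obtain ⟨τ, hτ, rfl⟩ := exists_e_div_eq hc hq0 (mem_ball_zero_iff.1 hq)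
      have := theta_sub_ne_zero h hτ
        (show a * τ + f (e (τ / c)) ∈ sectionLifts c a u τ from ⟨_, 0, 0, hfu _ hq, by simp⟩)
        (show b * τ + g (e (τ / c)) ∈ sectionLifts c b v τ from ⟨_, 0, 0, hgv _ hq, by simp⟩)
      rw [hth hτ] at this
      exact right_ne_zero_of_mul this
  obtain ⟨l, hl, hle⟩ := exists_e_eq
    (differentiableOn_thetaFun hc κ hw fun q _ => e_ne_zero _) hne
  refine ⟨κ, l, hκ, hl, fun τ hτ => ?_⟩
  rw [hth hτ, ← hle _ (hball hτ), ← e_add]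
  congr 1
  push_cast
  ring

theorem exists_int_eq_sum {r : ℕ} {c : ℕ} (m : Fin r → ℤ) {a : Fin r → ℚ}
    (ha : ∀ j, ∃ k : ℤ, c * a j = k) : ∃ k : ℤ, (c : ℝ) * (∑ j, (m j : ℝ) * a j) = k := by
  choose x hx using ha
  refine ⟨∑ j, m j * x j, ?_⟩
  rw [Finset.mul_sum]
  push_cast
  refine Finset.sum_congr rfl fun j _ => ?_
  have : (c : ℝ) * a j = x j := by exact_mod_cast congrArg (fun x : ℚ => (x : ℝ)) (hx j)
  rw [← this]; ring

/-- The period map of two divisors of degree zero. -/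
theorem exists_periodForm (c : ℕ) (hc : 1 ≤ c) {r s : ℕ}
    (m : Fin r → ℤ) (n : Fin s → ℤ) (hm : ∑ j, m j = 0) (hn : ∑ k, n k = 0)
    (a : Fin r → ℚ) (b : Fin s → ℚ)
    (ha : ∀ j, ∃ k : ℤ, c * a j = k) (hb : ∀ j, ∃ k : ℤ, c * b j = k)
    (u : Fin r → ℂ → ℂ) (v : Fin s → ℂ → ℂ)
    (hu : ∀ j, DifferentiableOn ℂ (u j) (Metric.ball 0 1))
    (hv : ∀ k, DifferentiableOn ℂ (v k) (Metric.ball 0 1))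
    (hu0 : ∀ j, ∀ q ∈ Metric.ball (0 : ℂ) 1, u j q ≠ 0)
    (hv0 : ∀ k, ∀ q ∈ Metric.ball (0 : ℂ) 1, v k q ≠ 0)
    (hmeet : ∀ j k, DoNotMeet c (a j) (u j) (b k) (v k)) :
    ∃ d : PeriodForm, d.c = c ∧ d.slope = heightSlope m n a b ∧
      ∀ τ : ℂ, 0 < τ.im → IsPeriod c m n a b u v (e (τ / c)) (d.point τ) := by
  choose f hf hfu using fun j => exists_e_eq (hu j) (hu0 j)
  choose g hg hgv using fun k => exists_e_eq (hv k) (hv0 k)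
  choose κ l hκ hl hth using fun j k =>
    exists_log_theta hc (ha j) (hb k) (hf j) (hg k) (hfu j) (hgv k) (hmeet j k)
  let L : Fin r → Fin s → ℚ := fun j k => -(⌊a j - b k⌋ * Int.fract (a j - b k)) -
    ⌊a j - b k⌋ * (⌊a j - b k⌋ - 1) / 2
  -- c times the fractional part is the integer κ, and the product of two consecutive integers is
  -- even.
  have hL : ∀ j k, ∃ x : ℤ, c * L j k = x := fun j k => by
    obtain ⟨y, hy⟩ := Int.even_mul_pred_self ⌊a j - b k⌋
    have hy' : ((⌊a j - b k⌋ : ℚ)) * (⌊a j - b k⌋ - 1) = y + y := by exact_mod_cast hy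
    refine ⟨-(⌊a j - b k⌋ * κ j k) - c * y, ?_⟩
    simp only [L]
    push_cast
    rw [hκ, hy']
    ring
  choose x hx using hL
  obtain ⟨cA, hcA⟩ := exists_int_eq_sum m ha
  obtain ⟨cB, hcB⟩ := exists_int_eq_sum n hb
  let d : PeriodForm :=
    { c := c
      hc := hc
      A := ∑ j, (m j : ℝ) * a j
      B := ∑ k, (n k : ℝ) * b k
      Lam := ∑ j, ∑ k, (m j : ℝ) * n k * L j k
      φ := fun q => ∑ j, m j * f j q
      ψ := fun q => ∑ k, n k * g k q
      μ := fun q => ∑ j, ∑ k, ((m j * n k : ℤ) : ℂ) *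
        (l j k q + ⌊a j - b k⌋ / 2 - ⌊a j - b k⌋ * (f j q - g k q))
      hφ := DifferentiableOn.fun_sum fun j _ => (hf j).const_mul _
      hψ := DifferentiableOn.fun_sum fun k _ => (hg k).const_mul _
      hμ := DifferentiableOn.fun_sum fun j _ => DifferentiableOn.fun_sum fun k _ =>
        (((hl j k).add_const _).sub (((hf j).sub (hg k)).const_mul _)).const_mul _
      cA := cA
      cB := cB
      cLam := ∑ j, ∑ k, m j * n k * x j k
      hA := hcA
      hB := hcB
      hLam := by
        simp only [Finset.mul_sum]
        push_cast
        refine Finset.sum_congr rfl fun j _ => Finset.sum_congr rfl fun k _ => ?_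
        have : (c : ℝ) * L j k = x j k := by
          exact_mod_cast congrArg (fun x : ℚ => (x : ℝ)) (hx j k)
        rw [← this]; ring }
  refine ⟨d, rfl, ?_, fun τ hτ => ?_⟩
  · have hm' : ∑ j, (m j : ℝ) = 0 := by exact_mod_cast hm
    have hn' : ∑ k, (n k : ℝ) = 0 := by exact_mod_cast hn
    -- Put N = ⌊a - b⌋ and f = {a - b}. Then -Nf - N(N-1)/2 = (f² - (N+f)²)/2 + ((N+f) - f)/2;
    -- expanding with N + f = a - b isolates B₂(f)/2 and ab. The products ab sum to AB, which the
    -- slope subtracts, and degree zero removes the rest.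
    have hLr : ∀ j k, (L j k : ℝ) = (-(a j : ℝ) ^ 2 / 2 + a j / 2 - 1 / 12) +
        (-(b k : ℝ) ^ 2 / 2 - b k / 2) +
        (1 / 2 * B2 (Int.fract ((a j : ℝ) - b k)) + a j * b k) := fun j k => by
      have h1 : Int.fract ((a j : ℝ) - b k) = ((Int.fract (a j - b k) : ℚ) : ℝ) := by
        rw [Rat.cast_fract, Rat.cast_sub]
      have h2 : (⌊a j - b k⌋ : ℝ) = a j - b k - ((Int.fract (a j - b k) : ℚ) : ℝ) := by
        have := congrArg (fun x : ℚ => (x : ℝ)) (Int.fract_add_floor (a j - b k))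
        push_cast at this ⊢
        linarith
      rw [h1]
      simp only [L, B2]
      rw [Rat.cast_sub, Rat.cast_neg, Rat.cast_mul, Rat.cast_div, Rat.cast_mul, Rat.cast_sub,
        Rat.cast_intCast, h2]
      push_cast
      ring
    change ∑ j, ∑ k, (m j : ℝ) * n k * L j k - (∑ j, (m j : ℝ) * a j) * ∑ k, (n k : ℝ) * b k = _
    simp only [hLr]
    rw [sum_sum_of_degree_zero hm' hn', ← sum_sum_mul, ← Finset.sum_sub_distrib, heightSlope,
      Finset.mul_sum]
    refine Finset.sum_congr rfl fun j _ => ?_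
    rw [← Finset.sum_sub_distrib, Finset.mul_sum]
    exact Finset.sum_congr rfl fun k _ => by ring
  · have hq : e (τ / c) ∈ Metric.ball (0 : ℂ) 1 := by
      rw [mem_ball_zero_iff]
      apply norm_e_lt_one
      rw [← Complex.ofReal_natCast, Complex.div_ofReal_im]
      have : (0 : ℝ) < c := by exact_mod_cast hc
      positivity
    refine ⟨τ, fun j => a j * τ + f j (e (τ / c)), fun k => b k * τ + g k (e (τ / c)),
      d.Lam * τ + d.μ (e (τ / c)), hτ, rfl, fun j => ⟨_, 0, 0, hfu j _ hq, by simp⟩,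
      fun k => ⟨_, 0, 0, hgv k _ hq, by simp⟩, ?_, ?_⟩
    · have : d.Lam * τ + d.μ (e (τ / c)) = ∑ j, ∑ k, ((m j * n k : ℤ) : ℂ) * ((L j k : ℂ) * τ +
          (l j k (e (τ / c)) + ⌊a j - b k⌋ / 2 -
            ⌊a j - b k⌋ * (f j (e (τ / c)) - g k (e (τ / c))))) := by
        simp only [d]
        push_cast
        simp only [Finset.sum_mul, ← Finset.sum_add_distrib]
        exact Finset.sum_congr rfl fun j _ => Finset.sum_congr rfl fun k _ => by ring
      rw [this, e_sum]
      refine Finset.prod_congr rfl fun j _ => ?_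
      rw [e_sum]
      refine Finset.prod_congr rfl fun k _ => ?_
      rw [e_int_mul, hth j k τ hτ]
    · simp only [PeriodForm.point, d]
      push_cast
      simp only [Finset.sum_mul, ← Finset.sum_add_distrib]
      congr 1 <;> exact Finset.sum_congr rfl fun j _ => by ring

end ExIV

end

open ExIV in
theorem proposition4p4p8 (c : ℕ) (hc : 1 ≤ c) {r s : ℕ}
    (m : Fin r → ℤ) (n : Fin s → ℤ) (hm : ∑ j, m j = 0) (hn : ∑ k, n k = 0)
    (a : Fin r → ℚ) (b : Fin s → ℚ)
    (ha : ∀ j, ∃ k : ℤ, c * a j = k) (hb : ∀ j, ∃ k : ℤ, c * b j = k)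
    (u : Fin r → ℂ → ℂ) (v : Fin s → ℂ → ℂ)
    (hu : ∀ j, DifferentiableOn ℂ (u j) (Metric.ball 0 1))
    (hv : ∀ k, DifferentiableOn ℂ (v k) (Metric.ball 0 1))
    (hu0 : ∀ j, ∀ q ∈ Metric.ball (0 : ℂ) 1, u j q ≠ 0)
    (hv0 : ∀ k, ∀ q ∈ Metric.ball (0 : ℂ) 1, v k q ≠ 0)
    (hmeet : ∀ j k, DoNotMeet c (a j) (u j) (b k) (v k)) :
    -- the period map `p : Δ^* → Γ \ D`, independent of the choices of lifts and logarithms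
    ∃ p : DiscStar → GamD,
      (∀ q : DiscStar, (∃ F, IsPeriod c m n a b u v q.1 F) ∧
        ∀ F, IsPeriod c m n a b u v q.1 F → ∃ hF : F ∈ D, p q = GamD.mk ⟨F, hF⟩) ∧
      -- (ii)
      (∃ δ : GamD → ℝ, (∀ F : D, δ (GamD.mk F) = delta F.1) ∧
        ∃ h : LogDisc → ℝ, SmoothOnLog h Set.univ ∧
          ∀ (x y : ℝ) (_ : 0 < y) (β : LogDisc) (hβ : (β.1 : ℝ) ≠ 0),
            β.toDisc = e ((x + Complex.I * y) / c) →
              δ (p (β.toStar hβ)) = heightSlope m n a b * y + h β) ∧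
      -- (i) and (iii)
      ∃ lΓ : GamDII → EReal, (∀ x : DII, lΓ (GamDII.mk x) = lbar x) ∧
        ∃ P : LogDisc → GamDII, IsSmoothMap P ∧
          (∀ (β : LogDisc) (hβ : (β.1 : ℝ) ≠ 0) (F : D),
            p (β.toStar hβ) = GamD.mk F → P β = GamDII.mk (DII.ofD F)) ∧
          ∀ β : LogDisc, (β.1 : ℝ) = 0 → lΓ (P β) = ((heightSlope m n a b : ℝ) : EReal) := by
  obtain ⟨d, rfl, hslope, hper⟩ :=
    exists_periodForm c hc m n hm hn a b ha hb u v hu hv hu0 hv0 hmeet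
  have hexists : ∀ q : DiscStar, ∃ τ : ℂ, 0 < τ.im ∧ e (τ / d.c) = q.1 := fun q =>
    exists_e_div_eq hc q.2.1 q.2.2
  choose T hT hTq using hexists
  have hD : ∀ {q F}, IsPeriod d.c m n a b u v q F → F ∈ D := by
    rintro q F ⟨τ, z, w, lam, hτ, -, -, -, -, rfl⟩
    exact filF_mem_D hτ _ _ _
  have hmk : ∀ {q F F'} (hF : IsPeriod d.c m n a b u v q F) (hF' : IsPeriod d.c m n a b u v q F'),
      GamD.mk ⟨F, hD hF⟩ = GamD.mk ⟨F', hD hF'⟩ := fun hF hF' =>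
    Quot.sound (exists_act_of_isPeriod hc hm hn ha hb hF hF')
  have hperT : ∀ q : DiscStar, IsPeriod d.c m n a b u v q.1 (d.point (T q)) := fun q => by
    rw [← hTq q]
    exact hper _ (hT q)
  -- The period map is defined through one chosen τ over each q; `hmk` compares it with any other
  -- admissible period.
  refine ⟨fun q => GamD.mk ⟨d.point (T q), hD (hperT q)⟩,
    fun q => ⟨⟨_, hperT q⟩, fun F hF => ⟨hD hF, hmk (hperT q) hF⟩⟩, ?_, ?_⟩
  · refine ⟨Quot.lift (fun F : D => delta F.1) ?_, fun F => rfl, d.restLog,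
      d.smoothOnLog_restLog, fun x y hy β hβ hβe => ?_⟩
    · rintro F F' ⟨γ, hγ, h⟩
      simp only [h]
      exact (delta_act hγ F.2).symm
    · have him : (x + Complex.I * y : ℂ).im = y := by simp
      have hτ : 0 < (x + Complex.I * y : ℂ).im := by rw [him]; exact hy
      have hp := hper _ hτ
      rw [← hβe] at hp
      beta_reduce
      rw [hmk (hperT (β.toStar hβ)) hp]
      change delta (d.point _) = _
      rw [d.delta_point hτ hβe, hslope, him]
  · refine ⟨lbarGam, fun x => rfl, d.ext, d.isSmoothMap_ext, fun β hβ F hF => ?_, fun β hβ => ?_⟩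
    · obtain ⟨τ, hτ, hβe, hext⟩ := d.ext_of_ne_zero hβ
      have hp := hper _ hτ
      rw [hβe] at hp
      rw [hext, (hmk (hperT (β.toStar hβ)) hp).symm.trans hF]
      rfl
    · rw [d.lbarGam_ext_of_eq_zero hβ, hslope]
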